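/- Work in $\mathsf{ZF}$ (without choice; that is, the statement is asserted inside an arbitrary model of first-order $\mathsf{ZF}$). Ordered pairs are Quine–Rosser pairs $\lceil x,y\rceil=\{s[u]:u\in x\}\cup\{s[u]\cup\{\emptyset\}:u\in y\}$, where $s(n)=n+1$ for $n<\omega$ and $s(u)=u$ for $u\notin\omega$; functions and relations are sets of such pairs. Let $\eta$ be an infinite even ordinal, i.e. $\eta=\lambda+2n$ with $\lambda$ a nonzero limit ordinal and $n<\omega$. Let $j:V_{\eta+2}\to V_{\eta+2}$ be $\Sigma_0$-elementary with $j(V_{\eta+1})=V_{\eta+1}$. Let $$\mu=\mu_j=\{\sigma\subseteq V_{\eta+1} : j{\upharpoonright}V_\eta\in j(\sigma)\}.$$ For $\beta\in\{\eta+2,\eta+3\}$ let $\mathrm{Ult}(V_\beta,\mu)$ be the structure of all classes $[f]$ of functions $f:V_{\eta+1}\to V_\beta$ modulo equality on a set in $\mu$, with $[f]\in^{\mathrm{Ult}}[g]$ iff $\{x : f(x)\in g(x)\}\in\mu$; the ultrapower map sends $x\in V_\beta$ to the class of the constant function with value $x$. Write $U=\mathrm{Ult}(V_{\eta+2},\mu)$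 and $\widetilde U=\mathrm{Ult}(V_{\eta+3},\mu)$, with ultrapower maps $i_\mu$ and $\widetilde i_\mu$. Let $\mathscr E(V_\eta)$ be the set of all elementary maps $k:V_\eta\to V_\eta$, and let $H$ be the set of all elements of $V_{\eta+2}$ that are definable over $(V_{\eta+2},\in)$ from parameters in $\mathrm{rg}(j)\cup\{j{\upharpoonright}V_\eta\}$. For a relation $R\subseteq\mathscr E(V_\eta)\times V_{\eta+2}$, a $\mu$-uniformization of $R$ is a function $f$ with domain $\mathscr E(V_\eta)$ such that the set of those $k\in\mathscr E(V_\eta)$ for which $\exists x\,[(k,x)\in R]$ implies $(k,f(k))\in R$ belongs to $\mu$. Then: 1. $U$ is extensional and wellfounded, and $U\cong H=V_{\eta+2}$. 2. After identifying $U$ with its transitive collapse $V_{\eta+2}$, we have $i_\mu=j$. 3. $j$ is $\Sigma_1$-elementary. 4. $\widetilde U$ is wellfounded. 5. The following are equivalent: (a) $\widetilde U$ is extensional; (b) $j$ extends to a $\Sigma_0$-elementary map $\ell:V_{\eta+3}\to V_{\eta+3}$; (c) every relation $R\subseteq\mathscr E(V_\eta)\times V_{\eta+2}$ has a $\mu$-uniformization.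 6. If $\ell:V_{\eta+3}\to V_{\eta+3}$ is a $\Sigma_0$-elementary extension of $j$ then, after identifying $\widetilde U$ with its transitive collapse, $V_{\eta+2}\subsetneq\widetilde U\subseteq V_{\eta+3}$, $\ell=\widetilde i_\mu$ and $\ell(V_{\eta+2})=V_{\eta+2}$. -/

import Mathlib

/-!
# Models of ZF and ultrapowers of rank segments inside them

The ambient theory is `ZF` without choice, and the sets of the metatheory satisfy choice.  So
everything is developed inside an arbitrary model `(M, ∈)` of first-order `ZF`.  Sets, functions,
formulas, satisfaction and ultrapowers are elements of `M`, and every quantifier in the definitions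
below ranges over `M`: each notion is the usual set-theoretic one, as computed in `M`.
-/

universe u

namespace ZFM

/-- The relation symbols of the language of set theory: one binary symbol. -/
inductive SetRel : ℕ → Type
  | mem : SetRel 2

/-- The first-order language of set theory. -/
def setLang : FirstOrder.Language.{0, 0} := ⟨fun _ => Empty, SetRel⟩

/-- A type with a membership relation is a structure for the language of set theory. -/
instance setStructure (M : Type u) [Membership M M] : setLang.Structure M where
  funMap := fun f _ => nomatch f
  RelMap := fun r => match r with
    | SetRel.mem => fun w => w 0 ∈ w 1

/-- `(M, ∈)` is a model of first-order `ZF` (no choice).  Separation and Replacement are the usual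
schemata: they speak about classes that are first-order definable over `(M, ∈)` with parameters. -/
class ZFModel (M : Type u) extends Membership M M where
  extensionality : ∀ x y : M, (∀ z : M, z ∈ x ↔ z ∈ y) → x = y
  foundation : ∀ x : M, (∃ y : M, y ∈ x) → ∃ y : M, y ∈ x ∧ ∀ z : M, z ∈ x → z ∉ y
  pairing : ∀ x y : M, ∃ p : M, ∀ z : M, z ∈ p ↔ z = x ∨ z = y
  union : ∀ x : M, ∃ y : M, ∀ z : M, z ∈ y ↔ ∃ w : M, w ∈ x ∧ z ∈ w
  powerset : ∀ x : M, ∃ y : M, ∀ z : M, z ∈ y ↔ ∀ w : M, w ∈ z → w ∈ x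
  infinity : ∃ w : M, (∃ e : M, (∀ x : M, x ∉ e) ∧ e ∈ w) ∧
    ∀ x : M, x ∈ w → ∃ y : M, y ∈ w ∧ ∀ z : M, z ∈ y ↔ z ∈ x ∨ z = x
  separation : ∀ P : Set M, (Set.univ : Set M).Definable₁ setLang P →
    ∀ a : M, ∃ b : M, ∀ x : M, x ∈ b ↔ x ∈ a ∧ x ∈ P
  replacement : ∀ F : Set (M × M), (Set.univ : Set M).Definable₂ setLang F →
    ∀ a : M, (∀ x y z : M, x ∈ a → (x, y) ∈ F → (x, z) ∈ F → y = z) →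
      ∃ b : M, ∀ y : M, y ∈ b ↔ ∃ x : M, x ∈ a ∧ (x, y) ∈ F

section Basics

variable {M : Type u} [ZFModel M]

instance : Nonempty M := ⟨(ZFModel.infinity (M := M)).choose⟩

/-- `{x | P x}` as an element of `M`.  It is used only for classes that `ZF` proves to be sets. -/
noncomputable def theSet (P : M → Prop) : M :=
  Classical.epsilon fun b : M => ∀ x : M, x ∈ b ↔ P x

/-- `a ⊆ b`. -/
def Sub (a b : M) : Prop := ∀ x : M, x ∈ a → x ∈ b

/-- The empty set. -/
noncomputable def empty : M := theSet fun _ => False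

/-- `x ∪ {x}`. -/
noncomputable def succ (x : M) : M := theSet fun z => z ∈ x ∨ z = x

/-- The power set. -/
noncomputable def power (a : M) : M := theSet fun z => Sub z a

/-- Transitive sets. -/
def IsTrans (x : M) : Prop := ∀ y : M, y ∈ x → Sub y x

/-- Ordinals: transitive sets which are linearly ordered by `∈`. -/
def IsOrd (x : M) : Prop :=
  IsTrans x ∧ ∀ y z : M, y ∈ x → z ∈ x → y ∈ z ∨ y = z ∨ z ∈ y

/-- (Nonzero) limit ordinals. -/
def IsLim (x : M) : Prop :=
  IsOrd x ∧ x ≠ empty ∧ ∀ y : M, y ∈ x → succ y ∈ x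

/-- Natural numbers of `M`: ordinals `n` such that every ordinal `≤ n` is zero or a successor. -/
def IsNat (n : M) : Prop :=
  IsOrd n ∧ ∀ m : M, m ∈ succ n → m = empty ∨ ∃ k : M, m = succ k

/-- The set `ω` of `M`. -/
noncomputable def omega : M := theSet IsNat

/-- Infinite even ordinals: `η = lam + 2n` with `lam` a limit ordinal and `n < ω`, that is, `η`
lies in every set which contains `lam` and is closed under `β ↦ β + 2`. -/
def IsInfEven (η : M) : Prop :=
  ∃ lam : M, IsLim lam ∧
    ∀ C : M, lam ∈ C → (∀ β : M, β ∈ C → succ (succ β) ∈ C) → η ∈ C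

/-! ### The flat (Quine-Rosser) pairing function, and functions as sets of such pairs -/

open Classical in
/-- `s(n) = n + 1` for `n < ω`, and `s(u) = u` for `u ∉ ω`. -/
noncomputable def shift (t : M) : M := if t ∈ (omega : M) then succ t else t

/-- `f₀(u) = s``u`. -/
noncomputable def code0 (u : M) : M := theSet fun z => ∃ t : M, t ∈ u ∧ z = shift t

/-- `f₁(u) = s``u ∪ {∅}`. -/
noncomputable def code1 (u : M) : M :=
  theSet fun z => (∃ t : M, t ∈ u ∧ z = shift t) ∨ z = empty

/-- The Quine-Rosser pair `⌈x, y⌉ = f₀``x ∪ f₁``y`.  All ordered pairs below are of this kind, so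
that functions from an infinite `V_α` to itself are elements of `V_{α+1}`. -/
noncomputable def pr (x y : M) : M :=
  theSet fun z => (∃ t : M, t ∈ x ∧ z = code0 t) ∨ (∃ t : M, t ∈ y ∧ z = code1 t)

/-- `f` is a function from `a` to `b`, as a set of pairs. -/
def IsFunc (f a b : M) : Prop :=
  (∀ p : M, p ∈ f → ∃ x y : M, x ∈ a ∧ y ∈ b ∧ p = pr x y) ∧
    ∀ x : M, x ∈ a → ∃! y : M, pr x y ∈ f

/-- The value `f(x)`, for `x` in the domain of `f`. -/
noncomputable def app (f x : M) : M := Classical.epsilon fun y : M => pr x y ∈ f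

/-- The restriction of the function `f` to the set `a`. -/
noncomputable def restrict (f a : M) : M :=
  theSet fun p => p ∈ f ∧ ∃ x y : M, x ∈ a ∧ p = pr x y

/-- `v = V_η`, for an ordinal `η`: `v` is the last value of a function on `η + 1` that obeys the
recursion `V_0 = ∅`, `V_{α+1} = 𝒫(V_α)`, and `V_α = ⋃_{β<α} V_β` for limit `α`. -/
def IsVLevel (η v : M) : Prop :=
  ∃ f b : M, IsFunc f (succ η) b ∧ app f empty = empty ∧
    (∀ α : M, α ∈ η → app f (succ α) = power (app f α)) ∧
    (∀ α : M, α ∈ succ η → IsLim α →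
      app f α = theSet fun x => ∃ β : M, β ∈ α ∧ x ∈ app f β) ∧
    app f η = v

/-! ### Formulas of `M` and satisfaction in structures `(A, ∈)` with `A ∈ M` -/

/-- The numerals `0, …, 4` of `M`. -/
noncomputable def num : ℕ → M
  | 0 => empty
  | n + 1 => succ (num n)

/-- The formula `v_m ∈ v_n`. -/
noncomputable def fMem (m n : M) : M := pr (num 0) (pr m n)

/-- The formula `v_m = v_n`. -/
noncomputable def fEq (m n : M) : M := pr (num 1) (pr m n)

/-- The formula `¬ φ`. -/
noncomputable def fNot (φ : M) : M := pr (num 2) φ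

/-- The formula `φ ∧ ψ`. -/
noncomputable def fAnd (φ ψ : M) : M := pr (num 3) (pr φ ψ)

/-- The formula `∃ v_m φ`. -/
noncomputable def fEx (m φ : M) : M := pr (num 4) (pr m φ)

/-- `C` contains the atomic formulas and is closed under negation and conjunction. -/
def BoolClosed (C : M) : Prop :=
  (∀ m n : M, m ∈ (omega : M) → n ∈ (omega : M) → fMem m n ∈ C ∧ fEq m n ∈ C) ∧
    (∀ φ : M, φ ∈ C → fNot φ ∈ C) ∧
    (∀ φ ψ : M, φ ∈ C → ψ ∈ C → fAnd φ ψ ∈ C)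

/-- `φ` is a formula of the language of set theory (in the sense of `M`). -/
def IsFml (φ : M) : Prop :=
  ∀ C : M, BoolClosed C → (∀ m ψ : M, m ∈ (omega : M) → ψ ∈ C → fEx m ψ ∈ C) → φ ∈ C

/-- `φ` is a `Σ₀` formula: all quantifiers are bounded, `∃ v_m ∈ v_n ψ` being
`∃ v_m (v_m ∈ v_n ∧ ψ)` for distinct variables. -/
def IsSigma0 (φ : M) : Prop :=
  ∀ C : M, BoolClosed C →
    (∀ m n ψ : M, m ∈ (omega : M) → n ∈ (omega : M) → m ≠ n → ψ ∈ C →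
      fEx m (fAnd (fMem m n) ψ) ∈ C) → φ ∈ C

/-- `φ` is a `Σ₁` formula: a finite string of existential quantifiers and then a `Σ₀` formula. -/
def IsSigma1 (φ : M) : Prop :=
  ∀ C : M, (∀ ψ : M, IsSigma0 ψ → ψ ∈ C) →
    (∀ m ψ : M, m ∈ (omega : M) → ψ ∈ C → fEx m ψ ∈ C) → φ ∈ C

/-- The assignments `s` and `t` agree, except possibly at the variable `v_m`. -/
def AgreeOff (m s t : M) : Prop :=
  ∀ i : M, i ∈ (omega : M) → i ≠ m → app t i = app s i

/-- `S` is a satisfaction relation for `(A, ∈)`: a set of pairs of formulas and assignments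
`ω → A` which obeys Tarski's clauses. -/
def IsSatRel (A S : M) : Prop :=
  ∀ s : M, IsFunc s omega A →
    (∀ m n : M, m ∈ (omega : M) → n ∈ (omega : M) →
      (pr (fMem m n) s ∈ S ↔ app s m ∈ app s n)) ∧
    (∀ m n : M, m ∈ (omega : M) → n ∈ (omega : M) →
      (pr (fEq m n) s ∈ S ↔ app s m = app s n)) ∧
    (∀ φ : M, IsFml φ → (pr (fNot φ) s ∈ S ↔ pr φ s ∉ S)) ∧
    (∀ φ ψ : M, IsFml φ → IsFml ψ →
      (pr (fAnd φ ψ) s ∈ S ↔ pr φ s ∈ S ∧ pr ψ s ∈ S)) ∧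
    (∀ m φ : M, m ∈ (omega : M) → IsFml φ →
      (pr (fEx m φ) s ∈ S ↔ ∃ t : M, IsFunc t omega A ∧ AgreeOff m s t ∧ pr φ t ∈ S))

/-- `(A, ∈) ⊨ φ[s]`. -/
def Sat (A φ s : M) : Prop := ∃ S : M, IsSatRel A S ∧ pr φ s ∈ S

/-- `j : A → A` is elementary with respect to all formulas in the class `Γ`. -/
def IsElemFor (Γ : M → Prop) (A j : M) : Prop :=
  IsFunc j A A ∧
    ∀ φ : M, Γ φ → ∀ s t : M, IsFunc s omega A → IsFunc t omega A →
      (∀ i : M, i ∈ (omega : M) → app t i = app j (app s i)) → (Sat A φ s ↔ Sat A φ t)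

/-- The set `ℰ(A)` of all (fully) elementary maps `A → A`. -/
noncomputable def elemMaps (A : M) : M := theSet fun k => IsElemFor IsFml A k

/-- `Hull^A(X)`: the set of all `x ∈ A` which are definable over `(A, ∈)` from parameters in `X`.
The defining formula describes the value of `v_0`; the other variables are parameters. -/
noncomputable def hull (A X : M) : M :=
  theSet fun x => x ∈ A ∧ ∃ φ s : M, IsFml φ ∧ IsFunc s omega A ∧
    (∀ i : M, i ∈ (omega : M) → i ≠ empty → app s i ∈ X) ∧
    ∀ t : M, IsFunc t omega A → AgreeOff empty s t → (Sat A φ t ↔ app t empty = x)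

/-! ### Set structures `(A, E)` and ultrapowers -/

/-- `(A, E)` is extensional. -/
def IsExtensional (A : M) (E : M → M → Prop) : Prop :=
  ∀ x y : M, x ∈ A → y ∈ A → x ≠ y → ∃ z : M, z ∈ A ∧ (E z x ↔ ¬ E z y)

/-- `(A, E)` is wellfounded: every nonempty subset has an `E`-minimal element. -/
def IsWellFd (A : M) (E : M → M → Prop) : Prop :=
  ∀ S : M, Sub S A → (∃ x : M, x ∈ S) → ∃ x : M, x ∈ S ∧ ∀ y : M, y ∈ S → ¬ E y x

/-- `T` is the transitive collapse of `(A, E)` and `π : (A, E) ≅ (T, ∈)` the collapse map (both are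
unique). -/
def IsCollapse (A : M) (E : M → M → Prop) (T π : M) : Prop :=
  IsTrans T ∧ IsFunc π A T ∧ (∀ y : M, y ∈ T → ∃ x : M, x ∈ A ∧ app π x = y) ∧
    (∀ x y : M, x ∈ A → y ∈ A → app π x = app π y → x = y) ∧
    (∀ x y : M, x ∈ A → y ∈ A → (E x y ↔ app π x ∈ app π y))

/-- The equivalence class `[f]` of `f : X → B` modulo the ultrafilter `F` over `X`: the set of all
`g : X → B` with `f(x) = g(x)` for `F`-almost all `x`. -/
noncomputable def ultClass (X B F f : M) : M :=
  theSet fun g => IsFunc g X B ∧ (theSet fun x : M => x ∈ X ∧ app f x = app g x) ∈ F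

/-- The universe of the ultrapower `Ult(B, F)`. -/
noncomputable def ult (X B F : M) : M :=
  theSet fun c => ∃ f : M, IsFunc f X B ∧ c = ultClass X B F f

/-- The membership relation of `Ult(B, F)`: `[f] ∈ [g]` iff `f(x) ∈ g(x)` for `F`-almost all
`x`. -/
def ultMem (X B F : M) (c d : M) : Prop :=
  ∃ f g : M, IsFunc f X B ∧ IsFunc g X B ∧ c = ultClass X B F f ∧ d = ultClass X B F g ∧
    (theSet fun x : M => x ∈ X ∧ app f x ∈ app g x) ∈ F

/-- The ultrapower map `B → Ult(B, F)`, which sends `b` to the class of the constant function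
`X → {b}`. -/
noncomputable def ultMap (X B F b : M) : M :=
  ultClass X B F (theSet fun p => ∃ x : M, x ∈ X ∧ p = pr x b)

/-- The ultrafilter over `X` derived from `j` with seed `s`: the set of all `σ ⊆ X` with
`s ∈ j(σ)`. -/
noncomputable def derivedUF (X j s : M) : M := theSet fun σ => Sub σ X ∧ s ∈ app j σ

/-- `f` is an `F`-uniformization of the relation `R`, whose left field is contained in `D`:
`f` is a function on `D`, and for `F`-almost all `k ∈ D`, if `(k, x) ∈ R` for some `x` then
`(k, f(k)) ∈ R`. -/
def IsUniformization (D F R f : M) : Prop :=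
  (∃ b : M, IsFunc f D b) ∧
    (theSet fun k : M => k ∈ D ∧ ((∃ x : M, pr k x ∈ R) → pr k (app f k) ∈ R)) ∈ F

end Basics

end ZFM

set_option synthInstance.maxHeartbeats 1000000
set_option synthInstance.maxSize 100000

namespace ZFM

open Set

/-! Write c for the seed j↾V_η and f_d for the section {t ∈ V_{η+1} : (d,t) ∈ f} of a relation f.
Everything rests on one fact (`represents_even`): each w ⊆ V_{η+1} has the form j(f)_c for some f ⊆
V_{η+1}. Flat pairs keep c and such relations f at the right rank. If j↾V_{η+1} is definable from c
by a bounded predicate Φ, uniformly and with parameters fixed by j, then f = {(k,y) : some z ∈ w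
satisfies Φ(k,y,z)} works, because (c,y) ∈ j(f) iff j(y) ∈ j(w) (`Fixed.represents_of`). Such a
definition is found by induction on even levels. At a limit, j(y) is the union of all j(b) with b ∈
V_η and b ⊆ y. Two levels up, the inductive hypothesis writes any w ∈ V_{η+2} as j(f)_c, and then w
∈ j(y) iff c ∈ j({x : f_x ∈ y}); both j(f) and this last set are values of j↾V_{η+2}, which also
determines c.

A function f : V_{η+1} → V_{η+2} is coded by the relation {(k,y) : y ∈ f(k)}, and `rho` sends f to
the section at c of the j-image of its code. Bounded elementarity makes `rho` respect equality and
membership modulo μ; representation makes it onto V_{η+2}; constant functions go to the values of j.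
This yields U ≅ V_{η+2} and i_μ = j, and the formula w = j(f)_c also gives the hull statement.

Choice is avoided in Łoś's theorem by uniformizing relations with values in V_{η+1}: if j(R)_c has
an element, a function representing it uniformizes R almost everywhere, and otherwise R_k is empty
for almost all k (`hasUnif_power`). Łoś's theorem for bounded formulas follows (`Repr.tr_iff`).
Reflecting an existential statement to almost all coordinates only requires representing a given
witness, so j is Σ₁-elementary.

For V_{η+3}, members of an element of the ultrapower are represented by functions into V_{η+2},
which `rho` maps into a genuine ∈-relation; hence wellfoundedness. Extensionality, applied to the
class of k ↦ R_k and the class of ∅, gives uniformization into V_{η+2}. Conversely, uniformization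
makes `rho₃` injective on classes and gives Łoś's theorem one level higher, so x ↦ `rho₃` of the
constant function x extends j. Finally, an extension ℓ fixes V_{η+2}, since V_{η+2} is closed under
sections, and an element of ℓ(R)_c is again represented by a uniformizing function. The relations
may be restricted to elementary maps k because satisfaction for V_η is fixed by j, so that almost
every k is elementary.

Separation and Replacement hold in M only for definable classes; the classes `Df`, `DfT` and `D0`
derive definability, and bounded definability, from the shape of an expression. -/

/-! ### Definability over `M`, with parameters -/

/-- `E` is a finite power of `M`, written as an iterated product. -/
class Env (M : Type u) (E : Type u) where
  dim : ℕ
  eqv : E ≃ (Fin dim → M)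

instance envBase (M : Type u) : Env M M := ⟨1, (Equiv.funUnique (Fin 1) M).symm⟩

instance envNil (M : Type u) : Env M PUnit.{u + 1} := ⟨0, Equiv.ofUnique _ _⟩

instance envProd (M E : Type u) [Env M E] : Env M (E × M) :=
  ⟨Env.dim M E + 1,
    ((Equiv.prodComm E M).trans ((Equiv.refl M).prodCongr Env.eqv)).trans
      (Fin.snocEquiv fun _ => M)⟩

theorem eqv_prod_last {M E : Type u} [Env M E] (e : E × M) :
    Env.eqv (M := M) e (Fin.last (Env.dim M E)) = e.2 := by
  change Fin.snoc (α := fun _ => M) (Env.eqv e.1) e.2 (Fin.last _) = e.2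
  simp

theorem eqv_prod_castSucc {M E : Type u} [Env M E] (e : E × M) (i : Fin (Env.dim M E)) :
    Env.eqv (M := M) e i.castSucc = Env.eqv e.1 i := by
  change Fin.snoc (α := fun _ => M) (Env.eqv e.1) e.2 i.castSucc = _
  simp

/-- Maps between environments that select coordinates. -/
class Proj (M : Type u) {E F : Type u} [Env M E] [Env M F] (p : E → F) : Prop where
  out : ∃ σ : Fin (Env.dim M F) → Fin (Env.dim M E), ∀ e i,
    (Env.eqv (p e) : _ → M) i = Env.eqv e (σ i)

section
variable {M E F G : Type u} [Env M E] [Env M F] [Env M G]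

instance (priority := 2000) Proj.id : Proj M (fun e : E => e) := ⟨fun i => i, fun _ _ => rfl⟩

instance Proj.fst {p : E → F × M} [h : Proj M p] : Proj M (fun e => (p e).1) := by
  obtain ⟨σ, hσ⟩ := h.out
  exact ⟨fun i => σ i.castSucc, fun e i => by rw [← hσ, eqv_prod_castSucc]⟩

instance Proj.snd {p : E → F × M} [h : Proj M p] : Proj M (fun e => (p e).2) := by
  obtain ⟨σ, hσ⟩ := h.out
  refine ⟨fun _ => σ (Fin.last _), fun e i => ?_⟩
  rw [← hσ, eqv_prod_last]; rfl

instance Proj.nil : Proj M (fun _ : E => PUnit.unit.{u + 1}) :=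
  ⟨fun i : Fin 0 => i.elim0, fun _ i => (i : Fin 0).elim0⟩

instance (priority := 100) Proj.pair {p : E → F} {x : E → M} [h : Proj M p] [hx : Proj M x] :
    Proj M (fun e => (p e, x e)) := by
  obtain ⟨σ, hσ⟩ := h.out
  obtain ⟨τ, hτ⟩ := hx.out
  refine ⟨Fin.lastCases (τ 0) σ, fun e i => ?_⟩
  induction i using Fin.lastCases with
  | last => rw [eqv_prod_last]; dsimp only; rw [Fin.lastCases_last, ← hτ]; rfl
  | cast i => rw [eqv_prod_castSucc]; dsimp only; rw [Fin.lastCases_castSucc, hσ]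

theorem Proj.comp {q : F → G} {p : E → F} (hq : Proj M q)
    (hp : Proj M p) : Proj M (fun e => q (p e)) := by
  obtain ⟨σ, hσ⟩ := hp.out
  obtain ⟨τ, hτ⟩ := hq.out
  exact ⟨fun i => σ (τ i), fun e i => by rw [hτ, hσ]⟩

/-- Activated only locally and with low priority, where a hypothesis on a variable coordinate has to
be pulled back under quantifiers. -/
theorem Proj.comp_inst {q : F → M} {p : E → F} [hq : Proj M q]
    [hp : Proj M p] : Proj M (fun e => q (p e)) := hq.comp hp

theorem Proj.var {x : E → M} (h : Proj M x) : ∃ i, ∀ e, x e = Env.eqv e i := by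
  obtain ⟨σ, hσ⟩ := h.out
  exact ⟨σ 0, fun e => hσ e 0⟩

end

/-- `P` is first-order definable over `M` with parameters. -/
class Df (M : Type u) [ZFModel M] {E : Type u} [Env M E] (P : E → Prop) : Prop where
  out : (univ : Set M).Definable setLang {v | P (Env.eqv.symm v)}

/-- Definable classes. -/
abbrev Df₁ (M : Type u) [ZFModel M] (P : M → Prop) : Prop :=
  Df M fun e : PUnit.{u + 1} × M => P e.2

/-- Definable binary relations. -/
abbrev Df₂ (M : Type u) [ZFModel M] (P : M → M → Prop) : Prop :=
  Df M fun e : (PUnit.{u + 1} × M) × M => P e.1.2 e.2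

/-- Definable ternary relations. -/
abbrev Df₃ (M : Type u) [ZFModel M] (P : M → M → M → Prop) : Prop :=
  Df M fun e : ((PUnit.{u + 1} × M) × M) × M => P e.1.1.2 e.1.2 e.2

/-- The graph of `t` is first-order definable over `M` with parameters. -/
class DfT (M : Type u) [ZFModel M] {E : Type u} [Env M E] (t : E → M) : Prop where
  out : Df M (fun e : E × M => e.2 = t e.1)

section
variable {M E F : Type u} [ZFModel M] [Env M E] [Env M F]

/-- Definable class functions. -/
abbrev DfT₁ (M : Type u) [ZFModel M] (P : M → M) : Prop :=
  DfT M fun e : PUnit.{u + 1} × M => P e.2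

/-- Definable binary class functions. -/
abbrev DfT₂ (M : Type u) [ZFModel M] (P : M → M → M) : Prop :=
  DfT M fun e : (PUnit.{u + 1} × M) × M => P e.1.2 e.2

/-- Definable ternary class functions. -/
abbrev DfT₃ (M : Type u) [ZFModel M] (P : M → M → M → M) : Prop :=
  DfT M fun e : ((PUnit.{u + 1} × M) × M) × M => P e.1.1.2 e.1.2 e.2

theorem Df.congr {P Q : E → Prop} (h : Df M P) (hPQ : ∀ e, P e ↔ Q e) : Df M Q := by
  have : P = Q := funext fun e => propext (hPQ e)
  exact this ▸ h

instance Df.and {P Q : E → Prop} [hP : Df M P] [hQ : Df M Q] : Df M (fun e => P e ∧ Q e) :=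
  ⟨hP.out.inter hQ.out⟩

instance Df.or {P Q : E → Prop} [hP : Df M P] [hQ : Df M Q] : Df M (fun e => P e ∨ Q e) :=
  ⟨hP.out.union hQ.out⟩

instance Df.not {P : E → Prop} [hP : Df M P] : Df M (fun e => ¬ P e) := ⟨hP.out.compl⟩

instance Df.imp {P Q : E → Prop} [Df M P] [Df M Q] : Df M (fun e => P e → Q e) :=
  Df.congr (P := fun e => ¬ P e ∨ Q e) inferInstance fun _ => imp_iff_not_or.symm

instance Df.iff {P Q : E → Prop} [Df M P] [Df M Q] : Df M (fun e => P e ↔ Q e) :=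
  Df.congr (P := fun e => (P e → Q e) ∧ (Q e → P e)) inferInstance
    fun _ => iff_def.symm

instance (priority := 2000) Df.const (p : Prop) : Df M (fun _ : E => p) := by
  by_cases h : p
  · exact ⟨by simp [h]⟩
  · exact ⟨by simp [h]⟩

instance Df.ex {P : E → M → Prop} [h : Df M (fun e : E × M => P e.1 e.2)] :
    Df M (fun e => ∃ y : M, P e y) := by
  refine ⟨?_⟩
  -- Quantifying out the last coordinate is taking the image under restriction along `castSucc`.
  have := h.out.image_comp (Fin.castSucc : Fin (Env.dim M E) → Fin (Env.dim M E + 1))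
  convert this using 1
  ext v
  simp only [mem_image, Set.mem_ofPred_eq]
  constructor
  · rintro ⟨y, hy⟩
    refine ⟨Env.eqv (Env.eqv.symm v, y), ?_, ?_⟩
    · simpa using hy
    · funext i
      simp only [Function.comp]
      rw [eqv_prod_castSucc]; simp
  · rintro ⟨w, hw, rfl⟩
    refine ⟨(Env.eqv.symm w : E × M).2, ?_⟩
    convert hw using 2
    rw [Equiv.symm_apply_eq]
    funext i
    rw [← eqv_prod_castSucc]; simp

instance Df.all {P : E → M → Prop} [Df M (fun e : E × M => P e.1 e.2)] :
    Df M (fun e => ∀ y : M, P e y) :=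
  Df.congr (P := fun e => ¬ ∃ y : M, ¬ P e y) inferInstance fun _ => not_exists_not

theorem Df.comp {P : F → Prop} {p : E → F} (h : Df M P) (hp : Proj M p) :
    Df M (fun e => P (p e)) := by
  obtain ⟨σ, hσ⟩ := hp.out
  refine ⟨?_⟩
  convert h.out.preimage_comp σ using 1
  ext v
  simp only [Set.mem_ofPred_eq, mem_preimage]
  have : p (Env.eqv.symm v) = Env.eqv.symm (v ∘ σ) := by
    rw [Equiv.eq_symm_apply]
    funext i
    rw [hσ]; simp
  rw [this]

theorem Df.varMem {x y : E → M} (hx : Proj M x) (hy : Proj M y) :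
    Df M (fun e => x e ∈ y e) := by
  obtain ⟨i, hi⟩ := hx.var
  obtain ⟨j, hj⟩ := hy.var
  refine ⟨((setLang.lhomWithConstants (univ : Set M)).onRelation SetRel.mem :
    (setLang.withConstants (univ : Set M)).Relations 2).formula₂
      (FirstOrder.Language.Term.var i) (FirstOrder.Language.Term.var j), ?_⟩
  ext v
  simp only [Set.mem_ofPred_eq, hi, hj, Equiv.apply_symm_apply]
  rw [FirstOrder.Language.Formula.realize_rel₂]
  simp only [FirstOrder.Language.Term.realize_var]
  rfl

theorem Df.varEq {x y : E → M} (hx : Proj M x) (hy : Proj M y) :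
    Df M (fun e => x e = y e) := by
  obtain ⟨i, hi⟩ := hx.var
  obtain ⟨j, hj⟩ := hy.var
  refine ⟨(FirstOrder.Language.Term.var i).equal (FirstOrder.Language.Term.var j), ?_⟩
  ext v
  simp [hi, hj]

instance DfT.var {x : E → M} [h : Proj M x] : DfT M x :=
  ⟨Df.varEq inferInstance (h.comp inferInstance)⟩

instance (priority := 2000) DfT.const (a : M) : DfT M (fun _ : E => a) := by
  refine ⟨⟨(FirstOrder.Language.Term.var (Fin.last (Env.dim M E))).equal
    (setLang.con (⟨a, mem_univ a⟩ : (univ : Set M))).term, ?_⟩⟩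
  ext v
  have := eqv_prod_last (M := M) (Env.eqv.symm v : E × M)
  simp only [Equiv.apply_symm_apply] at this
  simp [← this]

/-- Substitution of a definable term in a definable predicate. -/
theorem Df.subst {P : E → M → Prop} {t : E → M} (h : Df M (fun e : E × M => P e.1 e.2))
    (ht : DfT M t) : Df M (fun e => P e (t e)) :=
  have := ht.out
  Df.congr (P := fun e => ∃ a, a = t e ∧ P e a) inferInstance fun e => by simp

theorem DfT.weaken {t : E → M} (ht : DfT M t) : DfT M (fun e : E × M => t e.1) :=
  ⟨Df.comp (p := fun e : (E × M) × M => (e.1.1, e.2)) ht.out inferInstance⟩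

theorem DfT.comp_inst {t : F → M} {p : E → F} [ht : DfT M t] [Proj M p] :
    DfT M (fun e => t (p e)) :=
  ⟨Df.comp (p := fun e : E × M => (p e.1, e.2)) ht.out
    (@Proj.pair M _ _ _ _ _ _ (Proj.comp ‹_› inferInstance) inferInstance)⟩

instance Df.mem {x y : E → M} [hx : DfT M x] [hy : DfT M y] : Df M (fun e => x e ∈ y e) :=
  Df.subst (P := fun e a => a ∈ y e)
    (Df.subst (P := fun (e : E × M) b => e.2 ∈ b) (Df.varMem inferInstance inferInstance)
      hy.weaken) hx

instance Df.eq {x y : E → M} [hx : DfT M x] [hy : DfT M y] : Df M (fun e => x e = y e) :=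
  Df.subst (P := fun e a => a = y e)
    (Df.subst (P := fun (e : E × M) b => e.2 = b) (Df.varEq inferInstance inferInstance)
      hy.weaken) hx

/-- Definability of a notion is checked once, with variables as arguments; this lemma and its
analogues of higher arity carry it over to arbitrary definable arguments. -/
theorem Df.comp1 {P : M → Prop} {x : E → M} (h : Df₁ M P)
    (hx : DfT M x) : Df M (fun e => P (x e)) :=
  Df.subst (P := fun _ a => P a)
    (Df.comp (p := fun e : E × M => (PUnit.unit, e.2)) h inferInstance) hx

theorem DfT.comp1 {t : M → M} {x : E → M} (h : DfT₁ M t)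
    (hx : DfT M x) : DfT M (fun e => t (x e)) :=
  ⟨Df.subst (P := fun (e : E × M) a => e.2 = t a)
    (Df.comp (p := fun e : (E × M) × M => ((PUnit.unit, e.2), e.1.2)) h.out inferInstance)
    hx.weaken⟩

theorem DfT.subst {P : E → M → M} {t : E → M} (h : DfT M (fun e : E × M => P e.1 e.2))
    (ht : DfT M t) : DfT M (fun e => P e (t e)) :=
  ⟨Df.subst (P := fun (e : E × M) a => e.2 = P e.1 a)
    (Df.comp (p := fun e : (E × M) × M => ((e.1.1, e.2), e.1.2)) h.out inferInstance) ht.weaken⟩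

theorem Df.comp2 {P : M → M → Prop} {x y : E → M} (h : Df₂ M P) (hx : DfT M x) (hy : DfT M y) :
    Df M (fun e => P (x e) (y e)) :=
  Df.subst (P := fun e a => P a (y e))
    (Df.subst (P := fun (e : E × M) b => P e.2 b)
      (Df.comp (p := fun e : (E × M) × M => ((PUnit.unit, e.1.2), e.2)) h inferInstance)
      hy.weaken) hx

theorem DfT.comp2 {t : M → M → M} {x y : E → M} (h : DfT₂ M t) (hx : DfT M x) (hy : DfT M y) :
    DfT M (fun e => t (x e) (y e)) :=
  DfT.subst (P := fun e a => t a (y e))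
    (DfT.subst (P := fun (e : E × M) b => t e.2 b)
      ⟨Df.comp (p := fun e : ((E × M) × M) × M => (((PUnit.unit, e.1.1.2), e.1.2), e.2))
        h.out inferInstance⟩
      hy.weaken) hx

theorem Df.comp3 {P : M → M → M → Prop} {x y z : E → M} (h : Df₃ M P) (hx : DfT M x)
    (hy : DfT M y) (hz : DfT M z) : Df M (fun e => P (x e) (y e) (z e)) :=
  Df.subst (P := fun e a => P a (y e) (z e))
    (Df.subst (P := fun (e : E × M) b => P e.2 b (z e.1))
      (Df.subst (P := fun (e : (E × M) × M) c => P e.1.2 e.2 c)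
        (Df.comp (p := fun e : ((E × M) × M) × M => (((PUnit.unit, e.1.1.2), e.1.2), e.2))
          h inferInstance)
        hz.weaken.weaken) hy.weaken) hx

theorem DfT.comp3 {t : M → M → M → M} {x y z : E → M} (h : DfT₃ M t) (hx : DfT M x)
    (hy : DfT M y) (hz : DfT M z) : DfT M (fun e => t (x e) (y e) (z e)) :=
  DfT.subst (P := fun e a => t a (y e) (z e))
    (DfT.subst (P := fun (e : E × M) b => t e.2 b (z e.1))
      (DfT.subst (P := fun (e : (E × M) × M) c => t e.1.2 e.2 c)
        ⟨Df.comp (p := fun e : (((E × M) × M) × M) × M =>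
          ((((PUnit.unit, e.1.1.1.2), e.1.1.2), e.1.2), e.2)) h.out inferInstance⟩
        hz.weaken.weaken) hy.weaken) hx

/-! ### Extensionality and sets given by definable conditions. -/

theorem ext_iff {x y : M} : x = y ↔ ∀ z, z ∈ x ↔ z ∈ y :=
  ⟨by rintro rfl z; rfl, ZFModel.extensionality x y⟩

theorem ext {x y : M} (h : ∀ z, z ∈ x ↔ z ∈ y) : x = y := ext_iff.2 h

theorem mem_theSet' {P : M → Prop} (h : ∃ b : M, ∀ x, x ∈ b ↔ P x) (x : M) :
    x ∈ theSet P ↔ P x :=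
  Classical.epsilon_spec (p := fun b : M => ∀ x : M, x ∈ b ↔ P x) h x

theorem theSet_eq {P : M → Prop} {b : M} (h : ∀ x, x ∈ b ↔ P x) : theSet P = b :=
  ext fun x => (mem_theSet' ⟨b, h⟩ x).trans (h x).symm

theorem theSet_congr {P Q : M → Prop} (h : ∀ x, P x ↔ Q x) : theSet P = theSet Q := by
  have : P = Q := funext fun x => propext (h x)
  rw [this]

/-- The junk value of `theSet` at proper classes. -/
noncomputable def junkSet : M := Classical.epsilon fun _ : M => False

/-- For a proper class the predicate under `epsilon` is identically false, so the chosen value does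
not depend on the class. -/
theorem theSet_of_not {P : M → Prop} (h : ¬ ∃ b : M, ∀ x, x ∈ b ↔ P x) :
    theSet P = junkSet := by
  unfold theSet junkSet
  congr 1
  funext b
  exact eq_false fun hb => h ⟨b, hb⟩

/-- No existence hypothesis is needed: where the class is proper, the value is the single parameter
`junkSet`, so the graph is definable by cases. -/
instance DfT.theSet {P : E → M → Prop} [h : Df M (fun e : E × M => P e.1 e.2)] :
    DfT M (fun e => theSet (P e)) := by
  have h1 : Df M (fun e : (E × M) × M => P e.1.1 e.2) :=
    Df.comp (p := fun e : (E × M) × M => (e.1.1, e.2)) h inferInstance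
  have h2 : Df M (fun e : ((E × M) × M) × M => P e.1.1.1 e.2) :=
    Df.comp (p := fun e : ((E × M) × M) × M => (e.1.1.1, e.2)) h inferInstance
  refine ⟨Df.congr (P := fun e : E × M => (∀ x, x ∈ e.2 ↔ P e.1 x) ∨
    ((¬ ∃ b : M, ∀ x, x ∈ b ↔ P e.1 x) ∧ e.2 = junkSet)) inferInstance fun e => ?_⟩
  by_cases hb : ∃ b : M, ∀ x, x ∈ b ↔ P e.1 x
  · simp only [hb, not_true, false_and, or_false]
    exact ⟨fun h => (theSet_eq h).symm, fun h => h ▸ mem_theSet' hb⟩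
  · rw [theSet_of_not hb]
    have : ¬ ∀ x, x ∈ e.2 ↔ P e.1 x := fun h => hb ⟨_, h⟩
    simp [hb, this]

instance DfT.ite {P : E → Prop} {d : ∀ e, Decidable (P e)} {x y : E → M} [Df M P] [hx : DfT M x]
    [hy : DfT M y] : DfT M (fun e => @ite M (P e) (d e) (x e) (y e)) := by
  have h : Df M (fun e : E × M => P e.1) := Df.comp (P := P) inferInstance inferInstance
  have := hx.weaken
  have := hy.weaken
  refine ⟨Df.congr (P := fun e : E × M => (P e.1 ∧ e.2 = x e.1) ∨ (¬ P e.1 ∧ e.2 = y e.1))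
    inferInstance fun e => ?_⟩
  by_cases hp : P e.1 <;> simp [hp]

instance Df.exUnique {P : E → M → Prop} [h : Df M (fun e : E × M => P e.1 e.2)] :
    Df M (fun e => ∃! y : M, P e y) := by
  have h1 : Df M (fun e : (E × M) × M => P e.1.1 e.2) :=
    Df.comp (p := fun e : (E × M) × M => (e.1.1, e.2)) h inferInstance
  unfold ExistsUnique
  infer_instance

end

section
variable {M : Type u} [ZFModel M]

theorem separation (P : M → Prop) [h : Df₁ M P] (a : M) :
    ∃ b : M, ∀ x, x ∈ b ↔ x ∈ a ∧ P x :=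
  ZFModel.separation {x | P x}
    (by
      have h1 := h.out
      unfold Definable₁
      refine (congrArg ((univ : Set M).Definable setLang) (Set.ext fun v : Fin 1 → M => ?_)).mp h1
      have h1 := eqv_prod_last (M := M) ((Env.eqv (M := M)).symm v : PUnit.{u + 1} × M)
      rw [Equiv.apply_symm_apply] at h1
      exact Iff.of_eq (congrArg P h1.symm)) a

/-- A definable class that is contained in a set is a set. -/
theorem mem_theSet {P : M → Prop} [Df₁ M P] {a : M} (h : ∀ x, P x → x ∈ a) (x : M) :
    x ∈ theSet P ↔ P x := by
  obtain ⟨b, hb⟩ := separation P a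
  exact mem_theSet' ⟨b, fun x => (hb x).trans ⟨fun h => h.2, fun hx => ⟨h x hx, hx⟩⟩⟩ x

theorem mem_sep {P : M → Prop} [Df₁ M P] {a : M} (x : M) :
    x ∈ theSet (fun x => x ∈ a ∧ P x) ↔ x ∈ a ∧ P x :=
  mem_theSet (a := a) (fun _ h => h.1) x

theorem replacement (t : M → M) [h : DfT₁ M t] (a : M) :
    ∃ b : M, ∀ y, y ∈ b ↔ ∃ x, x ∈ a ∧ y = t x := by
  obtain ⟨b, hb⟩ := ZFModel.replacement {p : M × M | p.2 = t p.1}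
    (by
      have := h.out.out
      refine (congrArg ((univ : Set M).Definable setLang) (Set.ext fun v : Fin 2 → M => ?_)).mp
        this
      have h0 := eqv_prod_castSucc (M := M)
        ((Env.eqv (M := M)).symm v : (PUnit.{u + 1} × M) × M) (Fin.last 0)
      have h2 := eqv_prod_last (M := M)
        ((Env.eqv (M := M)).symm v : (PUnit.{u + 1} × M) × M).1
      have h1 := eqv_prod_last (M := M) ((Env.eqv (M := M)).symm v : (PUnit.{u + 1} × M) × M)
      rw [Equiv.apply_symm_apply] at h0 h1
      exact Iff.of_eq (congrArg₂ (fun a b => a = t b) h1.symm (h2.symm.trans h0.symm))) a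
    (fun x y z _ hy hz => by rw [show y = t x from hy, show z = t x from hz])
  exact ⟨b, hb⟩

theorem mem_image (t : M → M) [DfT₁ M t] (a y : M) :
    y ∈ theSet (fun y => ∃ x, x ∈ a ∧ y = t x) ↔ ∃ x, x ∈ a ∧ y = t x :=
  mem_theSet' (replacement t a) y

end

end ZFM



/-! ### Basic set theory inside `M`: definability, ordinals, flat pairs, functions. -/

namespace ZFM

open Set

/-! ### Definability of the basic notions -/

section
variable {M E : Type u} [ZFModel M] [Env M E] {a b c : E → M}

/-- `f(x)`, as the union of all `y` with `(x, y) ∈ f`; unlike `app`, it is a definable operation. -/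
noncomputable def val (f x : M) : M := theSet fun z => ∃ y, pr x y ∈ f ∧ z ∈ y

/-- The function with domain `X` and values `t x`. -/
noncomputable def mkFun (X : M) (t : M → M) : M := theSet fun p => ∃ x, x ∈ X ∧ p = pr x (t x)

variable [ha : DfT M a] [hb : DfT M b] [hc : DfT M c]

instance df_Sub : Df M (fun e => Sub (a e) (b e)) :=
  Df.comp2 (by unfold Sub; infer_instance) ha hb

instance df_succ : DfT M (fun e => succ (a e)) :=
  DfT.comp1 (by unfold succ; infer_instance) ha

instance df_power : DfT M (fun e => power (a e)) :=
  DfT.comp1 (by unfold power; infer_instance) ha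

instance df_IsTrans : Df M (fun e => IsTrans (a e)) :=
  Df.comp1 (by unfold IsTrans; infer_instance) ha

instance df_IsOrd : Df M (fun e => IsOrd (a e)) :=
  Df.comp1 (by unfold IsOrd; infer_instance) ha

instance df_IsNat : Df M (fun e => IsNat (a e)) :=
  Df.comp1 (by unfold IsNat; infer_instance) ha

instance df_shift : DfT M (fun e => shift (a e)) :=
  DfT.comp1 (by unfold shift; infer_instance) ha

instance df_code0 : DfT M (fun e => code0 (a e)) :=
  DfT.comp1 (by unfold code0; infer_instance) ha

instance df_code1 : DfT M (fun e => code1 (a e)) :=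
  DfT.comp1 (by unfold code1; infer_instance) ha

instance df_pr : DfT M (fun e => pr (a e) (b e)) :=
  DfT.comp2 (by unfold pr; infer_instance) ha hb

instance df_IsFunc : Df M (fun e => IsFunc (a e) (b e) (c e)) :=
  Df.comp3 (by unfold IsFunc; infer_instance) ha hb hc

instance df_val : DfT M (fun e => val (a e) (b e)) :=
  DfT.comp2 (by unfold val; infer_instance) ha hb

instance df_mkFun {t : E → M → M} [h : DfT M (fun e : E × M => t e.1 e.2)] :
    DfT M (fun e => mkFun (a e) (t e)) := by
  have := ha.weaken.weaken
  have : DfT M (fun e : (E × M) × M => t e.1.1 e.2) :=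
    DfT.subst (P := fun (e : (E × M) × M) x => t e.1.1 x)
      ⟨Df.comp (p := fun e : (((E × M) × M) × M) × M => ((e.1.1.1.1, e.1.2), e.2)) h.out
        inferInstance⟩ inferInstance
  unfold mkFun
  infer_instance

instance df_restrict : DfT M (fun e => restrict (a e) (b e)) :=
  DfT.comp2 (by unfold restrict; infer_instance) ha hb

instance df_fMem : DfT M (fun e => fMem (a e) (b e)) :=
  DfT.comp2 (by unfold fMem; infer_instance) ha hb

instance df_fEq : DfT M (fun e => fEq (a e) (b e)) :=
  DfT.comp2 (by unfold fEq; infer_instance) ha hb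

instance df_fNot : DfT M (fun e => fNot (a e)) :=
  DfT.comp1 (by unfold fNot; infer_instance) ha

instance df_fAnd : DfT M (fun e => fAnd (a e) (b e)) :=
  DfT.comp2 (by unfold fAnd; infer_instance) ha hb

instance df_fEx : DfT M (fun e => fEx (a e) (b e)) :=
  DfT.comp2 (by unfold fEx; infer_instance) ha hb

instance df_BoolClosed : Df M (fun e => BoolClosed (a e)) :=
  Df.comp1 (by unfold BoolClosed; infer_instance) ha

instance df_IsFml : Df M (fun e => IsFml (a e)) :=
  Df.comp1 (by unfold IsFml; infer_instance) ha

end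

/-! ### Elementary set theory in `M` -/

section
variable {M : Type u} [ZFModel M]

theorem not_mem_empty (x : M) : x ∉ (empty : M) := by
  obtain ⟨e, he, -⟩ := (ZFModel.infinity (M := M)).choose_spec.1
  have : (empty : M) = e := theSet_eq fun x => by simp [he x]
  rw [this]; exact he x

theorem eq_empty_of {x : M} (h : ∀ y, y ∉ x) : x = empty :=
  ext fun y => ⟨fun hy => (h y hy).elim, fun hy => (not_mem_empty y hy).elim⟩

theorem exists_mem_of_ne_empty {x : M} (h : x ≠ empty) : ∃ y, y ∈ x := by
  by_contra! h'
  exact h (eq_empty_of h')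

theorem exists_pair (x y : M) : ∃ p : M, ∀ z, z ∈ p ↔ z = x ∨ z = y := ZFModel.pairing x y

theorem exists_union₂ (x y : M) : ∃ p : M, ∀ z, z ∈ p ↔ z ∈ x ∨ z ∈ y := by
  obtain ⟨p, hp⟩ := exists_pair x y
  obtain ⟨u, hu⟩ := ZFModel.union p
  exact ⟨u, fun z => by simp [hu, hp]⟩

theorem exists_insert (x y : M) : ∃ p : M, ∀ z, z ∈ p ↔ z ∈ x ∨ z = y := by
  obtain ⟨s, hs⟩ := exists_pair y y
  obtain ⟨p, hp⟩ := exists_union₂ x s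
  exact ⟨p, fun z => by simp [hp, hs]⟩

theorem mem_succ {x z : M} : z ∈ succ x ↔ z ∈ x ∨ z = x := mem_theSet' (exists_insert x x) z

theorem mem_power {x z : M} : z ∈ power x ↔ Sub z x :=
  mem_theSet' (P := fun z => Sub z x) (ZFModel.powerset x) z

theorem self_mem_succ (x : M) : x ∈ succ x := mem_succ.2 (Or.inr rfl)

theorem Sub.refl (x : M) : Sub x x := fun _ h => h

theorem Sub.trans {x y z : M} (h : Sub x y) (h' : Sub y z) : Sub x z := fun w hw => h' w (h w hw)

theorem Sub.antisymm {x y : M} (h : Sub x y) (h' : Sub y x) : x = y :=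
  ext fun z => ⟨h z, h' z⟩

theorem empty_sub (x : M) : Sub empty x := fun y h => (not_mem_empty y h).elim

theorem not_mem_self (x : M) : x ∉ x := by
  intro h
  obtain ⟨p, hp⟩ := exists_pair x x
  obtain ⟨y, hy, h'⟩ := ZFModel.foundation p ⟨x, by simp [hp]⟩
  have : y = x := by simpa [hp] using hy
  subst this
  exact h' y hy h

theorem not_mem_of_mem {x y : M} (h : x ∈ y) : y ∉ x := by
  intro h'
  obtain ⟨p, hp⟩ := exists_pair x y
  obtain ⟨z, hz, h''⟩ := ZFModel.foundation p ⟨x, by simp [hp]⟩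
  rcases (hp z).1 hz with rfl | rfl
  · exact h'' y (by simp [hp]) h'
  · exact h'' x (by simp [hp]) h

theorem not_mem_cycle₃ {x y z : M} (h : x ∈ y) (h' : y ∈ z) : z ∉ x := by
  intro h3
  obtain ⟨p, hp⟩ := exists_pair x y
  obtain ⟨q, hq⟩ := exists_insert p z
  obtain ⟨w, hw, hw'⟩ := ZFModel.foundation q ⟨x, by simp [hp, hq]⟩
  rcases (hq w).1 hw with hw | rfl
  · rcases (hp w).1 hw with rfl | rfl
    · exact hw' z (by simp [hq]) h3
    · exact hw' x (by simp [hq, hp]) h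
  · exact hw' y (by simp [hq, hp]) h'

theorem succ_inj {x y : M} (h : succ x = succ y) : x = y := by
  have h1 : x ∈ succ y := h ▸ self_mem_succ x
  have h2 : y ∈ succ x := h ▸ self_mem_succ y
  rcases mem_succ.1 h1 with h1 | h1
  · rcases mem_succ.1 h2 with h2 | h2
    · exact (not_mem_of_mem h1 h2).elim
    · exact h2.symm
  · exact h1

theorem succ_ne_empty (x : M) : succ x ≠ empty := fun h => not_mem_empty x (h ▸ self_mem_succ x)

/-- Foundation as an induction principle on the elements of a set. -/
theorem mem_induction (P : M → Prop) [Df₁ M P] (a : M)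
    (h : ∀ x, x ∈ a → (∀ y, y ∈ x → y ∈ a → P y) → P x) (x : M) (hx : x ∈ a) : P x := by
  obtain ⟨b, hb⟩ := separation (fun x => ¬ P x) a
  by_contra hP
  obtain ⟨y, hy, hy'⟩ := ZFModel.foundation b ⟨x, (hb x).2 ⟨hx, hP⟩⟩
  refine ((hb y).1 hy).2 (h y ((hb y).1 hy).1 fun z hz hza => ?_)
  by_contra hPz
  exact hy' z ((hb z).2 ⟨hza, hPz⟩) hz

/-! ### Ordinals and natural numbers -/

theorem IsOrd.trans_mem {x y z : M} (h : IsOrd z) (h1 : x ∈ y) (h2 : y ∈ z) : x ∈ z :=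
  h.1 y h2 x h1

theorem IsOrd.mem {x y : M} (h : IsOrd x) (hy : y ∈ x) : IsOrd y := by
  refine ⟨fun z hz w hw => ?_, fun z w hz hw => h.2 z w (h.trans_mem hz hy) (h.trans_mem hw hy)⟩
  have hzx := h.trans_mem hz hy
  rcases h.2 w y (h.trans_mem hw hzx) hy with h1 | rfl | h1
  · exact h1
  · exact (not_mem_of_mem hz hw).elim
  · exact (not_mem_cycle₃ hw hz h1).elim

theorem IsOrd.succ {x : M} (h : IsOrd x) : IsOrd (succ x) := by
  refine ⟨fun y hy z hz => ?_, fun y z hy hz => ?_⟩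
  · rcases mem_succ.1 hy with hy | rfl
    · exact mem_succ.2 (Or.inl (h.trans_mem hz hy))
    · exact mem_succ.2 (Or.inl hz)
  · rcases mem_succ.1 hy with hy | rfl <;> rcases mem_succ.1 hz with hz | rfl
    · exact h.2 y z hy hz
    · exact Or.inl hy
    · exact Or.inr (Or.inr hz)
    · exact Or.inr (Or.inl rfl)

theorem isOrd_empty : IsOrd (empty : M) :=
  ⟨fun y hy => (not_mem_empty y hy).elim, fun y _ hy => (not_mem_empty y hy).elim⟩

/-- An ∈-minimal element of `x` outside `succ y` must be `succ y` itself; if there is no element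
outside, then `x = succ y`. -/
theorem IsOrd.succ_mem_succ {x y : M} (h : IsOrd x) (hy : y ∈ x) : ZFM.succ y ∈ ZFM.succ x := by
  let P : M → Prop := fun z => ¬ z ∈ ZFM.succ y
  obtain ⟨b, hb⟩ := separation (fun z => ¬ z ∈ ZFM.succ y) x
  by_cases hne : ∃ z, z ∈ b
  · obtain ⟨z, hz, hz'⟩ := ZFModel.foundation b hne
    obtain ⟨hzx, hzy⟩ := (hb z).1 hz
    have : z = ZFM.succ y := by
      refine ext fun w => ⟨fun hw => ?_, fun hw => ?_⟩
      · by_contra hwy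
        exact hz' w ((hb w).2 ⟨h.trans_mem hw hzx, hwy⟩) hw
      · rw [mem_succ] at hzy hw
        push Not at hzy
        have hyz : y ∈ z := by
          rcases h.2 y z hy hzx with h1 | h1 | h1
          · exact h1
          · exact (hzy.2 h1.symm).elim
          · exact (hzy.1 h1).elim
        rcases hw with hw | rfl
        · exact (h.mem hzx).trans_mem hw hyz
        · exact hyz
    exact mem_succ.2 (Or.inl (this ▸ hzx))
  · refine mem_succ.2 (Or.inr (ext fun w => ⟨fun hw => ?_, fun hw => ?_⟩))
    · rcases mem_succ.1 hw with hw | rfl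
      · exact h.trans_mem hw hy
      · exact hy
    · by_contra hwy
      exact hne ⟨w, (hb w).2 ⟨hw, hwy⟩⟩

theorem IsOrd.cases {x : M} (h : IsOrd x) : x = empty ∨ (∃ y, y ∈ x ∧ x = ZFM.succ y) ∨ IsLim x := by
  by_cases h0 : x = empty
  · exact Or.inl h0
  by_cases h1 : ∃ y, y ∈ x ∧ x = ZFM.succ y
  · exact Or.inr (Or.inl h1)
  refine Or.inr (Or.inr ⟨h, h0, fun y hy => ?_⟩)
  rcases mem_succ.1 (h.succ_mem_succ hy) with h2 | h2
  · exact h2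
  · exact (h1 ⟨y, hy, h2.symm⟩).elim

theorem isNat_empty : IsNat (empty : M) :=
  ⟨isOrd_empty, fun m hm => by
    rcases mem_succ.1 hm with hm | rfl
    · exact (not_mem_empty m hm).elim
    · exact Or.inl rfl⟩

theorem IsNat.succ {n : M} (h : IsNat n) : IsNat (succ n) :=
  ⟨h.1.succ, fun m hm => by
    rcases mem_succ.1 hm with hm | rfl
    · exact h.2 m hm
    · exact Or.inr ⟨n, rfl⟩⟩

theorem IsNat.mem_inductive {w n : M} (h0 : empty ∈ w) (hs : ∀ x, x ∈ w → ZFM.succ x ∈ w)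
    (hn : IsNat n) : n ∈ w := by
  refine mem_induction (fun m => m ∈ w) (ZFM.succ n) (fun m hm ih => ?_) n (self_mem_succ n)
  rcases hn.2 m hm with rfl | ⟨k, rfl⟩
  · exact h0
  · exact hs k (ih k (self_mem_succ k) (hn.1.succ.trans_mem (self_mem_succ k) hm))

theorem mem_omega {n : M} : n ∈ (omega : M) ↔ IsNat n := by
  obtain ⟨w, ⟨e, he, hew⟩, hs⟩ := ZFModel.infinity (M := M)
  refine mem_theSet (a := w) (fun n hn => hn.mem_inductive ?_ fun x hx => ?_) n
  · rwa [← eq_empty_of he]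
  · obtain ⟨y, hy, hyx⟩ := hs x hx
    have : y = succ x := ext fun z => (hyx z).trans mem_succ.symm
    exact this ▸ hy

theorem empty_mem_omega : (empty : M) ∈ (omega : M) := mem_omega.2 isNat_empty

theorem succ_mem_omega {n : M} (h : n ∈ (omega : M)) : succ n ∈ (omega : M) :=
  mem_omega.2 (mem_omega.1 h).succ

theorem num_mem_omega : ∀ i : ℕ, (num i : M) ∈ (omega : M)
  | 0 => empty_mem_omega
  | i + 1 => succ_mem_omega (num_mem_omega i)

theorem num_inj : ∀ {i j : ℕ}, (num i : M) = num j → i = j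
  | 0, 0, _ => rfl
  | 0, _ + 1, h => (succ_ne_empty _ h.symm).elim
  | _ + 1, 0, h => (succ_ne_empty _ h).elim
  | _ + 1, _ + 1, h => congrArg _ (num_inj (succ_inj h))

theorem omega_induction (P : M → Prop) [Df₁ M P] (h0 : P empty)
    (hs : ∀ n, n ∈ (omega : M) → P n → P (succ n)) (n : M) (hn : n ∈ (omega : M)) : P n := by
  obtain ⟨b, hb⟩ := separation P omega
  exact ((hb n).1 ((mem_omega.1 hn).mem_inductive ((hb _).2 ⟨empty_mem_omega, h0⟩) fun x hx =>
    (hb _).2 ⟨succ_mem_omega ((hb x).1 hx).1, hs x ((hb x).1 hx).1 ((hb x).1 hx).2⟩)).2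

/-! ### Pairs -/

theorem shift_inj {x y : M} (h : shift x = shift y) : x = y := by
  unfold shift at h
  split_ifs at h with hx hy hy
  · exact succ_inj h
  · exact (hy (h ▸ succ_mem_omega hx)).elim
  · exact (hx (h ▸ succ_mem_omega hy)).elim
  · exact h

theorem shift_ne_empty (x : M) : shift x ≠ empty := by
  unfold shift
  split_ifs with hx
  · exact succ_ne_empty x
  · rintro rfl
    exact hx empty_mem_omega

theorem mem_code0 {u z : M} : z ∈ code0 u ↔ ∃ t, t ∈ u ∧ z = shift t := mem_image shift u z

theorem mem_code1 {u z : M} : z ∈ code1 u ↔ (∃ t, t ∈ u ∧ z = shift t) ∨ z = empty := by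
  obtain ⟨b, hb⟩ := exists_insert (code0 u) empty
  exact mem_theSet' ⟨b, fun z => by rw [hb, mem_code0]⟩ z

theorem code0_inj {x y : M} (h : code0 x = code0 y) : x = y := by
  have : ∀ {x y : M}, code0 x = code0 y → Sub x y := fun {x y} h z hz => by
    have : shift z ∈ code0 y := h ▸ mem_code0.2 ⟨z, hz, rfl⟩
    obtain ⟨t, ht, h'⟩ := mem_code0.1 this
    exact shift_inj h' ▸ ht
  exact Sub.antisymm (this h) (this h.symm)

theorem code1_inj {x y : M} (h : code1 x = code1 y) : x = y := by
  have : ∀ {x y : M}, code1 x = code1 y → Sub x y := fun {x y} h z hz => by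
    have : shift z ∈ code1 y := h ▸ mem_code1.2 (Or.inl ⟨z, hz, rfl⟩)
    rcases mem_code1.1 this with ⟨t, ht, h'⟩ | h'
    · exact shift_inj h' ▸ ht
    · exact (shift_ne_empty _ h').elim
  exact Sub.antisymm (this h) (this h.symm)

/-- The empty set is the tag: it belongs to every `code1` and to no `code0`, since `shift` never
takes the value ∅. -/
theorem code0_ne_code1 (x y : M) : code0 x ≠ code1 y := fun h => by
  obtain ⟨t, _, ht⟩ := mem_code0.1 (h ▸ mem_code1.2 (Or.inr rfl) : empty ∈ code0 x)
  exact shift_ne_empty t ht.symm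

theorem mem_pr {x y z : M} :
    z ∈ pr x y ↔ (∃ t, t ∈ x ∧ z = code0 t) ∨ (∃ t, t ∈ y ∧ z = code1 t) := by
  obtain ⟨b, hb⟩ := replacement code0 x
  obtain ⟨c, hc⟩ := replacement code1 y
  obtain ⟨d, hd⟩ := exists_union₂ b c
  exact mem_theSet' ⟨d, fun z => by rw [hd, hb, hc]⟩ z

theorem pr_inj {x y x' y' : M} (h : pr x y = pr x' y') : x = x' ∧ y = y' := by
  have h0 : ∀ {x y x' y' : M}, pr x y = pr x' y' → Sub x x' ∧ Sub y y' := by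
    intro x y x' y' h
    refine ⟨fun z hz => ?_, fun z hz => ?_⟩
    · have : code0 z ∈ pr x' y' := h ▸ mem_pr.2 (Or.inl ⟨z, hz, rfl⟩)
      rcases mem_pr.1 this with ⟨t, ht, h'⟩ | ⟨t, _, h'⟩
      · exact code0_inj h' ▸ ht
      · exact (code0_ne_code1 _ _ h').elim
    · have : code1 z ∈ pr x' y' := h ▸ mem_pr.2 (Or.inr ⟨z, hz, rfl⟩)
      rcases mem_pr.1 this with ⟨t, _, h'⟩ | ⟨t, ht, h'⟩
      · exact (code0_ne_code1 _ _ h'.symm).elim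
      · exact code1_inj h' ▸ ht
  exact ⟨Sub.antisymm (h0 h).1 (h0 h.symm).1, Sub.antisymm (h0 h).2 (h0 h.symm).2⟩

@[simp] theorem pr_eq {x y x' y' : M} : pr x y = pr x' y' ↔ x = x' ∧ y = y' :=
  ⟨pr_inj, fun h => by rw [h.1, h.2]⟩

/-! ### Functions -/

theorem IsFunc.exists_val {f a b x : M} (h : IsFunc f a b) (hx : x ∈ a) :
    ∃ y, y ∈ b ∧ pr x y ∈ f := by
  obtain ⟨y, hy, -⟩ := h.2 x hx
  obtain ⟨x', y', _, hy', h'⟩ := h.1 _ hy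
  exact ⟨y, (pr_inj h').2 ▸ hy', hy⟩

theorem IsFunc.uniq {f a b x y y' : M} (h : IsFunc f a b) (hy : pr x y ∈ f) (hy' : pr x y' ∈ f) :
    y = y' := by
  obtain ⟨x', _, hx', -, h'⟩ := h.1 _ hy
  exact (h.2 x ((pr_inj h').1 ▸ hx')).unique hy hy'

theorem IsFunc.pr_mem {f a b x : M} (h : IsFunc f a b) (hx : x ∈ a) : pr x (app f x) ∈ f :=
  Classical.epsilon_spec (p := fun y : M => pr x y ∈ f) (h.2 x hx).exists

theorem IsFunc.app_eq {f a b x y : M} (h : IsFunc f a b) (hy : pr x y ∈ f) : app f x = y := by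
  obtain ⟨x', _, hx', -, h'⟩ := h.1 _ hy
  exact h.uniq (h.pr_mem ((pr_inj h').1 ▸ hx')) hy

theorem IsFunc.app_mem {f a b x : M} (h : IsFunc f a b) (hx : x ∈ a) : app f x ∈ b := by
  obtain ⟨y, hy, h'⟩ := h.exists_val hx
  exact h.app_eq h' ▸ hy

theorem IsFunc.mem_dom {f a b x y : M} (h : IsFunc f a b) (hy : pr x y ∈ f) : x ∈ a := by
  obtain ⟨x', _, hx', -, h'⟩ := h.1 _ hy
  exact (pr_inj h').1 ▸ hx'

theorem IsFunc.pr_mem_iff {f a b x y : M} (h : IsFunc f a b) :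
    pr x y ∈ f ↔ x ∈ a ∧ y = app f x :=
  ⟨fun hy => ⟨h.mem_dom hy, (h.app_eq hy).symm⟩, fun ⟨hx, hy⟩ => hy ▸ h.pr_mem hx⟩

theorem IsFunc.mem_iff {f a b p : M} (h : IsFunc f a b) :
    p ∈ f ↔ ∃ x, x ∈ a ∧ p = pr x (app f x) := by
  constructor
  · intro hp
    obtain ⟨x, y, hx, -, rfl⟩ := h.1 p hp
    exact ⟨x, hx, by rw [h.app_eq hp]⟩
  · rintro ⟨x, hx, rfl⟩
    exact h.pr_mem hx

theorem IsFunc.val_eq {f a b x : M} (h : IsFunc f a b) (hx : x ∈ a) : val f x = app f x := by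
  refine theSet_eq fun z => ⟨fun hz => ⟨_, h.pr_mem hx, hz⟩, ?_⟩
  rintro ⟨y, hy, hz⟩
  rwa [h.app_eq hy]

theorem IsFunc.ext {f g a b c : M} (hf : IsFunc f a b) (hg : IsFunc g a c)
    (h : ∀ x, x ∈ a → app f x = app g x) : f = g :=
  ZFM.ext fun p => by
    rw [hf.mem_iff, hg.mem_iff]
    exact exists_congr fun x => and_congr_right fun hx => by rw [h x hx]

theorem IsFunc.mono {f a b c : M} (hf : IsFunc f a b) (h : ∀ x, x ∈ a → app f x ∈ c) :
    IsFunc f a c :=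
  ⟨fun p hp => by
    obtain ⟨x, hx, rfl⟩ := hf.mem_iff.1 hp
    exact ⟨x, _, hx, h x hx, rfl⟩, hf.2⟩

section mkFun
variable {t : M → M} [hDf : DfT₁ M t] {X B : M}

include hDf in
theorem mem_mkFun {p : M} : p ∈ mkFun X t ↔ ∃ x, x ∈ X ∧ p = pr x (t x) := by
  have : DfT₁ M (fun x => pr x (t x)) := inferInstance
  exact mem_image (fun x => pr x (t x)) X p

include hDf in
theorem isFunc_mkFun (h : ∀ x, x ∈ X → t x ∈ B) : IsFunc (mkFun X t) X B := by
  refine ⟨fun p hp => ?_, fun x hx => ⟨t x, mem_mkFun.2 ⟨x, hx, rfl⟩, fun y hy => ?_⟩⟩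
  · obtain ⟨x, hx, rfl⟩ := mem_mkFun.1 hp
    exact ⟨x, t x, hx, h x hx, rfl⟩
  · obtain ⟨x', _, h'⟩ := mem_mkFun.1 hy
    rw [pr_eq] at h'
    rw [h'.2, h'.1]

theorem exists_bound (t : M → M) [DfT₁ M t] (X : M) : ∃ B : M, ∀ x, x ∈ X → t x ∈ B := by
  obtain ⟨B, hB⟩ := replacement t X
  exact ⟨B, fun x hx => (hB _).2 ⟨x, hx, rfl⟩⟩

include hDf in
theorem app_mkFun {x : M} (hx : x ∈ X) : app (mkFun X t) x = t x := by
  obtain ⟨B, hB⟩ := exists_bound t X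
  exact (isFunc_mkFun hB).app_eq (mem_mkFun.2 ⟨x, hx, rfl⟩)

end mkFun

/-- A definable functional relation on a set, as a function. -/
theorem exists_function (P : M → M → Prop) [Df₂ M P] (a b : M) 
    (h : ∀ x, x ∈ a → ∃! y, y ∈ b ∧ P x y) : ∃ f, IsFunc f a b ∧ ∀ x, x ∈ a → P x (app f x) := by
  -- The unique `y` is recovered as the union of all suitable `y`, which keeps the term definable.
  let t : M → M := fun x => theSet fun z => ∃ y, (y ∈ b ∧ P x y) ∧ z ∈ y
  have ht : ∀ x, x ∈ a → ∀ y, y ∈ b ∧ P x y → t x = y := fun x hx y hy =>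
    theSet_eq fun z => ⟨fun hz => ⟨y, hy, hz⟩, fun ⟨y', hy', hz⟩ => (h x hx).unique hy' hy ▸ hz⟩
  have : Df M (fun e : ((PUnit.{u + 1} × M) × M) × M => P e.1.1.2 e.2) :=
    Df.comp2 (P := P) inferInstance inferInstance inferInstance
  have hD : DfT₁ M t := by
    have : Df M (fun e : ((PUnit.{u + 1} × M) × M) × M => 
      (e.2 ∈ b ∧ P e.1.1.2 e.2) ∧ e.1.2 ∈ e.2) := inferInstance
    exact DfT.theSet (P := fun (e : PUnit.{u + 1} × M) z => ∃ y, (y ∈ b ∧ P e.2 y) ∧ z ∈ y)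
  have ht' : ∀ x, x ∈ a → t x ∈ b ∧ P x (t x) := fun x hx => by
    obtain ⟨y, hy, _⟩ := h x hx
    exact ht x hx y hy ▸ hy
  exact ⟨mkFun a t, isFunc_mkFun fun x hx => (ht' x hx).1, fun x hx => by
    rw [app_mkFun hx]; exact (ht' x hx).2⟩

end

end ZFM



/-! ### Closed sets, iteration along ω, and the cumulative hierarchy. -/

namespace ZFM

/-! ### Closed sets -/

section
variable {M : Type u} [ZFModel M]

/-- `v` is transitive, closed under subsets and pairs, and contains the natural numbers. -/
structure Good (v : M) : Prop where
  trans : ∀ {x y : M}, x ∈ y → y ∈ v → x ∈ v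
  sub : ∀ {x y : M}, Sub x y → y ∈ v → x ∈ v
  nat : ∀ {n : M}, n ∈ (omega : M) → n ∈ v
  code0 : ∀ {t : M}, t ∈ v → ZFM.code0 t ∈ v
  code1 : ∀ {t : M}, t ∈ v → ZFM.code1 t ∈ v
  pr : ∀ {x y : M}, x ∈ v → y ∈ v → ZFM.pr x y ∈ v

theorem good_iff {v : M} : Good v ↔ (∀ x y : M, x ∈ y → y ∈ v → x ∈ v) ∧
    (∀ x y : M, Sub x y → y ∈ v → x ∈ v) ∧ (∀ n : M, n ∈ (omega : M) → n ∈ v) ∧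
    (∀ t : M, t ∈ v → ZFM.code0 t ∈ v) ∧ (∀ t : M, t ∈ v → ZFM.code1 t ∈ v) ∧
    ∀ x y : M, x ∈ v → y ∈ v → ZFM.pr x y ∈ v :=
  ⟨fun h => ⟨fun _ _ => h.trans, fun _ _ => h.sub, fun _ => h.nat, fun _ => h.code0,
    fun _ => h.code1, fun _ _ => h.pr⟩,
    fun ⟨h1, h2, h3, h4, h5, h6⟩ => ⟨h1 _ _, h2 _ _, h3 _, h4 _, h5 _, h6 _ _⟩⟩

instance df_Good {E : Type u} [Env M E] {a : E → M} [ha : DfT M a] : Df M (fun e => Good (a e)) :=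
  Df.comp1 (P := fun v => Good v) (by simp only [good_iff]; infer_instance) ha

theorem Good.sub_of_mem {v x : M} (h : Good v) (hx : x ∈ v) : Sub x v := fun _ hy => h.trans hy hx

theorem Good.empty {v : M} (h : Good v) : empty ∈ v := h.nat empty_mem_omega

theorem Good.shift {v x : M} (h : Good v) (hx : x ∈ v) : shift x ∈ v := by
  unfold ZFM.shift
  split_ifs with hn
  · exact h.nat (succ_mem_omega hn)
  · exact hx

/-- Flatness of the pairing is what is used: the elements of `pr x y` are codes of elements of `x`
and `y`, hence lie in `v` when `x` and `y` are subsets of `v`. -/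
theorem Good.power {v : M} (h : Good v) : Good (power v) where
  trans hx hy := mem_power.2 (h.sub_of_mem (mem_power.1 hy _ hx))
  sub hx hy := mem_power.2 (hx.trans (mem_power.1 hy))
  nat hn := mem_power.2 (h.sub_of_mem (h.nat hn))
  code0 ht := mem_power.2 fun z hz => by
    obtain ⟨t, ht', rfl⟩ := mem_code0.1 hz
    exact h.shift (mem_power.1 ht t ht')
  code1 ht := mem_power.2 fun z hz => by
    rcases mem_code1.1 hz with ⟨t, ht', rfl⟩ | rfl
    · exact h.shift (mem_power.1 ht t ht')
    · exact h.empty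
  pr hx hy := mem_power.2 fun z hz => by
    rcases mem_pr.1 hz with ⟨t, ht, rfl⟩ | ⟨t, ht, rfl⟩
    · exact h.code0 (mem_power.1 hx t ht)
    · exact h.code1 (mem_power.1 hy t ht)

theorem self_mem_power (v : M) : v ∈ power v := mem_power.2 (Sub.refl v)

theorem Good.mem_power_of_mem {v x : M} (h : Good v) (hx : x ∈ v) : x ∈ ZFM.power v :=
  mem_power.2 (h.sub_of_mem hx)

theorem Good.omega_sub {v : M} (h : Good v) : Sub omega v := fun _ hn => h.nat hn

theorem IsFunc.sub {f a b v : M} (hf : IsFunc f a b) (h : Good v) (ha : Sub a v) (hb : Sub b v) :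
    Sub f v := fun p hp => by
  obtain ⟨x, y, hx, hy, rfl⟩ := hf.1 p hp
  exact h.pr (ha x hx) (hb y hy)

/-! ### Iterating a class function along `ω` -/

/-- Every set belongs to a set that is closed under a given class function. -/
theorem exists_closed (t : M → M) [ht : DfT₁ M t] (a : M) :
    ∃ B : M, a ∈ B ∧ ∀ x, x ∈ B → t x ∈ B := by
  -- `A n g` says that `g` is the approximation of length `n + 1` to the sequence of iterates of `t`
  -- at `a`.
  let A : M → M → Prop := fun n g => (∃ b, IsFunc g (succ n) b) ∧ val g empty = a ∧
    ∀ i, i ∈ n → val g (succ i) = t (val g i)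
  have ht₂ : ∀ {E : Type u} [Env M E] {x : E → M} [DfT M x], DfT M (fun e => t (x e)) :=
    fun {E} _ {x} hx => DfT.comp1 ht hx
  have hA : Df₂ M A := by
    change Df M fun e : (PUnit.{u + 1} × M) × M => (∃ b, IsFunc e.2 (succ e.1.2) b) ∧
      val e.2 empty = a ∧ ∀ i, i ∈ e.1.2 → val e.2 (succ i) = t (val e.2 i)
    infer_instance
  have hA' : ∀ {E : Type u} [Env M E] {x y : E → M} [DfT M x] [DfT M y],
      Df M (fun e => A (x e) (y e)) := fun {E} _ {x y} hx hy => Df.comp2 hA hx hy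
  have huniq : ∀ i, i ∈ (omega : M) → ∀ n g m h, A n g → A m h → IsOrd n → IsOrd m →
      i ∈ succ n → i ∈ succ m → val g i = val h i := by
    refine omega_induction _ ?_ ?_
    · intro n g m h hg hh _ _ _ _
      rw [hg.2.1, hh.2.1]
    · intro i _ ih n g m h hg hh hn hm hin him
      have h1 : ∀ n : M, IsOrd n → succ i ∈ succ n → i ∈ n := fun n hn hi => by
        rcases mem_succ.1 hi with hi | rfl
        · exact hn.trans_mem (self_mem_succ i) hi
        · exact self_mem_succ i
      rw [hg.2.2 i (h1 n hn hin), hh.2.2 i (h1 m hm him),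
        ih n g m h hg hh hn hm (mem_succ.2 (Or.inl (h1 n hn hin)))
          (mem_succ.2 (Or.inl (h1 m hm him)))]
  have hex : ∀ n, n ∈ (omega : M) → ∃ g, A n g := by
    refine omega_induction _ ?_ ?_
    · have h1 : (empty : M) ∈ succ (empty : M) := self_mem_succ _
      have hF := isFunc_mkFun (X := succ (empty : M)) (t := fun _ => a) (B := succ a)
        fun _ _ => self_mem_succ a
      refine ⟨_, ⟨_, hF⟩, ?_, fun i hi => (not_mem_empty i hi).elim⟩
      rw [hF.val_eq h1, app_mkFun h1]
    · rintro n hn ⟨g, ⟨b, hg⟩, h0, hs⟩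
      classical
      let s : M → M := fun i => if i ∈ succ n then val g i else t (val g n)
      obtain ⟨B, hB⟩ := exists_bound s (succ (succ n))
      have hF := isFunc_mkFun hB
      have hv : ∀ i, i ∈ succ (succ n) → val (mkFun (succ (succ n)) s) i = s i := fun i hi => by
        rw [hF.val_eq hi, app_mkFun hi]
      have hlow : ∀ i, i ∈ succ n → val (mkFun (succ (succ n)) s) i = val g i := fun i hi => by
        rw [hv i (mem_succ.2 (Or.inl hi))]
        exact if_pos hi
      have h0n : (empty : M) ∈ succ n :=
        omega_induction (fun m => empty ∈ succ m) (self_mem_succ _)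
          (fun _ _ h => mem_succ.2 (Or.inl h)) n hn
      refine ⟨_, ⟨B, hF⟩, by rw [hlow _ h0n, h0], fun i hi => ?_⟩
      rw [hlow i hi]
      rcases mem_succ.1 hi with hi | rfl
      · rw [hlow _ ((mem_omega.1 hn).1.succ_mem_succ hi), hs i hi]
      · rw [hv _ (self_mem_succ _)]
        exact if_neg (not_mem_self _)
  -- All approximations agree, so the union of their values at `n` is the `n`-th iterate, and
  -- Replacement collects these.
  let T : M → M := fun n => theSet fun z => ∃ g, A n g ∧ z ∈ val g n
  have hT : ∀ n, n ∈ (omega : M) → ∀ g, A n g → T n = val g n := fun n hn g hg =>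
    theSet_eq fun z => ⟨fun hz => ⟨g, hg, hz⟩, fun ⟨g', hg', hz⟩ => by
      rwa [huniq n hn n g n g' hg hg' (mem_omega.1 hn).1 (mem_omega.1 hn).1 (self_mem_succ n)
        (self_mem_succ n)]⟩
  obtain ⟨B, hB⟩ := replacement T omega
  refine ⟨B, ?_, fun x hx => ?_⟩
  · obtain ⟨g, hg⟩ := hex _ empty_mem_omega
    exact (hB a).2 ⟨empty, empty_mem_omega, by rw [hT _ empty_mem_omega g hg, hg.2.1]⟩
  · obtain ⟨n, hn, rfl⟩ := (hB x).1 hx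
    obtain ⟨g, hg⟩ := hex _ (succ_mem_omega hn)
    obtain ⟨g', hg'⟩ := hex _ hn
    refine (hB _).2 ⟨succ n, succ_mem_omega hn, ?_⟩
    rw [hT _ (succ_mem_omega hn) g hg, hg.2.2 n (self_mem_succ n), hT n hn g' hg',
      huniq n hn n g' (succ n) g hg' hg (mem_omega.1 hn).1 (mem_omega.1 hn).1.succ
        (self_mem_succ n) (mem_succ.2 (Or.inl (self_mem_succ n)))]

/-- `IsInfEven` tests only sets, so the class `P` is first cut down to a set containing the limit
ordinal and closed under adding 2. -/
theorem IsInfEven.induction (P : M → Prop) [Df₁ M P] {η : M} (hη : IsInfEven η)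
    (h0 : ∀ lam, IsLim lam → P lam) (hs : ∀ β, P β → P (succ (succ β))) : P η := by
  obtain ⟨lam, hlam, h⟩ := hη
  obtain ⟨B, hB, hB'⟩ := exists_closed (fun x => succ (succ x)) lam
  obtain ⟨C, hC⟩ := separation P B
  exact ((hC η).1 (h C ((hC _).2 ⟨hB, h0 lam hlam⟩) fun β hβ =>
    (hC _).2 ⟨hB' β ((hC β).1 hβ).1, hs β ((hC β).1 hβ).2⟩)).2

theorem IsInfEven.isOrd {η : M} (hη : IsInfEven η) : IsOrd η :=
  hη.induction IsOrd (fun _ h => h.1) fun _ h => h.succ.succ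

/-! ### The cumulative hierarchy -/

/-- `v = V_λ` for a limit ordinal `λ`, and `W = {V_α : α < λ}`. -/
structure LimLevel (v W : M) : Prop where
  mem_iff : ∀ x : M, x ∈ v ↔ ∃ t, t ∈ W ∧ x ∈ t
  down : ∀ t x : M, t ∈ W → x ∈ t → ∃ t', t' ∈ W ∧ t' ∈ t ∧ Sub x t' ∧ ∀ u, Sub u t' → u ∈ t
  up : ∀ t : M, t ∈ W → ∃ t', t' ∈ W ∧ ∀ u, Sub u t → u ∈ t'
  dir : ∀ t t' : M, t ∈ W → t' ∈ W → Sub t t' ∨ Sub t' t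
  tr : ∀ t x y : M, t ∈ W → x ∈ y → y ∈ t → x ∈ t
  nonempty : ∃ t, t ∈ W

/-- Each operation in `Good` raises the level only finitely often, which the limit absorbs. -/
theorem LimLevel.good {v W : M} (h : LimLevel v W) : Good v := by
  have hmem : ∀ t x, t ∈ W → Sub x t → x ∈ v := fun t x ht hx => by
    obtain ⟨t', ht', h'⟩ := h.up t ht
    exact (h.mem_iff x).2 ⟨t', ht', h' x hx⟩
  have hempty : empty ∈ v := by
    obtain ⟨t, ht⟩ := h.nonempty
    exact hmem t _ ht (empty_sub t)
  have hsucc : ∀ t x, t ∈ W → x ∈ t → Sub (succ x) t := fun t x ht hx y hy => by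
    rcases mem_succ.1 hy with hy | rfl
    · exact h.tr t y x ht hy hx
    · exact hx
  have hshift : ∀ t x, t ∈ W → x ∈ t → Sub (ZFM.shift x) t := fun t x ht hx => by
    unfold ZFM.shift
    split_ifs
    · exact hsucc t x ht hx
    · exact fun y hy => h.tr t y x ht hy hx
  have hcode : ∀ t, t ∈ W → ∃ t', t' ∈ W ∧ ∀ x, x ∈ t → ZFM.code0 x ∈ t' ∧ ZFM.code1 x ∈ t' := by
    intro t ht
    obtain ⟨t1, ht1, h1⟩ := h.up t ht
    obtain ⟨t2, ht2, h2⟩ := h.up t1 ht1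
    refine ⟨t2, ht2, fun x hx => ⟨h2 _ fun z hz => ?_, h2 _ fun z hz => ?_⟩⟩
    · obtain ⟨s, hs, rfl⟩ := mem_code0.1 hz
      exact h1 _ (hshift t s ht (h.tr t s x ht hs hx))
    · rcases mem_code1.1 hz with ⟨s, hs, rfl⟩ | rfl
      · exact h1 _ (hshift t s ht (h.tr t s x ht hs hx))
      · exact h1 _ (empty_sub t)
  refine ⟨fun {x y} hx hy => ?_, fun {x y} hx hy => ?_, fun {n} hn => ?_, fun {t} ht => ?_,
    fun {t} ht => ?_, fun {x y} hx hy => ?_⟩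
  · obtain ⟨t, ht, h'⟩ := (h.mem_iff y).1 hy
    exact (h.mem_iff x).2 ⟨t, ht, h.tr t x y ht hx h'⟩
  · obtain ⟨t, ht, h'⟩ := (h.mem_iff y).1 hy
    exact hmem t x ht fun z hz => h.tr t z y ht (hx z hz) h'
  · refine omega_induction (fun n => n ∈ v) hempty (fun n _ hn => ?_) n hn
    obtain ⟨t, ht, h'⟩ := (h.mem_iff n).1 hn
    exact hmem t _ ht (hsucc t n ht h')
  · obtain ⟨s, hs, h'⟩ := (h.mem_iff t).1 ht
    obtain ⟨s', hs', h2⟩ := hcode s hs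
    exact (h.mem_iff _).2 ⟨s', hs', (h2 t h').1⟩
  · obtain ⟨s, hs, h'⟩ := (h.mem_iff t).1 ht
    obtain ⟨s', hs', h2⟩ := hcode s hs
    exact (h.mem_iff _).2 ⟨s', hs', (h2 t h').2⟩
  · obtain ⟨t, ht, hxt, hyt⟩ : ∃ t, t ∈ W ∧ x ∈ t ∧ y ∈ t := by
      obtain ⟨s, hs, h1⟩ := (h.mem_iff x).1 hx
      obtain ⟨t, ht, h2⟩ := (h.mem_iff y).1 hy
      rcases h.dir s t hs ht with h3 | h3
      · exact ⟨t, ht, h3 x h1, h2⟩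
      · exact ⟨s, hs, h1, h3 y h2⟩
    obtain ⟨t', ht', h'⟩ := hcode t ht
    refine hmem t' _ ht' fun z hz => ?_
    rcases mem_pr.1 hz with ⟨s, hs, rfl⟩ | ⟨s, hs, rfl⟩
    · exact (h' s (h.tr t s x ht hs hxt)).1
    · exact (h' s (h.tr t s y ht hs hyt)).2

/-- Induction on the levels `V_η` for infinite even `η`. -/
theorem even_level_induction (Q : M → Prop) [hQ : Df₁ M Q] {η v : M} (hη : IsInfEven η)
    (hv : IsVLevel η v) (h0 : ∀ v W, LimLevel v W → Q v)
    (hs : ∀ v, Q v → Q (power (power v))) : Q v := by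
  obtain ⟨f, b, hf, hf0, hfs, hfl, rfl⟩ := hv
  have hord := hη.isOrd
  have hin : ∀ α, α ∈ η → α ∈ succ η := fun α h => mem_succ.2 (Or.inl h)
  have h0η : empty ∈ succ η := by
    rcases hord.cases with rfl | ⟨y, hy, -⟩ | h
    · exact self_mem_succ _
    all_goals
      by_contra h'
      -- If ∅ were not in η + 1, every `x ∈ η` would be nonzero and so would have an element lying
      -- in η, against the induction hypothesis. Hence η would be empty, which is absurd for a
      -- successor or a limit.
      have := mem_induction (fun y => y ∉ η) η (fun x hx ih => by
        rcases (hord.mem hx).cases with rfl | ⟨y, hy, -⟩ | h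
        · exact (h' (hin _ hx)).elim
        · exact (ih y hy (hord.trans_mem hy hx) (hord.trans_mem hy hx)).elim
        · obtain ⟨y, hy⟩ := exists_mem_of_ne_empty h.2.1
          exact (ih y hy (hord.trans_mem hy hx) (hord.trans_mem hy hx)).elim)
    · exact this y hy hy
    · obtain ⟨y, hy⟩ := exists_mem_of_ne_empty h.2.1
      exact this y hy hy
  have hval : ∀ α, α ∈ succ η → app f α = val f α := fun α hα => (hf.val_eq hα).symm
  rw [hval _ h0η] at hf0
  have hfs' : ∀ α, α ∈ η → val f (succ α) = power (val f α) := fun α hα => by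
    rw [← hval α (hin α hα), ← hfs α hα, hval _ (hord.succ_mem_succ hα)]
  have hfl' : ∀ α, α ∈ succ η → IsLim α → ∀ x, x ∈ val f α ↔ ∃ β, β ∈ α ∧ x ∈ val f β := by
    intro α hα hl x
    rw [← hval α hα, hfl α hα hl]
    -- `app` is a choice operator of the metatheory; only after it is replaced by `val` does the
    -- class become visibly definable.
    have : (theSet fun x : M => ∃ β : M, β ∈ α ∧ x ∈ app f β) =
        theSet fun x => ∃ β : M, β ∈ α ∧ x ∈ val f β :=
      theSet_congr fun x => exists_congr fun β => and_congr_right fun hβ => by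
        rw [hval β (hord.succ.trans_mem hβ hα)]
    rw [this]
    obtain ⟨c, hc⟩ := replacement (fun β => val f β) α
    obtain ⟨d, hd⟩ := ZFModel.union c
    refine mem_theSet (a := d) (fun y hy => ?_) x
    obtain ⟨β, hβ, hy⟩ := hy
    exact (hd y).2 ⟨_, (hc _).2 ⟨β, hβ, rfl⟩, hy⟩
  -- The recursion in uniform form, V_α = ⋃_{β<α} 𝒫(V_β). Monotonicity and the properties of limit
  -- levels follow without further case distinctions.
  have key : ∀ α, α ∈ succ η → ∀ x, x ∈ val f α ↔ ∃ β, β ∈ α ∧ Sub x (val f β) := by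
    refine mem_induction _ _ fun α hα ih x => ?_
    have ih' : ∀ β, β ∈ α → ∀ x, x ∈ val f β ↔ ∃ γ, γ ∈ β ∧ Sub x (val f γ) := fun β hβ =>
      ih β hβ (hord.succ.trans_mem hβ hα)
    have hαo := hord.succ.mem hα
    rcases hαo.cases with rfl | ⟨γ, hγ, rfl⟩ | hl
    · rw [hf0]
      exact ⟨fun h => (not_mem_empty _ h).elim, fun ⟨β, hβ, _⟩ => (not_mem_empty _ hβ).elim⟩
    · have hγη : γ ∈ η := by
        rcases mem_succ.1 hα with h | h
        · exact hord.trans_mem hγ h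
        · exact h ▸ hγ
      rw [hfs' γ hγη, mem_power]
      refine ⟨fun h => ⟨γ, hγ, h⟩, fun ⟨β, hβ, h⟩ => ?_⟩
      rcases mem_succ.1 hβ with hβ' | rfl
      · refine h.trans fun u hu => ?_
        obtain ⟨δ, hδ, hu'⟩ := (ih' β hβ u).1 hu
        exact (ih' γ hγ u).2 ⟨δ, (hαo.mem hγ).trans_mem hδ hβ', hu'⟩
      · exact h
    · rw [hfl' α hα hl]
      constructor
      · rintro ⟨β, hβ, hx⟩
        obtain ⟨δ, hδ, hx'⟩ := (ih' β hβ x).1 hx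
        exact ⟨δ, hαo.trans_mem hδ hβ, hx'⟩
      · rintro ⟨β, hβ, hx⟩
        exact ⟨succ β, hl.2.2 β hβ, (ih' _ (hl.2.2 β hβ) x).2 ⟨β, self_mem_succ β, hx⟩⟩
  have hmono : ∀ α β, α ∈ succ η → β ∈ α → Sub (val f β) (val f α) := fun α β hα hβ u hu => by
    have hβ' := hord.succ.trans_mem hβ hα
    obtain ⟨δ, hδ, hu'⟩ := (key β hβ' u).1 hu
    exact (key α hα u).2 ⟨δ, (hord.succ.mem hα).trans_mem hδ hβ, hu'⟩
  have hlim : ∀ α, α ∈ succ η → IsLim α →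
      LimLevel (val f α) (theSet fun y => ∃ β, β ∈ α ∧ y = val f β) := by
    intro α hα hl
    have hW := mem_image (fun β => val f β) α
    have hin' : ∀ β, β ∈ α → β ∈ succ η := fun β hβ => hord.succ.trans_mem hβ hα
    refine ⟨fun x => ?_, fun t x ht hx => ?_, fun t ht => ?_, fun t t' ht ht' => ?_,
      fun t x y ht hx hy => ?_, ?_⟩
    · rw [hfl' α hα hl]
      exact ⟨fun ⟨β, hβ, hx⟩ => ⟨_, (hW _).2 ⟨β, hβ, rfl⟩, hx⟩, fun ⟨t, ht, hx⟩ => by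
        obtain ⟨β, hβ, rfl⟩ := (hW t).1 ht
        exact ⟨β, hβ, hx⟩⟩
    · obtain ⟨β, hβ, rfl⟩ := (hW t).1 ht
      obtain ⟨δ, hδ, h'⟩ := (key β (hin' β hβ) x).1 hx
      exact ⟨_, (hW _).2 ⟨δ, hl.1.trans_mem hδ hβ, rfl⟩,
        (key β (hin' β hβ) _).2 ⟨δ, hδ, Sub.refl _⟩, h',
        fun u hu => (key β (hin' β hβ) u).2 ⟨δ, hδ, hu⟩⟩
    · obtain ⟨β, hβ, rfl⟩ := (hW t).1 ht
      exact ⟨_, (hW _).2 ⟨succ β, hl.2.2 β hβ, rfl⟩, fun u hu =>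
        (key _ (hin' _ (hl.2.2 β hβ)) u).2 ⟨β, self_mem_succ β, hu⟩⟩
    · obtain ⟨β, hβ, rfl⟩ := (hW t).1 ht
      obtain ⟨γ, hγ, rfl⟩ := (hW t').1 ht'
      rcases hl.1.2 β γ hβ hγ with h | rfl | h
      · exact Or.inl (hmono γ β (hin' γ hγ) h)
      · exact Or.inl (Sub.refl _)
      · exact Or.inr (hmono β γ (hin' β hβ) h)
    · obtain ⟨β, hβ, rfl⟩ := (hW t).1 ht
      obtain ⟨δ, hδ, h'⟩ := (key β (hin' β hβ) y).1 hy
      exact hmono β δ (hin' β hβ) hδ x (h' x hx)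
    · obtain ⟨β, hβ⟩ := exists_mem_of_ne_empty hl.2.1
      exact ⟨_, (hW _).2 ⟨β, hβ, rfl⟩⟩
  have hQ' : ∀ {E : Type u} [Env M E] {x : E → M} [DfT M x], Df M (fun e => Q (x e)) :=
    fun {E} _ {x} hx => Df.comp1 hQ hx
  rw [hval η (self_mem_succ η)]
  refine hη.induction (fun α => α ∈ succ η → Q (val f α)) (fun lam hl hlη => ?_)
    (fun β ih hβ => ?_) (self_mem_succ η)
  · exact h0 _ _ (hlim lam hlη hl)
  · have h1 : succ β ∈ η := by
      rcases mem_succ.1 hβ with h | rfl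
      · exact hord.trans_mem (self_mem_succ _) h
      · exact self_mem_succ _
    have h2 : β ∈ η := hord.trans_mem (self_mem_succ _) h1
    rw [hfs' _ h1, hfs' _ h2]
    exact hs _ (ih (hin β h2))

theorem IsVLevel.good {η v : M} (hv : IsVLevel η v) (hη : IsInfEven η) : Good v :=
  even_level_induction Good hη hv (fun _ _ h => h.good) fun _ h => h.power.power

end

end ZFM



/-! ### Formulas and satisfaction inside `M`. -/

namespace ZFM

section
variable {M : Type u} [ZFModel M]

/-! ### Formulas -/

@[simp] theorem num_eq {i j : ℕ} : (num i : M) = num j ↔ i = j := ⟨num_inj, fun h => h ▸ rfl⟩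

theorem Good.fMem {v m n : M} (h : Good v) (hm : m ∈ v) (hn : n ∈ v) : fMem m n ∈ v :=
  h.pr (h.nat (num_mem_omega 0)) (h.pr hm hn)

theorem Good.fEq {v m n : M} (h : Good v) (hm : m ∈ v) (hn : n ∈ v) : fEq m n ∈ v :=
  h.pr (h.nat (num_mem_omega 1)) (h.pr hm hn)

theorem Good.fNot {v φ : M} (h : Good v) (hφ : φ ∈ v) : fNot φ ∈ v :=
  h.pr (h.nat (num_mem_omega 2)) hφ

theorem Good.fAnd {v φ ψ : M} (h : Good v) (hφ : φ ∈ v) (hψ : ψ ∈ v) : fAnd φ ψ ∈ v :=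
  h.pr (h.nat (num_mem_omega 3)) (h.pr hφ hψ)

theorem Good.fEx {v m φ : M} (h : Good v) (hm : m ∈ v) (hφ : φ ∈ v) : fEx m φ ∈ v :=
  h.pr (h.nat (num_mem_omega 4)) (h.pr hm hφ)

theorem isFml_fMem {m n : M} (hm : m ∈ (omega : M)) (hn : n ∈ (omega : M)) : IsFml (fMem m n) :=
  fun _ hC _ => (hC.1 m n hm hn).1

theorem isFml_fEq {m n : M} (hm : m ∈ (omega : M)) (hn : n ∈ (omega : M)) : IsFml (fEq m n) :=
  fun _ hC _ => (hC.1 m n hm hn).2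

theorem IsFml.fNot {φ : M} (h : IsFml φ) : IsFml (fNot φ) := fun C hC hE => hC.2.1 φ (h C hC hE)

theorem IsFml.fAnd {φ ψ : M} (h : IsFml φ) (h' : IsFml ψ) : IsFml (fAnd φ ψ) :=
  fun C hC hE => hC.2.2 φ ψ (h C hC hE) (h' C hC hE)

theorem IsFml.fEx {m φ : M} (hm : m ∈ (omega : M)) (h : IsFml φ) : IsFml (fEx m φ) :=
  fun C hC hE => hE m φ hm (h C hC hE)

theorem isSigma0_fMem {m n : M} (hm : m ∈ (omega : M)) (hn : n ∈ (omega : M)) :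
    IsSigma0 (fMem m n) := fun _ hC _ => (hC.1 m n hm hn).1

theorem isSigma0_fEq {m n : M} (hm : m ∈ (omega : M)) (hn : n ∈ (omega : M)) :
    IsSigma0 (fEq m n) := fun _ hC _ => (hC.1 m n hm hn).2

theorem IsSigma0.fNot {φ : M} (h : IsSigma0 φ) : IsSigma0 (fNot φ) :=
  fun C hC hE => hC.2.1 φ (h C hC hE)

theorem IsSigma0.fAnd {φ ψ : M} (h : IsSigma0 φ) (h' : IsSigma0 ψ) : IsSigma0 (fAnd φ ψ) :=
  fun C hC hE => hC.2.2 φ ψ (h C hC hE) (h' C hC hE)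

theorem IsSigma0.fBEx {m n φ : M} (hm : m ∈ (omega : M)) (hn : n ∈ (omega : M)) (hmn : m ≠ n)
    (h : IsSigma0 φ) : IsSigma0 (fEx m (ZFM.fAnd (fMem m n) φ)) :=
  fun C hC hE => hE m n φ hm hn hmn (h C hC hE)

theorem Good.boolClosed {v : M} (h : Good v) : BoolClosed v :=
  ⟨fun _ _ hm hn => ⟨h.fMem (h.nat hm) (h.nat hn), h.fEq (h.nat hm) (h.nat hn)⟩,
    fun _ => h.fNot, fun _ _ => h.fAnd⟩

theorem IsFml.mem_good {φ v : M} (h : IsFml φ) (hv : Good v) : φ ∈ v :=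
  h v hv.boolClosed fun _ _ hm hψ => hv.fEx (hv.nat hm) hψ

/-- A closed set `A` contains all formulas, so the formulas with property `P` form a set, to which
the definition of `IsFml` applies. -/
theorem fml_induction {A : M} (hA : Good A) (P : M → Prop) [Df₁ M P]
    (hmem : ∀ m n, m ∈ (omega : M) → n ∈ (omega : M) → P (fMem m n))
    (heq : ∀ m n, m ∈ (omega : M) → n ∈ (omega : M) → P (fEq m n))
    (hnot : ∀ φ, IsFml φ → P φ → P (fNot φ))
    (hand : ∀ φ ψ, IsFml φ → IsFml ψ → P φ → P ψ → P (fAnd φ ψ))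
    (hex : ∀ m φ, m ∈ (omega : M) → IsFml φ → P φ → P (fEx m φ)) (φ : M) (hφ : IsFml φ) :
    P φ := by
  obtain ⟨C, hC⟩ := separation (fun φ => IsFml φ ∧ P φ) A
  refine ((hC φ).1 (hφ C ⟨fun m n hm hn => ⟨?_, ?_⟩, fun φ h => ?_, fun φ ψ h h' => ?_⟩
    fun m φ hm h => ?_)).2.2
  · exact (hC _).2 ⟨(isFml_fMem hm hn).mem_good hA, isFml_fMem hm hn, hmem m n hm hn⟩
  · exact (hC _).2 ⟨(isFml_fEq hm hn).mem_good hA, isFml_fEq hm hn, heq m n hm hn⟩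
  · obtain ⟨_, h1, h2⟩ := (hC _).1 h
    exact (hC _).2 ⟨h1.fNot.mem_good hA, h1.fNot, hnot φ h1 h2⟩
  · obtain ⟨_, h1, h2⟩ := (hC _).1 h
    obtain ⟨_, h3, h4⟩ := (hC _).1 h'
    exact (hC _).2 ⟨(h1.fAnd h3).mem_good hA, h1.fAnd h3, hand φ ψ h1 h3 h2 h4⟩
  · obtain ⟨_, h1, h2⟩ := (hC _).1 h
    exact (hC _).2 ⟨(h1.fEx hm).mem_good hA, h1.fEx hm, hex m φ hm h1 h2⟩

theorem sigma0_induction {A : M} (hA : Good A) (P : M → Prop) [Df₁ M P]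
    (hmem : ∀ m n, m ∈ (omega : M) → n ∈ (omega : M) → P (fMem m n))
    (heq : ∀ m n, m ∈ (omega : M) → n ∈ (omega : M) → P (fEq m n))
    (hnot : ∀ φ, IsFml φ → P φ → P (fNot φ))
    (hand : ∀ φ ψ, IsFml φ → IsFml ψ → P φ → P ψ → P (fAnd φ ψ))
    (hex : ∀ m n φ, m ∈ (omega : M) → n ∈ (omega : M) → m ≠ n → IsFml φ → P φ →
      P (fEx m (fAnd (fMem m n) φ))) (φ : M) (hφ : IsSigma0 φ) : IsFml φ ∧ P φ := by
  obtain ⟨C, hC⟩ := separation (fun φ => IsFml φ ∧ P φ) A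
  have mk : ∀ φ, IsFml φ → P φ → φ ∈ C := fun φ h h' => (hC _).2 ⟨h.mem_good hA, h, h'⟩
  refine ((hC φ).1 (hφ C ⟨fun m n hm hn => ⟨?_, ?_⟩, fun φ h => ?_, fun φ ψ h h' => ?_⟩
    fun m n φ hm hn hmn h => ?_)).2
  · exact mk _ (isFml_fMem hm hn) (hmem m n hm hn)
  · exact mk _ (isFml_fEq hm hn) (heq m n hm hn)
  · obtain ⟨_, h1, h2⟩ := (hC _).1 h
    exact mk _ h1.fNot (hnot φ h1 h2)
  · obtain ⟨_, h1, h2⟩ := (hC _).1 h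
    obtain ⟨_, h3, h4⟩ := (hC _).1 h'
    exact mk _ (h1.fAnd h3) (hand φ ψ h1 h3 h2 h4)
  · obtain ⟨_, h1, h2⟩ := (hC _).1 h
    exact mk _ (((isFml_fMem hm hn).fAnd h1).fEx hm) (hex m n φ hm hn hmn h1 h2)

theorem IsSigma0.isFml {A φ : M} (hA : Good A) (h : IsSigma0 φ) : IsFml φ :=
  (sigma0_induction hA (fun _ => True) (fun _ _ _ _ => trivial) (fun _ _ _ _ => trivial)
    (fun _ _ _ => trivial) (fun _ _ _ _ _ _ => trivial) (fun _ _ _ _ _ _ _ _ => trivial) φ h).1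

theorem sigma1_induction {A : M} (hA : Good A) (P : M → Prop) [Df₁ M P]
    (h0 : ∀ φ, IsSigma0 φ → P φ)
    (hex : ∀ m φ, m ∈ (omega : M) → IsFml φ → P φ → P (fEx m φ)) (φ : M) (hφ : IsSigma1 φ) :
    IsFml φ ∧ P φ := by
  obtain ⟨C, hC⟩ := separation (fun φ => IsFml φ ∧ P φ) A
  refine ((hC φ).1 (hφ C (fun φ h => ?_) fun m φ hm h => ?_)).2
  · exact (hC _).2 ⟨(h.isFml hA).mem_good hA, h.isFml hA, h0 φ h⟩
  · obtain ⟨_, h1, h2⟩ := (hC _).1 h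
    exact (hC _).2 ⟨(h1.fEx hm).mem_good hA, h1.fEx hm, hex m φ hm h1 h2⟩

/-! ### Truth sets and satisfaction -/

/-- The set of all assignments `ω → A`. -/
noncomputable def asg (A : M) : M := theSet fun s => IsFunc s omega A

/-- A definable version of `AgreeOff`. -/
def AgOff (m s t : M) : Prop := ∀ i : M, i ∈ (omega : M) → i ≠ m → val t i = val s i

/-- The assignments that satisfy `v_m ∈ v_n`. -/
noncomputable def tMem (A m n : M) : M := theSet fun s => s ∈ asg A ∧ val s m ∈ val s n

/-- The assignments that satisfy `v_m = v_n`. -/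
noncomputable def tEq (A m n : M) : M := theSet fun s => s ∈ asg A ∧ val s m = val s n

/-- The assignments that are not in `X`. -/
noncomputable def tNot (A X : M) : M := theSet fun s => s ∈ asg A ∧ s ∉ X

/-- The assignments in `X ∩ Y`. -/
noncomputable def tAnd (A X Y : M) : M := theSet fun s => s ∈ asg A ∧ (s ∈ X ∧ s ∈ Y)

/-- The assignments that differ at most at `m` from an element of `X`. -/
noncomputable def tEx (A m X : M) : M := theSet fun s => s ∈ asg A ∧ ∃ t, t ∈ X ∧ AgOff m s t

/-- `C` is closed under the inductive definition of truth sets. -/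
def TrClosed (A C : M) : Prop :=
  (∀ m n : M, m ∈ (omega : M) → n ∈ (omega : M) →
    pr (fMem m n) (tMem A m n) ∈ C ∧ pr (fEq m n) (tEq A m n) ∈ C) ∧
  (∀ φ X : M, pr φ X ∈ C → pr (fNot φ) (tNot A X) ∈ C) ∧
  (∀ φ ψ X Y : M, pr φ X ∈ C → pr ψ Y ∈ C → pr (fAnd φ ψ) (tAnd A X Y) ∈ C) ∧
  ∀ m φ X : M, m ∈ (omega : M) → pr φ X ∈ C → pr (fEx m φ) (tEx A m X) ∈ C

/-- `X` is the truth set of `φ` in `A`. -/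
def IsTr (A φ X : M) : Prop := ∀ C : M, TrClosed A C → pr φ X ∈ C

/-- `(A, ∈) ⊨ φ[s]`, in terms of truth sets. -/
def Tr (A φ s : M) : Prop := ∃ X, IsTr A φ X ∧ s ∈ X

section Df
variable {E : Type u} [Env M E] {a b c : E → M} [ha : DfT M a] [hb : DfT M b] [hc : DfT M c]

instance df_asg : DfT M (fun e => asg (a e)) := DfT.comp1 (by unfold asg; infer_instance) ha

instance df_AgOff : Df M (fun e => AgOff (a e) (b e) (c e)) :=
  Df.comp3 (by unfold AgOff; infer_instance) ha hb hc

instance df_tMem : DfT M (fun e => tMem (a e) (b e) (c e)) :=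
  DfT.comp3 (by unfold tMem; infer_instance) ha hb hc

instance df_tEq : DfT M (fun e => tEq (a e) (b e) (c e)) :=
  DfT.comp3 (by unfold tEq; infer_instance) ha hb hc

instance df_tNot : DfT M (fun e => tNot (a e) (b e)) :=
  DfT.comp2 (by unfold tNot; infer_instance) ha hb

instance df_tAnd : DfT M (fun e => tAnd (a e) (b e) (c e)) :=
  DfT.comp3 (by unfold tAnd; infer_instance) ha hb hc

instance df_tEx : DfT M (fun e => tEx (a e) (b e) (c e)) :=
  DfT.comp3 (by unfold tEx; infer_instance) ha hb hc

instance df_TrClosed : Df M (fun e => TrClosed (a e) (b e)) :=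
  Df.comp2 (by unfold TrClosed; infer_instance) ha hb

instance df_IsTr : Df M (fun e => IsTr (a e) (b e) (c e)) :=
  Df.comp3 (by unfold IsTr; infer_instance) ha hb hc

instance df_Tr : Df M (fun e => Tr (a e) (b e) (c e)) :=
  Df.comp3 (by unfold Tr; infer_instance) ha hb hc

end Df

section
variable {A : M}

theorem mem_asg' (hA : Good A) {s : M} : s ∈ asg A ↔ IsFunc s omega A :=
  mem_theSet (a := power A) (fun s (hs : IsFunc s omega A) =>
    mem_power.2 (hs.sub hA hA.omega_sub (Sub.refl A))) s

theorem asg_sub (hA : Good A) : Sub (asg A) (power A) := fun _ hs =>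
  mem_power.2 (((mem_asg' hA).1 hs).sub hA hA.omega_sub (Sub.refl A))

theorem isTr_mem {m n : M} (hm : m ∈ (omega : M)) (hn : n ∈ (omega : M)) :
    IsTr A (fMem m n) (tMem A m n) := fun _ hC => (hC.1 m n hm hn).1

theorem isTr_eq {m n : M} (hm : m ∈ (omega : M)) (hn : n ∈ (omega : M)) :
    IsTr A (fEq m n) (tEq A m n) := fun _ hC => (hC.1 m n hm hn).2

theorem IsTr.not {φ X : M} (h : IsTr A φ X) : IsTr A (fNot φ) (tNot A X) :=
  fun C hC => hC.2.1 φ X (h C hC)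

theorem IsTr.and {φ ψ X Y : M} (h : IsTr A φ X) (h' : IsTr A ψ Y) :
    IsTr A (fAnd φ ψ) (tAnd A X Y) := fun C hC => hC.2.2.1 φ ψ X Y (h C hC) (h' C hC)

theorem IsTr.ex {m φ X : M} (hm : m ∈ (omega : M)) (h : IsTr A φ X) :
    IsTr A (fEx m φ) (tEx A m X) := fun C hC => hC.2.2.2 m φ X hm (h C hC)

theorem exists_isTr (hA : Good A) (φ : M) (hφ : IsFml φ) : ∃ X, IsTr A φ X :=
  fml_induction hA (fun φ => ∃ X, IsTr A φ X) (fun _ _ hm hn => ⟨_, isTr_mem hm hn⟩)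
    (fun _ _ hm hn => ⟨_, isTr_eq hm hn⟩) (fun _ _ ⟨_, h⟩ => ⟨_, h.not⟩)
    (fun _ _ _ _ ⟨_, h⟩ ⟨_, h'⟩ => ⟨_, h.and h'⟩) (fun _ _ hm _ ⟨_, h⟩ => ⟨_, h.ex hm⟩) φ hφ

/-- How a pair of a formula and a truth set arises. -/
def TrInv (A φ X : M) : Prop :=
  (∃ m n : M, φ = fMem m n ∧ X = tMem A m n) ∨ (∃ m n : M, φ = fEq m n ∧ X = tEq A m n) ∨
  (∃ ψ Y : M, IsTr A ψ Y ∧ φ = fNot ψ ∧ X = tNot A Y) ∨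
  (∃ ψ χ Y Z : M, IsTr A ψ Y ∧ IsTr A χ Z ∧ φ = fAnd ψ χ ∧ X = tAnd A Y Z) ∨
  ∃ m ψ Y : M, IsTr A ψ Y ∧ φ = fEx m ψ ∧ X = tEx A m Y

/-- `IsTr` is the least relation closed under the truth-set clauses. Its pairs that arise from one
of the clauses still form a closed relation, and this is a set because truth sets are subsets of
`power A`; minimality then gives the inversion. -/
theorem IsTr.inv (hA : Good A) {φ X : M} (h : IsTr A φ X) : TrInv A φ X := by
  have hInv : Df₂ M (TrInv A) := by
    change Df M fun e : (PUnit.{u + 1} × M) × M => TrInv A e.1.2 e.2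
    unfold TrInv
    infer_instance
  have hInv' : ∀ {E : Type u} [Env M E] {x y : E → M} [DfT M x] [DfT M y],
      Df M (fun e => TrInv A (x e) (y e)) := fun {E} _ {x y} hx hy => Df.comp2 hInv hx hy
  let Q : M → M → Prop := fun φ X => IsFml φ ∧ IsTr A φ X ∧ TrInv A φ X
  have hB : Good (power (power A)) := hA.power.power
  obtain ⟨C, hC⟩ := separation (fun p => ∃ φ X, p = pr φ X ∧ IsFml φ ∧ IsTr A φ X ∧ TrInv A φ X)
    (power (power A))
  have mk : ∀ φ X, IsFml φ → Sub X (asg A) → IsTr A φ X → TrInv A φ X → pr φ X ∈ C :=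
    fun φ X h h1 h2 h3 => (hC _).2 ⟨hB.pr (h.mem_good hB)
      (mem_power.2 (h1.trans (asg_sub hA))), φ, X, rfl, h, h2, h3⟩
  have sub : ∀ (P : M → Prop) [Df₁ M P], Sub (theSet fun s => s ∈ asg A ∧ P s) (asg A) :=
    fun P _ s hs => ((mem_sep s).1 hs).1
  have un : ∀ φ X, pr φ X ∈ C → IsFml φ ∧ IsTr A φ X := fun φ X h => by
    obtain ⟨_, φ', X', h', h1, h2, _⟩ := (hC _).1 h
    rw [pr_eq] at h'
    rw [h'.1, h'.2]
    exact ⟨h1, h2⟩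
  have hcl : TrClosed A C := by
    refine ⟨fun m n hm hn => ⟨?_, ?_⟩, fun φ X h => ?_, fun φ ψ X Y h h' => ?_,
      fun m φ X hm h => ?_⟩
    · exact mk _ _ (isFml_fMem hm hn) (sub _) (isTr_mem hm hn) (Or.inl ⟨m, n, rfl, rfl⟩)
    · exact mk _ _ (isFml_fEq hm hn) (sub _) (isTr_eq hm hn) (Or.inr (Or.inl ⟨m, n, rfl, rfl⟩))
    · obtain ⟨h1, h2⟩ := un _ _ h
      exact mk _ _ h1.fNot (sub _) h2.not (Or.inr (Or.inr (Or.inl ⟨φ, X, h2, rfl, rfl⟩)))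
    · obtain ⟨h1, h2⟩ := un _ _ h
      obtain ⟨h3, h4⟩ := un _ _ h'
      exact mk _ _ (h1.fAnd h3) (sub _) (h2.and h4)
        (Or.inr (Or.inr (Or.inr (Or.inl ⟨φ, ψ, X, Y, h2, h4, rfl, rfl⟩))))
    · obtain ⟨h1, h2⟩ := un _ _ h
      exact mk _ _ (h1.fEx hm) (sub _) (h2.ex hm)
        (Or.inr (Or.inr (Or.inr (Or.inr ⟨m, φ, X, h2, rfl, rfl⟩))))
  obtain ⟨_, φ', X', h', _, _, h3⟩ := (hC _).1 (h C hcl)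
  rw [pr_eq] at h'
  rw [h'.1, h'.2]
  exact h3

/-- The numeral tags separate the five kinds of formulas, so inversion leaves one clause, whose
constituents have unique truth sets by induction. -/
theorem isTr_unique (hA : Good A) (φ : M) (hφ : IsFml φ) :
    ∀ X Y, IsTr A φ X → IsTr A φ Y → X = Y := by
  have one : ∀ (φ X : M), (∀ Y, TrInv A φ Y → Y = X) → ∀ Y Z, IsTr A φ Y → IsTr A φ Z → Y = Z :=
    fun φ X h Y Z hY hZ => (h Y (hY.inv hA)).trans (h Z (hZ.inv hA)).symm
  refine fml_induction hA (fun φ => ∀ X Y, IsTr A φ X → IsTr A φ Y → X = Y) (fun m n hm hn => ?_)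
    (fun m n hm hn => ?_) (fun φ hφ ih => ?_) (fun φ ψ hφ hψ ih ih' => ?_)
    (fun m φ hm hφ ih => ?_) φ hφ
  · refine one _ (tMem A m n) fun Y h => ?_
    simp only [TrInv, fMem, fEq, fNot, fAnd, fEx, pr_eq, num_eq] at h
    rcases h with ⟨_, _, ⟨_, rfl, rfl⟩, rfl⟩ | ⟨_, _, ⟨h, _⟩, _⟩ | ⟨_, _, _, ⟨h, _⟩, _⟩ |
      ⟨_, _, _, _, _, _, ⟨h, _⟩, _⟩ | ⟨_, _, _, _, ⟨h, _⟩, _⟩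
    · rfl
    all_goals simp at h
  · refine one _ (tEq A m n) fun Y h => ?_
    simp only [TrInv, fMem, fEq, fNot, fAnd, fEx, pr_eq, num_eq] at h
    rcases h with ⟨_, _, ⟨h, _⟩, _⟩ | ⟨_, _, ⟨_, rfl, rfl⟩, rfl⟩ | ⟨_, _, _, ⟨h, _⟩, _⟩ |
      ⟨_, _, _, _, _, _, ⟨h, _⟩, _⟩ | ⟨_, _, _, _, ⟨h, _⟩, _⟩
    rotate_left
    · rfl
    all_goals simp at h
  · obtain ⟨X, hX⟩ := exists_isTr hA φ hφ
    refine one _ (tNot A X) fun Y h => ?_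
    simp only [TrInv, fMem, fEq, fNot, fAnd, fEx, pr_eq, num_eq] at h
    rcases h with ⟨_, _, ⟨h, _⟩, _⟩ | ⟨_, _, ⟨h, _⟩, _⟩ | ⟨_, Z, hZ, ⟨_, rfl⟩, rfl⟩ |
      ⟨_, _, _, _, _, _, ⟨h, _⟩, _⟩ | ⟨_, _, _, _, ⟨h, _⟩, _⟩
    rotate_left 2
    · rw [ih Z X hZ hX]
    all_goals simp at h
  · obtain ⟨X, hX⟩ := exists_isTr hA φ hφ
    obtain ⟨X', hX'⟩ := exists_isTr hA ψ hψ
    refine one _ (tAnd A X X') fun Y h => ?_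
    simp only [TrInv, fMem, fEq, fNot, fAnd, fEx, pr_eq, num_eq] at h
    rcases h with ⟨_, _, ⟨h, _⟩, _⟩ | ⟨_, _, ⟨h, _⟩, _⟩ | ⟨_, _, _, ⟨h, _⟩, _⟩ |
      ⟨_, _, Z, Z', hZ, hZ', ⟨_, rfl, rfl⟩, rfl⟩ | ⟨_, _, _, _, ⟨h, _⟩, _⟩
    rotate_left 3
    · rw [ih Z X hZ hX, ih' Z' X' hZ' hX']
    all_goals simp at h
  · obtain ⟨X, hX⟩ := exists_isTr hA φ hφ
    refine one _ (tEx A m X) fun Y h => ?_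
    simp only [TrInv, fMem, fEq, fNot, fAnd, fEx, pr_eq, num_eq] at h
    rcases h with ⟨_, _, ⟨h, _⟩, _⟩ | ⟨_, _, ⟨h, _⟩, _⟩ | ⟨_, _, _, ⟨h, _⟩, _⟩ |
      ⟨_, _, _, _, _, _, ⟨h, _⟩, _⟩ | ⟨_, _, Z, hZ, ⟨_, rfl, rfl⟩, rfl⟩
    rotate_left 4
    · rw [ih Z X hZ hX]
    all_goals simp at h

theorem IsTr.tr_iff (hA : Good A) {φ X s : M} (h : IsTr A φ X) (hφ : IsFml φ) :
    Tr A φ s ↔ s ∈ X :=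
  ⟨fun ⟨Y, hY, hs⟩ => isTr_unique hA φ hφ Y X hY h ▸ hs, fun hs => ⟨X, h, hs⟩⟩

variable {s : M}

theorem tr_mem (hA : Good A) {m n : M} (hm : m ∈ (omega : M)) (hn : n ∈ (omega : M))
    (hs : IsFunc s omega A) : Tr A (fMem m n) s ↔ val s m ∈ val s n := by
  rw [(isTr_mem hm hn).tr_iff hA (isFml_fMem hm hn), tMem, mem_sep, mem_asg' hA]
  simp [hs]

theorem tr_eq (hA : Good A) {m n : M} (hm : m ∈ (omega : M)) (hn : n ∈ (omega : M))
    (hs : IsFunc s omega A) : Tr A (fEq m n) s ↔ val s m = val s n := by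
  rw [(isTr_eq hm hn).tr_iff hA (isFml_fEq hm hn), tEq, mem_sep, mem_asg' hA]
  simp [hs]

theorem tr_not (hA : Good A) {φ : M} (hφ : IsFml φ) (hs : IsFunc s omega A) :
    Tr A (fNot φ) s ↔ ¬ Tr A φ s := by
  obtain ⟨X, hX⟩ := exists_isTr hA φ hφ
  rw [hX.not.tr_iff hA hφ.fNot, hX.tr_iff hA hφ, tNot, mem_sep, mem_asg' hA]
  simp [hs]

theorem tr_and (hA : Good A) {φ ψ : M} (hφ : IsFml φ) (hψ : IsFml ψ) (hs : IsFunc s omega A) :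
    Tr A (fAnd φ ψ) s ↔ Tr A φ s ∧ Tr A ψ s := by
  obtain ⟨X, hX⟩ := exists_isTr hA φ hφ
  obtain ⟨Y, hY⟩ := exists_isTr hA ψ hψ
  rw [(hX.and hY).tr_iff hA (hφ.fAnd hψ), hX.tr_iff hA hφ, hY.tr_iff hA hψ, tAnd, mem_sep,
    mem_asg' hA]
  simp [hs]

theorem Tr.isFunc (hA : Good A) {φ : M} (h : Tr A φ s) : IsFunc s omega A := by
  obtain ⟨X, hX, hs⟩ := h
  rw [← mem_asg' hA]
  rcases hX.inv hA with ⟨_, _, -, rfl⟩ | ⟨_, _, -, rfl⟩ | ⟨_, _, -, -, rfl⟩ |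
    ⟨_, _, _, _, -, -, -, rfl⟩ | ⟨_, _, _, -, -, rfl⟩
  all_goals exact (mem_sep (a := asg A) s |>.1 hs).1

theorem tr_ex' (hA : Good A) {m φ : M} (hm : m ∈ (omega : M)) (hφ : IsFml φ)
    (hs : IsFunc s omega A) :
    Tr A (fEx m φ) s ↔ ∃ t, AgOff m s t ∧ Tr A φ t := by
  obtain ⟨X, hX⟩ := exists_isTr hA φ hφ
  rw [(hX.ex hm).tr_iff hA (hφ.fEx hm), tEx, mem_sep, mem_asg' hA]
  simp only [hs, true_and, hX.tr_iff hA hφ, and_comm]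

open Classical in
/-- The assignment `s` with the value at `m` changed to `x`. -/
noncomputable def upd (s m x : M) : M := mkFun omega fun i => if i = m then x else val s i

instance df_upd {E : Type u} [Env M E] {a b c : E → M} [ha : DfT M a] [hb : DfT M b]
    [hc : DfT M c] : DfT M (fun e => upd (a e) (b e) (c e)) :=
  DfT.comp3 (by unfold upd; infer_instance) ha hb hc

theorem isFunc_upd (hs : IsFunc s omega A) {m x : M} (hx : x ∈ A) : IsFunc (upd s m x) omega A := by
  refine isFunc_mkFun fun i hi => ?_
  split_ifs
  · exact hx
  · exact hs.val_eq hi ▸ hs.app_mem hi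

theorem val_mkFun {t : M → M} [DfT₁ M t] {X x : M} (hx : x ∈ X) : val (mkFun X t) x = t x := by
  obtain ⟨B, hB⟩ := exists_bound t X
  rw [(isFunc_mkFun hB).val_eq hx, app_mkFun hx]

theorem val_upd {s m x i : M} (hi : i ∈ (omega : M)) (h : i ≠ m) : val (upd s m x) i = val s i := by
  unfold upd
  rw [val_mkFun hi]
  exact if_neg h

theorem val_upd_self {s m x : M} (hm : m ∈ (omega : M)) : val (upd s m x) m = x := by
  unfold upd
  rw [val_mkFun hm]
  exact if_pos rfl

theorem IsFunc.ext_val {f g a b c : M} (hf : IsFunc f a b) (hg : IsFunc g a c)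
    (h : ∀ x, x ∈ a → val f x = val g x) : f = g :=
  hf.ext hg fun x hx => by rw [← hf.val_eq hx, ← hg.val_eq hx, h x hx]

theorem tr_ex (hA : Good A) {m φ : M} (hm : m ∈ (omega : M)) (hφ : IsFml φ)
    (hs : IsFunc s omega A) : Tr A (fEx m φ) s ↔ ∃ x, x ∈ A ∧ Tr A φ (upd s m x) := by
  rw [tr_ex' hA hm hφ hs]
  constructor
  · rintro ⟨t, ht, h⟩
    have htf := h.isFunc hA
    have hx : val t m ∈ A := htf.val_eq hm ▸ htf.app_mem hm
    refine ⟨val t m, hx, ?_⟩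
    have : upd s m (val t m) = t := (isFunc_upd hs hx).ext_val htf fun i hi => by
      by_cases him : i = m
      · rw [him, val_upd_self hm]
      · rw [val_upd hi him, ht i hi him]
    rwa [this]
  · rintro ⟨x, hx, h⟩
    exact ⟨_, fun i hi him => val_upd hi him, h⟩

theorem tr_bex (hA : Good A) {m n φ : M} (hm : m ∈ (omega : M)) (hn : n ∈ (omega : M))
    (hmn : m ≠ n) (hφ : IsFml φ) (hs : IsFunc s omega A) :
    Tr A (fEx m (fAnd (fMem m n) φ)) s ↔ ∃ x, x ∈ val s n ∧ Tr A φ (upd s m x) := by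
  rw [tr_ex hA hm ((isFml_fMem hm hn).fAnd hφ) hs]
  refine exists_congr fun x => ⟨fun ⟨hx, h⟩ => ?_, fun ⟨hx, h⟩ => ?_⟩
  · have hu := isFunc_upd hs (m := m) hx
    rw [tr_and hA (isFml_fMem hm hn) hφ hu, tr_mem hA hm hn hu, val_upd_self hm,
      val_upd hn hmn.symm] at h
    exact h
  · have hxA : x ∈ A := hA.trans hx (hs.val_eq hn ▸ hs.app_mem hn)
    have hu := isFunc_upd hs (m := m) hxA
    refine ⟨hxA, ?_⟩
    rw [tr_and hA (isFml_fMem hm hn) hφ hu, tr_mem hA hm hn hu, val_upd_self hm,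
      val_upd hn hmn.symm]
    exact ⟨hx, h⟩

theorem agreeOff_iff {m t B C : M} (hs : IsFunc s omega B) (ht : IsFunc t omega C) :
    AgreeOff m s t ↔ AgOff m s t :=
  forall_congr' fun i => forall_congr' fun hi => by rw [hs.val_eq hi, ht.val_eq hi]

theorem IsSatRel.iff_tr (hA : Good A) {S : M} (hS : IsSatRel A S) (φ : M) (hφ : IsFml φ) :
    ∀ s, IsFunc s omega A → (pr φ s ∈ S ↔ Tr A φ s) := by
  refine fml_induction hA (fun φ => ∀ s, IsFunc s omega A → (pr φ s ∈ S ↔ Tr A φ s))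
    (fun m n hm hn s hs => ?_) (fun m n hm hn s hs => ?_) (fun φ hφ ih s hs => ?_)
    (fun φ ψ hφ hψ ih ih' s hs => ?_) (fun m φ hm hφ ih s hs => ?_) φ hφ
  · rw [(hS s hs).1 m n hm hn, tr_mem hA hm hn hs, hs.val_eq hm, hs.val_eq hn]
  · rw [(hS s hs).2.1 m n hm hn, tr_eq hA hm hn hs, hs.val_eq hm, hs.val_eq hn]
  · rw [(hS s hs).2.2.1 φ hφ, tr_not hA hφ hs, ih s hs]
  · rw [(hS s hs).2.2.2.1 φ ψ hφ hψ, tr_and hA hφ hψ hs, ih s hs, ih' s hs]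
  · rw [(hS s hs).2.2.2.2 m φ hm hφ, tr_ex' hA hm hφ hs]
    refine exists_congr fun t => ⟨fun ⟨h1, h2, h3⟩ => ?_, fun ⟨h1, h2⟩ => ?_⟩
    · exact ⟨(agreeOff_iff hs h1).1 h2, (ih t h1).1 h3⟩
    · have ht := h2.isFunc hA
      exact ⟨ht, (agreeOff_iff hs ht).2 h1, (ih t ht).2 h2⟩

/-- The satisfaction relation of `(A, ∈)`. -/
noncomputable def satSet (A : M) : M :=
  theSet fun p => ∃ φ s, IsFml φ ∧ p = pr φ s ∧ Tr A φ s

theorem mem_satSet (hA : Good A) {p : M} :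
    p ∈ satSet A ↔ ∃ φ s, IsFml φ ∧ p = pr φ s ∧ Tr A φ s := by
  refine mem_theSet (a := power A) (fun p hp => ?_) p
  obtain ⟨φ, s, h1, rfl, h2⟩ := hp
  exact hA.power.pr (h1.mem_good hA.power)
    (mem_power.2 ((h2.isFunc hA).sub hA hA.omega_sub (Sub.refl A)))

theorem pr_mem_satSet (hA : Good A) {φ : M} (hφ : IsFml φ) : pr φ s ∈ satSet A ↔ Tr A φ s := by
  rw [mem_satSet hA]
  constructor
  · rintro ⟨φ', s', _, h, h'⟩
    rw [pr_eq] at h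
    rwa [h.1, h.2]
  · exact fun h => ⟨φ, s, hφ, rfl, h⟩

theorem isSatRel_satSet (hA : Good A) : IsSatRel A (satSet A) := by
  intro s hs
  refine ⟨fun m n hm hn => ?_, fun m n hm hn => ?_, fun φ hφ => ?_, fun φ ψ hφ hψ => ?_,
    fun m φ hm hφ => ?_⟩
  · rw [pr_mem_satSet hA (isFml_fMem hm hn), tr_mem hA hm hn hs, hs.val_eq hm, hs.val_eq hn]
  · rw [pr_mem_satSet hA (isFml_fEq hm hn), tr_eq hA hm hn hs, hs.val_eq hm, hs.val_eq hn]
  · rw [pr_mem_satSet hA hφ.fNot, pr_mem_satSet hA hφ, tr_not hA hφ hs]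
  · rw [pr_mem_satSet hA (hφ.fAnd hψ), pr_mem_satSet hA hφ, pr_mem_satSet hA hψ,
      tr_and hA hφ hψ hs]
  · rw [pr_mem_satSet hA (hφ.fEx hm), tr_ex' hA hm hφ hs]
    refine exists_congr fun t => ?_
    rw [pr_mem_satSet hA hφ]
    exact ⟨fun ⟨h1, h2⟩ => ⟨h2.isFunc hA, (agreeOff_iff hs (h2.isFunc hA)).2 h1, h2⟩,
      fun ⟨h1, h2, h3⟩ => ⟨(agreeOff_iff hs h1).1 h2, h3⟩⟩

/-- Any satisfaction relation agrees with the truth sets on formulas, and `satSet` shows that one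
exists. From here on, `Sat` can be replaced by the definable relation `Tr`. -/
theorem sat_iff_tr (hA : Good A) {φ : M} (hφ : IsFml φ) (hs : IsFunc s omega A) :
    Sat A φ s ↔ Tr A φ s :=
  ⟨fun ⟨_, hS, h⟩ => (hS.iff_tr hA φ hφ s hs).1 h,
    fun h => ⟨_, isSatRel_satSet hA, (pr_mem_satSet hA hφ).2 h⟩⟩

end
end

end ZFM



/-! ### Bounded formulas: absoluteness and transfer along Σ₀-elementary maps. -/

namespace ZFM

/-! ### Bounded predicates -/

/-- `P` is defined by a `Σ₀` formula of `M`, with the same meaning in all closed sets. -/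
class D0 (M : Type u) [ZFModel M] {E : Type u} [Env M E] (P : E → Prop) : Prop where
  out : ∃ φ : M, IsSigma0 φ ∧ ∀ A, Good A → ∀ e : E, (∀ i, Env.eqv (M := M) e i ∈ A) →
    ∀ s, IsFunc s omega A → (∀ i, val s (num i.val) = Env.eqv (M := M) e i) → (Tr A φ s ↔ P e)

section
variable {M E F : Type u} [ZFModel M] [Env M E]

theorem D0.congr {P Q : E → Prop} (h : D0 M P) (hPQ : ∀ e, P e ↔ Q e) : D0 M Q := by
  have : P = Q := funext fun e => propext (hPQ e)
  exact this ▸ h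

instance D0.mem {x y : E → M} [hx : Proj M x] [hy : Proj M y] : D0 M (fun e => x e ∈ y e) := by
  obtain ⟨i, hi⟩ := hx.var
  obtain ⟨j, hj⟩ := hy.var
  refine ⟨_, isSigma0_fMem (num_mem_omega i) (num_mem_omega j), fun A hA e he s hs h => ?_⟩
  rw [tr_mem hA (num_mem_omega i) (num_mem_omega j) hs, h, h, hi, hj]

instance D0.eq {x y : E → M} [hx : Proj M x] [hy : Proj M y] : D0 M (fun e => x e = y e) := by
  obtain ⟨i, hi⟩ := hx.var
  obtain ⟨j, hj⟩ := hy.var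
  refine ⟨_, isSigma0_fEq (num_mem_omega i) (num_mem_omega j), fun A hA e he s hs h => ?_⟩
  rw [tr_eq hA (num_mem_omega i) (num_mem_omega j) hs, h, h, hi, hj]

instance D0.not {P : E → Prop} [hP : D0 M P] : D0 M (fun e => ¬ P e) := by
  obtain ⟨φ, hφ, h⟩ := hP.out
  refine ⟨_, hφ.fNot, fun A hA e he s hs h' => ?_⟩
  rw [tr_not hA (hφ.isFml hA) hs, h A hA e he s hs h']

instance D0.and {P Q : E → Prop} [hP : D0 M P] [hQ : D0 M Q] : D0 M (fun e => P e ∧ Q e) := by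
  obtain ⟨φ, hφ, h⟩ := hP.out
  obtain ⟨ψ, hψ, h2⟩ := hQ.out
  refine ⟨_, hφ.fAnd hψ, fun A hA e he s hs h' => ?_⟩
  rw [tr_and hA (hφ.isFml hA) (hψ.isFml hA) hs, h A hA e he s hs h', h2 A hA e he s hs h']

instance D0.or {P Q : E → Prop} [D0 M P] [D0 M Q] : D0 M (fun e => P e ∨ Q e) :=
  D0.congr (P := fun e => ¬ (¬ P e ∧ ¬ Q e)) inferInstance fun _ => by tauto

instance D0.imp {P Q : E → Prop} [D0 M P] [D0 M Q] : D0 M (fun e => P e → Q e) :=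
  D0.congr (P := fun e => ¬ (P e ∧ ¬ Q e)) inferInstance fun _ => by tauto

instance D0.iff {P Q : E → Prop} [D0 M P] [D0 M Q] : D0 M (fun e => P e ↔ Q e) :=
  D0.congr (P := fun e => (P e → Q e) ∧ (Q e → P e)) inferInstance fun _ => iff_def.symm

/-- Coordinate `i` is read from the variable `v_i`. The coordinate added in `E × M` has index
`Env.dim M E`, larger than all old ones, so it serves as the fresh bound variable. Transitivity of
`A` makes the bounded quantifier absolute. -/
instance D0.bex {P : E → M → Prop} {x : E → M} [hx : Proj M x]
    [hP : D0 M (fun e : E × M => P e.1 e.2)] : D0 M (fun e => ∃ y : M, y ∈ x e ∧ P e y) := by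
  obtain ⟨i, hi⟩ := hx.var
  obtain ⟨φ, hφ, h⟩ := hP.out
  have hne : (num (Env.dim M E) : M) ≠ num i.val := fun h => i.isLt.ne' (num_inj h)
  refine ⟨_, IsSigma0.fBEx (num_mem_omega (Env.dim M E)) (num_mem_omega i.val) hne hφ,
    fun A hA e he s hs h' => ?_⟩
  rw [tr_bex hA (num_mem_omega _) (num_mem_omega _) hne (hφ.isFml hA) hs, h', ← hi]
  refine exists_congr fun y => and_congr_right fun hy => ?_
  have hyA : y ∈ A := hA.trans hy (hi e ▸ he i)
  refine h A hA (e, y) (fun k => ?_) _ (isFunc_upd hs hyA) fun k => ?_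
  · induction k using Fin.lastCases with
    | last => rw [eqv_prod_last]; exact hyA
    | cast k => rw [eqv_prod_castSucc]; exact he k
  · induction k using Fin.lastCases with
    | last => rw [eqv_prod_last]; exact val_upd_self (num_mem_omega _)
    | cast k =>
      rw [eqv_prod_castSucc, ← h' k]
      exact val_upd (num_mem_omega _) fun h => k.isLt.ne (num_inj h)

instance D0.ball {P : E → M → Prop} {x : E → M} [hx : Proj M x]
    [hP : D0 M (fun e : E × M => P e.1 e.2)] : D0 M (fun e => ∀ y : M, y ∈ x e → P e y) :=
  D0.congr (P := fun e => ¬ ∃ y, y ∈ x e ∧ ¬ P e y) inferInstance fun e => by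
    push Not; rfl

/-! ### Bounded definitions of the basic notions. -/

section notions

attribute [local instance 50] Proj.comp_inst

variable {x y z : E → M} [Proj M x] [Proj M y] [Proj M z]

instance d0_Sub : D0 M (fun e => Sub (x e) (y e)) := by
  unfold Sub
  infer_instance

instance d0_empty : D0 M (fun e => x e = empty) :=
  D0.congr (P := fun e => ∀ y, y ∈ x e → y ≠ y) inferInstance fun _ =>
    ⟨fun h => eq_empty_of fun y hy => h y hy rfl, fun h y hy => (not_mem_empty y (h ▸ hy)).elim⟩

instance d0_succ : D0 M (fun e => x e = succ (y e)) :=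
  D0.congr (P := fun e => y e ∈ x e ∧ (∀ w, w ∈ y e → w ∈ x e) ∧
    ∀ w, w ∈ x e → w ∈ y e ∨ w = y e) inferInstance fun e => by
    constructor
    · rintro ⟨h1, h2, h3⟩
      refine ext fun w => ⟨fun h => mem_succ.2 (h3 w h), fun h => ?_⟩
      rcases mem_succ.1 h with h | rfl
      exacts [h2 w h, h1]
    · intro h
      rw [h]
      exact ⟨self_mem_succ _, fun w hw => mem_succ.2 (Or.inl hw), fun w => mem_succ.1⟩

instance d0_IsTrans : D0 M (fun e => IsTrans (x e)) := by
  unfold IsTrans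
  infer_instance

instance d0_IsOrd : D0 M (fun e => IsOrd (x e)) :=
  D0.congr (P := fun e => IsTrans (x e) ∧ ∀ y, y ∈ x e → ∀ z, z ∈ x e → y ∈ z ∨ y = z ∨ z ∈ y)
    inferInstance fun _ => and_congr_right fun _ =>
      ⟨fun h y z hy hz => h y hy z hz, fun h y hy z hz => h y z hy hz⟩

instance d0_IsNat : D0 M (fun e => IsNat (x e)) :=
  D0.congr (P := fun e => IsOrd (x e) ∧ (x e = empty ∨ ∃ k, k ∈ x e ∧ x e = succ k) ∧
    ∀ m, m ∈ x e → m = empty ∨ ∃ k, k ∈ m ∧ m = succ k) inferInstance fun e => by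
    refine and_congr_right fun _ => ?_
    have : ∀ m : M, (m = empty ∨ ∃ k, k ∈ m ∧ m = succ k) ↔ (m = empty ∨ ∃ k, m = succ k) :=
      fun m => or_congr_right ⟨fun ⟨k, _, h⟩ => ⟨k, h⟩, fun ⟨k, h⟩ => ⟨k, h ▸ self_mem_succ k, h⟩⟩
    simp only [this, mem_succ]
    exact ⟨fun h m hm => hm.elim (h.2 m) fun h' => h' ▸ h.1,
      fun h => ⟨h _ (Or.inr rfl), fun m hm => h m (Or.inl hm)⟩⟩

/-- Going through `IsNat` avoids ω as a parameter, since ω need not be an element of a closed set.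
-/
instance d0_mem_omega : D0 M (fun e => x e ∈ (omega : M)) :=
  D0.congr (P := fun e => IsNat (x e)) inferInstance fun _ => mem_omega.symm

instance d0_omega : D0 M (fun e => x e = omega) :=
  D0.congr (P := fun e => (∀ n, n ∈ x e → n ∈ (omega : M)) ∧ (∃ n, n ∈ x e ∧ n = empty) ∧
    ∀ n, n ∈ x e → ∃ m, m ∈ x e ∧ m = succ n) inferInstance fun e => by
    constructor
    · rintro ⟨h1, ⟨n, hn, rfl⟩, h3⟩
      refine ext fun n => ⟨h1 n, fun hn' => ?_⟩
      exact omega_induction (fun n => n ∈ x e) hn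
        (fun n _ h => by obtain ⟨m, hm, rfl⟩ := h3 n h; exact hm) n hn'
    · intro h
      rw [h]
      exact ⟨fun _ => id, ⟨_, empty_mem_omega, rfl⟩, fun n hn => ⟨_, succ_mem_omega hn, rfl⟩⟩

instance d0_shift : D0 M (fun e => x e = shift (y e)) :=
  D0.congr (P := fun e => (y e ∈ (omega : M) ∧ x e = succ (y e)) ∨
    (¬ y e ∈ (omega : M) ∧ x e = y e)) inferInstance fun e => by
    unfold shift
    by_cases h : y e ∈ (omega : M) <;> simp [h]

instance d0_code0 : D0 M (fun e => x e = code0 (y e)) :=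
  D0.congr (P := fun e => (∀ z, z ∈ x e → ∃ t, t ∈ y e ∧ z = shift t) ∧
    ∀ t, t ∈ y e → ∃ z, z ∈ x e ∧ z = shift t) inferInstance fun e => by
    constructor
    · rintro ⟨h1, h2⟩
      refine ext fun z => ⟨fun h => mem_code0.2 (h1 z h), fun h => ?_⟩
      obtain ⟨t, ht, rfl⟩ := mem_code0.1 h
      obtain ⟨z, hz, rfl⟩ := h2 t ht
      exact hz
    · intro h
      rw [h]
      exact ⟨fun z => mem_code0.1, fun t ht => ⟨_, mem_code0.2 ⟨t, ht, rfl⟩, rfl⟩⟩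

instance d0_code1 : D0 M (fun e => x e = code1 (y e)) :=
  D0.congr (P := fun e => (∀ z, z ∈ x e → (∃ t, t ∈ y e ∧ z = shift t) ∨ z = empty) ∧
    (∃ z, z ∈ x e ∧ z = empty) ∧
    ∀ t, t ∈ y e → ∃ z, z ∈ x e ∧ z = shift t) inferInstance fun e => by
    constructor
    · rintro ⟨h1, ⟨z, h3, rfl⟩, h2⟩
      refine ext fun z => ⟨fun h => mem_code1.2 (h1 z h), fun h => ?_⟩
      rcases mem_code1.1 h with ⟨t, ht, rfl⟩ | rfl
      · obtain ⟨z, hz, rfl⟩ := h2 t ht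
        exact hz
      · exact h3
    · intro h
      rw [h]
      exact ⟨fun z => mem_code1.1, ⟨_, mem_code1.2 (Or.inr rfl), rfl⟩,
        fun t ht => ⟨_, mem_code1.2 (Or.inl ⟨t, ht, rfl⟩), rfl⟩⟩

instance d0_pr : D0 M (fun e => x e = pr (y e) (z e)) :=
  D0.congr (P := fun e =>
    (∀ w, w ∈ x e → (∃ t, t ∈ y e ∧ w = code0 t) ∨ ∃ t, t ∈ z e ∧ w = code1 t) ∧
    (∀ t, t ∈ y e → ∃ w, w ∈ x e ∧ w = code0 t) ∧
    ∀ t, t ∈ z e → ∃ w, w ∈ x e ∧ w = code1 t) inferInstance fun e => by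
    constructor
    · rintro ⟨h1, h2, h3⟩
      refine ext fun w => ⟨fun h => mem_pr.2 (h1 w h), fun h => ?_⟩
      rcases mem_pr.1 h with ⟨t, ht, rfl⟩ | ⟨t, ht, rfl⟩
      · obtain ⟨w, hw, rfl⟩ := h2 t ht
        exact hw
      · obtain ⟨w, hw, rfl⟩ := h3 t ht
        exact hw
    · intro h
      rw [h]
      exact ⟨fun w => mem_pr.1, fun t ht => ⟨_, mem_pr.2 (Or.inl ⟨t, ht, rfl⟩), rfl⟩,
        fun t ht => ⟨_, mem_pr.2 (Or.inr ⟨t, ht, rfl⟩), rfl⟩⟩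

instance d0_pr_mem : D0 M (fun e => pr (x e) (y e) ∈ z e) :=
  D0.congr (P := fun e => ∃ p, p ∈ z e ∧ p = pr (x e) (y e)) inferInstance fun e => by simp

end notions
end

/-! ### Elementarity for bounded predicates -/

/-- Coordinatewise relations between environments. -/
def EnvRel {M E : Type u} [Env M E] (R : M → M → Prop) (e e' : E) : Prop :=
  ∀ i, R (Env.eqv (M := M) e i) (Env.eqv (M := M) e' i)

theorem envRel_nil {M : Type u} (R : M → M → Prop) (e e' : PUnit.{u + 1}) : EnvRel R e e' :=
  fun i => (i : Fin 0).elim0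

theorem EnvRel.prod {M E : Type u} [Env M E] {R : M → M → Prop} {e e' : E} {x x' : M}
    (h : EnvRel R e e') (hx : R x x') : EnvRel R (e, x) (e', x') := fun i => by
  induction i using Fin.lastCases with
  | last => rw [eqv_prod_last, eqv_prod_last]; exact hx
  | cast i => rw [eqv_prod_castSucc, eqv_prod_castSucc]; exact h i

section
variable {M : Type u} [ZFModel M] {A j : M}

theorem exists_assignment (hA : Good A) (a : ℕ → M) (ha : ∀ i, a i ∈ A) :
    ∀ n : ℕ, ∃ s, IsFunc s omega A ∧ ∀ i, i < n → val s (num i) = a i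
  | 0 => ⟨_, isFunc_mkFun (X := omega) (t := fun _ => empty) fun _ _ => hA.empty,
      fun i hi => (Nat.not_lt_zero i hi).elim⟩
  | n + 1 => by
    obtain ⟨s, hs, h⟩ := exists_assignment hA a ha n
    refine ⟨_, isFunc_upd hs (m := num n) (ha n), fun i hi => ?_⟩
    by_cases hin : i = n
    · rw [hin, val_upd_self (num_mem_omega n)]
    · rw [val_upd (num_mem_omega i) fun h => hin (num_inj h), h i (by omega)]

theorem exists_env_assignment {E : Type u} [Env M E] (hA : Good A) (e : E)
    (he : ∀ i, Env.eqv (M := M) e i ∈ A) :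
    ∃ s, IsFunc s omega A ∧ ∀ i, val s (num i.val) = Env.eqv (M := M) e i := by
  classical
  obtain ⟨s, hs, h⟩ := exists_assignment hA
    (fun i => if hi : i < Env.dim M E then Env.eqv (M := M) e ⟨i, hi⟩ else empty)
    (fun i => by
      split_ifs
      exacts [he _, hA.empty]) (Env.dim M E)
  exact ⟨s, hs, fun i => by rw [h i i.isLt, dif_pos i.isLt]⟩

/-- `j ∘ s` for an assignment `s`. -/
noncomputable def compAsg (j s : M) : M := mkFun omega fun i => val j (val s i)

instance df_compAsg {E : Type u} [Env M E] {a b : E → M} [ha : DfT M a] [hb : DfT M b] :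
    DfT M (fun e => compAsg (a e) (b e)) :=
  DfT.comp2 (by unfold compAsg; infer_instance) ha hb

theorem isFunc_compAsg {B s : M} (hj : IsFunc j A B) (hs : IsFunc s omega A) :
    IsFunc (compAsg j s) omega B := isFunc_mkFun fun i hi => by
  have : val s i ∈ A := hs.val_eq hi ▸ hs.app_mem hi
  exact hj.val_eq this ▸ hj.app_mem this

theorem val_compAsg {s i : M} (hi : i ∈ (omega : M)) : val (compAsg j s) i = val j (val s i) :=
  val_mkFun hi

theorem IsFunc.val_mem {f a b x : M} (h : IsFunc f a b) (hx : x ∈ a) : val f x ∈ b :=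
  h.val_eq hx ▸ h.app_mem hx

theorem isElemFor_iff {Γ : M → Prop} (hA : Good A) (hΓ : ∀ φ, Γ φ → IsFml φ) :
    IsElemFor Γ A j ↔ IsFunc j A A ∧ ∀ φ, Γ φ → ∀ s, IsFunc s omega A →
      (Tr A φ s ↔ Tr A φ (compAsg j s)) := by
  refine and_congr_right fun hj => forall_congr' fun φ => forall_congr' fun hφ => ?_
  constructor
  · intro h s hs
    have ht := isFunc_compAsg hj hs
    rw [← sat_iff_tr hA (hΓ φ hφ) hs, ← sat_iff_tr hA (hΓ φ hφ) ht]
    refine h s _ hs ht fun i hi => ?_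
    rw [← ht.val_eq hi, val_compAsg hi, hs.val_eq hi, hj.val_eq (hs.app_mem hi)]
  · intro h s t hs ht hst
    rw [sat_iff_tr hA (hΓ φ hφ) hs, sat_iff_tr hA (hΓ φ hφ) ht, h s hs]
    have : compAsg j s = t := (isFunc_compAsg hj hs).ext_val ht fun i hi => by
      rw [val_compAsg hi, ht.val_eq hi, hst i hi, hs.val_eq hi, hj.val_eq (hs.app_mem hi)]
    rw [this]

/-- `j : A → A` is `Σ₀`-elementary, and `A` is closed. -/
structure Elem0 (A j : M) : Prop where
  good : Good A
  func : IsFunc j A A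
  tr : ∀ φ, IsSigma0 φ → ∀ s, IsFunc s omega A → (Tr A φ s ↔ Tr A φ (compAsg j s))

theorem elem0_iff (hA : Good A) : Elem0 A j ↔ IsElemFor IsSigma0 A j := by
  rw [isElemFor_iff hA fun φ h => h.isFml hA]
  exact ⟨fun h => ⟨h.func, h.tr⟩, fun h => ⟨hA, h.1, h.2⟩⟩

theorem Elem0.mem (hj : Elem0 A j) {x : M} (hx : x ∈ A) : val j x ∈ A := hj.func.val_mem hx

/-- The transfer principle behind all later uses of elementarity: a finite environment is turned
into an internal assignment, and the formula given by `D0` has its intended meaning at both ends. -/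
theorem Elem0.elem (hj : Elem0 A j) {E : Type u} [Env M E] (P : E → Prop) [hP : D0 M P]
    {e e' : E} (h : EnvRel (fun x y => x ∈ A ∧ y = val j x) e e') : P e ↔ P e' := by
  obtain ⟨φ, hφ, hP⟩ := hP.out
  obtain ⟨s, hs, hse⟩ := exists_env_assignment hj.good e fun i => (h i).1
  rw [← hP A hj.good e (fun i => (h i).1) s hs hse, hj.tr φ hφ s hs]
  refine hP A hj.good e' (fun i => (h i).2 ▸ hj.mem (h i).1) _ (isFunc_compAsg hj.func hs)
    fun i => ?_
  rw [val_compAsg (num_mem_omega _), hse i, (h i).2]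

theorem Elem0.elem1 (hj : Elem0 A j) (P : M → Prop) [D0 M fun e : PUnit.{u + 1} × M => P e.2]
    {a : M} (ha : a ∈ A) : P a ↔ P (val j a) :=
  hj.elem (fun e : PUnit.{u + 1} × M => P e.2) (e := (PUnit.unit, a)) (e' := (PUnit.unit, val j a))
    ((envRel_nil _ _ _).prod ⟨ha, rfl⟩)

theorem Elem0.elem2 (hj : Elem0 A j) (P : M → M → Prop)
    [D0 M fun e : (PUnit.{u + 1} × M) × M => P e.1.2 e.2]
    {a b : M} (ha : a ∈ A) (hb : b ∈ A) : P a b ↔ P (val j a) (val j b) :=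
  hj.elem (fun e : (PUnit.{u + 1} × M) × M => P e.1.2 e.2)
    (((envRel_nil _ PUnit.unit PUnit.unit).prod ⟨ha, rfl⟩).prod ⟨hb, rfl⟩)

theorem Elem0.elem3 (hj : Elem0 A j) (P : M → M → M → Prop)
    [D0 M fun e : ((PUnit.{u + 1} × M) × M) × M => P e.1.1.2 e.1.2 e.2]
    {a b c : M} (ha : a ∈ A) (hb : b ∈ A) (hc : c ∈ A) :
    P a b c ↔ P (val j a) (val j b) (val j c) :=
  hj.elem (fun e : ((PUnit.{u + 1} × M) × M) × M => P e.1.1.2 e.1.2 e.2)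
    ((((envRel_nil _ PUnit.unit PUnit.unit).prod ⟨ha, rfl⟩).prod ⟨hb, rfl⟩).prod ⟨hc, rfl⟩)

theorem Elem0.elem4 (hj : Elem0 A j) (P : M → M → M → M → Prop)
    [D0 M fun e : (((PUnit.{u + 1} × M) × M) × M) × M => P e.1.1.1.2 e.1.1.2 e.1.2 e.2]
    {a b c d : M} (ha : a ∈ A) (hb : b ∈ A) (hc : c ∈ A) (hd : d ∈ A) :
    P a b c d ↔ P (val j a) (val j b) (val j c) (val j d) :=
  hj.elem (fun e : (((PUnit.{u + 1} × M) × M) × M) × M => P e.1.1.1.2 e.1.1.2 e.1.2 e.2)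
    (((((envRel_nil _ PUnit.unit PUnit.unit).prod ⟨ha, rfl⟩).prod ⟨hb, rfl⟩).prod
      ⟨hc, rfl⟩).prod ⟨hd, rfl⟩)

theorem Elem0.elem5 (hj : Elem0 A j) (P : M → M → M → M → M → Prop)
    [D0 M fun e : ((((PUnit.{u + 1} × M) × M) × M) × M) × M =>
      P e.1.1.1.1.2 e.1.1.1.2 e.1.1.2 e.1.2 e.2]
    {a b c d f : M} (ha : a ∈ A) (hb : b ∈ A) (hc : c ∈ A) (hd : d ∈ A) (hf : f ∈ A) :
    P a b c d f ↔ P (val j a) (val j b) (val j c) (val j d) (val j f) :=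
  hj.elem (fun e : ((((PUnit.{u + 1} × M) × M) × M) × M) × M =>
      P e.1.1.1.1.2 e.1.1.1.2 e.1.1.2 e.1.2 e.2)
    ((((((envRel_nil _ PUnit.unit PUnit.unit).prod ⟨ha, rfl⟩).prod ⟨hb, rfl⟩).prod
      ⟨hc, rfl⟩).prod ⟨hd, rfl⟩).prod ⟨hf, rfl⟩)

theorem Elem0.elem6 (hj : Elem0 A j) (P : M → M → M → M → M → M → Prop)
    [D0 M fun e : (((((PUnit.{u + 1} × M) × M) × M) × M) × M) × M =>
      P e.1.1.1.1.1.2 e.1.1.1.1.2 e.1.1.1.2 e.1.1.2 e.1.2 e.2]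
    {a b c d f g : M} (ha : a ∈ A) (hb : b ∈ A) (hc : c ∈ A) (hd : d ∈ A) (hf : f ∈ A)
    (hg : g ∈ A) :
    P a b c d f g ↔ P (val j a) (val j b) (val j c) (val j d) (val j f) (val j g) :=
  hj.elem (fun e : (((((PUnit.{u + 1} × M) × M) × M) × M) × M) × M =>
      P e.1.1.1.1.1.2 e.1.1.1.1.2 e.1.1.1.2 e.1.1.2 e.1.2 e.2)
    (((((((envRel_nil _ PUnit.unit PUnit.unit).prod ⟨ha, rfl⟩).prod ⟨hb, rfl⟩).prod
      ⟨hc, rfl⟩).prod ⟨hd, rfl⟩).prod ⟨hf, rfl⟩).prod ⟨hg, rfl⟩)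

theorem Elem0.mem_iff (hj : Elem0 A j) {x y : M} (hx : x ∈ A) (hy : y ∈ A) :
    x ∈ y ↔ val j x ∈ val j y := hj.elem2 (fun x y => x ∈ y) hx hy

theorem Elem0.sub_iff (hj : Elem0 A j) {x y : M} (hx : x ∈ A) (hy : y ∈ A) :
    Sub x y ↔ Sub (val j x) (val j y) := hj.elem2 Sub hx hy

theorem Elem0.map_pr (hj : Elem0 A j) {x y : M} (hx : x ∈ A) (hy : y ∈ A) :
    val j (pr x y) = pr (val j x) (val j y) :=
  (hj.elem3 (fun p x y => p = pr x y) (hj.good.pr hx hy) hx hy).1 rfl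

theorem Elem0.map_nat (hj : Elem0 A j) {n : M} (hn : n ∈ (omega : M)) : val j n = n := by
  refine omega_induction (fun n => val j n = n)
    ((hj.elem1 (fun x => x = empty) hj.good.empty).1 rfl) (fun n hn ih => ?_) n hn
  have := (hj.elem2 (fun x y => x = succ y) (hj.good.nat (succ_mem_omega hn)) (hj.good.nat hn)).1
    rfl
  rw [this, ih]

theorem Elem0.map_omega (hj : Elem0 A j) (hω : omega ∈ A) : val j omega = omega :=
  (hj.elem1 (fun x => x = omega) hω).1 rfl

end

end ZFM



/-! ### Representation of the subsets of V_{η+1} as sections at the seed. -/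

namespace ZFM

section
variable {M : Type u} [ZFModel M]

/-! ### Sections of relations -/

/-- The section `{t ∈ u : (d, t) ∈ g}` of `g` at `d`. -/
noncomputable def row (u g d : M) : M := theSet fun t => t ∈ u ∧ pr d t ∈ g

section
variable {E : Type u} [Env M E] {a b c : E → M}

instance df_row [ha : DfT M a] [hb : DfT M b] [hc : DfT M c] :
    DfT M (fun e => row (a e) (b e) (c e)) :=
  DfT.comp3 (by unfold row; infer_instance) ha hb hc

theorem mem_row {u g d t : M} : t ∈ row u g d ↔ t ∈ u ∧ pr d t ∈ g := mem_sep t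

theorem row_sub (u g d : M) : Sub (row u g d) u := fun _ h => (mem_row.1 h).1

attribute [local instance 50] Proj.comp_inst

instance d0_row {x : E → M} [Proj M x] [Proj M a] [Proj M b] [Proj M c] :
    D0 M (fun e => x e = row (a e) (b e) (c e)) :=
  D0.congr (P := fun e => (∀ t, t ∈ x e → t ∈ a e) ∧ ∀ t, t ∈ a e →
    (t ∈ x e ↔ pr (c e) t ∈ b e)) inferInstance fun e => by
    constructor
    · rintro ⟨h1, h2⟩
      exact ext fun t => by
        rw [mem_row]
        exact ⟨fun h => ⟨h1 t h, (h2 t (h1 t h)).1 h⟩, fun h => (h2 t h.1).2 h.2⟩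
    · intro h
      rw [h]
      exact ⟨row_sub _ _ _, fun t ht => by rw [mem_row]; simp [ht]⟩

end

/-! ### Levels that are fixed by `j` -/

/-- `v` is closed, and `j` fixes its power set. -/
def Fixed (A j v : M) : Prop := Good v ∧ power v ∈ A ∧ val j (power v) = power v

/-- Every subset of the power set of `v` is the section of `j(f)` at `j ↾ v`, for some subset `f`
of the power set of `v`. -/
def Represents (j v : M) : Prop :=
  ∀ w, Sub w (power v) → ∃ f, Sub f (power v) ∧ ∀ y, y ∈ w ↔ pr (restrict j v) y ∈ val j f

variable {A j v : M}

namespace Fixed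

theorem mem (hv : Fixed A j v) (hj : Elem0 A j) : v ∈ A :=
  hj.good.trans (self_mem_power v) hv.2.1

theorem sub (hv : Fixed A j v) (hj : Elem0 A j) : Sub v A := hj.good.sub_of_mem (hv.mem hj)

theorem power_sub (hv : Fixed A j v) (hj : Elem0 A j) : Sub (power v) A :=
  hj.good.sub_of_mem hv.2.1

theorem map_sub (hv : Fixed A j v) (hj : Elem0 A j) {x : M} (hx : Sub x (power v)) :
    Sub (val j x) (power v) := by
  have := (hj.sub_iff (hj.good.sub hx hv.2.1) hv.2.1).1 hx
  rwa [hv.2.2] at this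

theorem map_mem_power (hv : Fixed A j v) (hj : Elem0 A j) {x : M} (hx : x ∈ power v) :
    val j x ∈ power v := by
  have := (hj.mem_iff (hv.power_sub hj x hx) hv.2.1).1 hx
  rwa [hv.2.2] at this

/-- `v` is the largest element of its power set, a bounded description from a parameter that `j`
fixes. -/
theorem map (hv : Fixed A j v) (hj : Elem0 A j) : val j v = v := by
  have h := (hj.elem2 (fun p v => v ∈ p ∧ ∀ x, x ∈ p → Sub x v) hv.2.1 (hv.mem hj)).1
    ⟨self_mem_power v, fun x => mem_power.1⟩
  rw [hv.2.2] at h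
  exact Sub.antisymm (mem_power.1 h.1) (h.2 v (self_mem_power v))

theorem map_mem (hv : Fixed A j v) (hj : Elem0 A j) {x : M} (hx : x ∈ v) : val j x ∈ v := by
  have := (hj.mem_iff (hv.sub hj x hx) (hv.mem hj)).1 hx
  rwa [hv.map hj] at this

/-- `power v` is the largest element of `power (power v)`, which `j` fixes. -/
theorem of_power_power (hj : Elem0 A j) (hv : Good v) (h : Fixed A j (power (power v))) :
    Fixed A j v := by
  have h1 := h.map hj
  have h2 : power v ∈ A := hj.good.trans (self_mem_power _) (h.mem hj)
  refine ⟨hv, h2, ?_⟩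
  have h3 := (hj.elem2 (fun p v => v ∈ p ∧ ∀ x, x ∈ p → Sub x v) (h.mem hj) h2).1
    ⟨self_mem_power _, fun x => mem_power.1⟩
  rw [h1] at h3
  exact Sub.antisymm (mem_power.1 h3.1) (h3.2 _ (self_mem_power _))

theorem mem_restrict (hv : Fixed A j v) (hj : Elem0 A j) {p : M} :
    p ∈ restrict j v ↔ ∃ x, x ∈ v ∧ p = pr x (val j x) := by
  unfold restrict
  rw [mem_sep]
  constructor
  · rintro ⟨hp, x, y, hx, rfl⟩
    exact ⟨x, hx, by rw [hj.func.val_eq (hv.sub hj x hx), hj.func.app_eq hp]⟩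
  · rintro ⟨x, hx, rfl⟩
    exact ⟨hj.func.pr_mem_iff.2 ⟨hv.sub hj x hx, hj.func.val_eq (hv.sub hj x hx)⟩, x, _, hx, rfl⟩

theorem pr_mem_restrict (hv : Fixed A j v) (hj : Elem0 A j) {x y : M} :
    pr x y ∈ restrict j v ↔ x ∈ v ∧ y = val j x := by
  rw [hv.mem_restrict hj]
  constructor
  · rintro ⟨x', hx', h⟩
    rw [pr_eq] at h
    rw [h.1, h.2]
    exact ⟨hx', rfl⟩
  · rintro ⟨hx, rfl⟩
    exact ⟨x, hx, rfl⟩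

theorem restrict_mem (hv : Fixed A j v) (hj : Elem0 A j) : restrict j v ∈ power v :=
  mem_power.2 fun p hp => by
    obtain ⟨x, hx, rfl⟩ := (hv.mem_restrict hj).1 hp
    exact hv.1.pr hx (hv.map_mem hj hx)

theorem isFunc_restrict (hv : Fixed A j v) (hj : Elem0 A j) : IsFunc (restrict j v) v v :=
  ⟨fun p hp => by
    obtain ⟨x, hx, rfl⟩ := (hv.mem_restrict hj).1 hp
    exact ⟨x, _, hx, hv.map_mem hj hx, rfl⟩,
  fun x hx => ⟨val j x, (hv.pr_mem_restrict hj).2 ⟨hx, rfl⟩,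
    fun _ hy => ((hv.pr_mem_restrict hj).1 hy).2⟩⟩

/-- If `j` restricted to the power set of `v` is uniformly defined from `j ↾ v` by a bounded
predicate with fixed parameters, then every subset of the power set is represented. -/
theorem represents_of (hj : Elem0 A j) (hv : Fixed A j v) (Φ : M → M → M → M → M → M → Prop)
    (hD : ∀ {E : Type u} [Env M E] (a b c d f g : E → M) [DfT M a] [DfT M b] [DfT M c] [DfT M d]
      [DfT M f] [DfT M g], Df M fun e => Φ (a e) (b e) (c e) (d e) (f e) (g e))
    (h0 : ∀ {E : Type u} [Env M E] (a b c d f g : E → M) [Proj M a] [Proj M b] [Proj M c]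
      [Proj M d] [Proj M f] [Proj M g], D0 M fun e => Φ (a e) (b e) (c e) (d e) (f e) (g e))
    {q₁ q₂ q₃ : M} (hq₁ : q₁ ∈ A) (hq₂ : q₂ ∈ A) (hq₃ : q₃ ∈ A) (h₁ : val j q₁ = q₁)
    (h₂ : val j q₂ = q₂) (h₃ : val j q₃ = q₃)
    (hΦ : ∀ y z, y ∈ power v → z ∈ power v → (Φ (restrict j v) y z q₁ q₂ q₃ ↔ z = val j y)) :
    Represents j v := by
  intro w hw
  have hpw := hv.1.power
  have hwA : w ∈ A := hj.good.sub hw hv.2.1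
  have hDf : Df₁ M fun p => ∃ k y z, k ∈ power v ∧ y ∈ power v ∧ z ∈ w ∧ p = pr k y ∧
    Φ k y z q₁ q₂ q₃ := inferInstance
  -- In `f` the role of `j ↾ v` is played by a variable `k`. In `j(f)` this variable may take the
  -- value `j ↾ v`, where `Φ` defines `j`; so `y` is in that section iff `j(y) ∈ j(w)`, that is, iff
  -- `y ∈ w`.
  let f := theSet fun p => p ∈ power v ∧ ∃ k y z, k ∈ power v ∧ y ∈ power v ∧ z ∈ w ∧ p = pr k y ∧
    Φ k y z q₁ q₂ q₃
  have hf : ∀ p, p ∈ f ↔ p ∈ power v ∧ ∃ k y z, k ∈ power v ∧ y ∈ power v ∧ z ∈ w ∧ p = pr k y ∧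
    Φ k y z q₁ q₂ q₃ := fun p => mem_sep p
  have hfs : Sub f (power v) := fun p hp => ((hf p).1 hp).1
  have hfA : f ∈ A := hj.good.sub hfs hv.2.1
  refine ⟨f, hfs, ?_⟩
  have key := (hj.elem6 (fun f w u a b c =>
    (∀ p, p ∈ f → ∃ k, k ∈ u ∧ ∃ y, y ∈ u ∧ ∃ z, z ∈ w ∧ (p = pr k y ∧ Φ k y z a b c)) ∧
    ∀ k, k ∈ u → ∀ y, y ∈ u → ∀ z, z ∈ w → Φ k y z a b c → pr k y ∈ f)
    hfA hwA hv.2.1 hq₁ hq₂ hq₃).1 ⟨fun p hp => by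
      obtain ⟨_, k, y, z, hk, hy, hz, h⟩ := (hf p).1 hp
      exact ⟨k, hk, y, hy, z, hz, h⟩, fun k hk y hy z hz h =>
      (hf _).2 ⟨hpw.pr hk hy, k, y, z, hk, hy, hz, rfl, h⟩⟩
  rw [hv.2.2, h₁, h₂, h₃] at key
  have hc := hv.restrict_mem hj
  intro y
  constructor
  · intro hy
    have hyP := hw y hy
    exact key.2 _ hc y hyP (val j y) ((hj.mem_iff (hv.power_sub hj y hyP) hwA).1 hy)
      ((hΦ y _ hyP (hv.map_mem_power hj hyP)).2 rfl)
  · intro hy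
    obtain ⟨k, hk, y', hy', z, hz, h, hk'⟩ := key.1 _ hy
    rw [pr_eq] at h
    rw [← h.1, ← h.2] at hk'
    rw [← h.2] at hy'
    have hzP := hv.map_sub hj hw z hz
    rw [(hΦ y z hy' hzP).1 hk'] at hz
    exact (hj.mem_iff (hv.power_sub hj y hy') hwA).2 hz

end Fixed

/-! ### Limit levels -/

attribute [local instance 50] Proj.comp_inst DfT.comp_inst

/-- `z = ⋃ {k(b) : b ∈ v, b ⊆ y}`. -/
def LimExt (k y z v _ _ : M) : Prop :=
  ∀ w, w ∈ v → (w ∈ z ↔ ∃ b, b ∈ v ∧ (Sub b y ∧ ∃ e, e ∈ v ∧ (pr b e ∈ k ∧ w ∈ e)))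

/-- An element `x` of `t` is a subset of an earlier level `t'` all of whose subsets lie in `t`. By
elementarity every subset of `j(t')` in `v` lies in `j(t)`, and `x ⊆ t' ⊆ j(t')` by induction. -/
theorem LimLevel.sub_map {W : M} (h : LimLevel v W) (hj : Elem0 A j) (hv : Fixed A j v) :
    ∀ t, t ∈ W → Sub t (val j t) := by
  have hW : ∀ t, t ∈ W → t ∈ v := fun t ht => by
    obtain ⟨t', ht', h'⟩ := h.up t ht
    exact (h.mem_iff t).2 ⟨t', ht', h' t (Sub.refl t)⟩
  refine mem_induction (fun t => Sub t (val j t)) W fun t ht ih x hx => ?_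
  obtain ⟨t', ht', htt, hxt, hP⟩ := h.down t x ht hx
  have key := (hj.elem3 (fun t' t v => ∀ u, u ∈ v → Sub u t' → u ∈ t)
    (hv.sub hj t' (hW t' ht')) (hv.sub hj t (hW t ht)) (hv.mem hj)).1 fun u _ hu => hP u hu
  rw [hv.map hj] at key
  exact key x (hv.1.trans hx (hW t ht)) (hxt.trans (ih t' htt ht'))

/-- At a limit, `j` is continuous along the bounded pieces of `y ⊆ v`, so its values at subsets of
`v` are determined by `j ↾ v`. -/
theorem LimLevel.represents {W : M} (h : LimLevel v W) (hj : Elem0 A j) (hv : Fixed A j v) :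
    Represents j v := by
  refine hv.represents_of hj LimExt (fun a b c d f g => ?_) (fun a b c d f g => ?_)
    (hv.mem hj) (hv.mem hj) (hv.mem hj) (hv.map hj) (hv.map hj) (hv.map hj) fun y z hy hz => ?_
  · intros
    unfold LimExt
    infer_instance
  · intros
    unfold LimExt
    infer_instance
  · have hzv := mem_power.1 hz
    have hyv := mem_power.1 hy
    have hjy := mem_power.1 (hv.map_mem_power hj hy)
    have key : ∀ w, w ∈ v → (w ∈ val j y ↔
        ∃ b, b ∈ v ∧ (Sub b y ∧ ∃ e, e ∈ v ∧ (pr b e ∈ restrict j v ∧ w ∈ e))) := by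
      intro w hw
      constructor
      · intro hwy
        obtain ⟨t, ht, hwt⟩ := (h.mem_iff w).1 hw
        obtain ⟨t', ht', hP⟩ := h.up t ht
        -- The piece is `b = y ∩ t`. Then `j(b)` contains all common elements of `j(t)` and `j(y)`,
        -- in particular `w`, because `t ⊆ j(t)`.
        obtain ⟨b, hb⟩ := separation (fun x => x ∈ y) t
        have hbt : Sub b t := fun x hx => ((hb x).1 hx).1
        have hbv : b ∈ v := (h.mem_iff b).2 ⟨t', ht', hP b hbt⟩
        have htv : t ∈ v := (h.mem_iff t).2 ⟨t', ht', hP t (Sub.refl t)⟩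
        have := (hj.elem3 (fun b t y => ∀ x, x ∈ t → x ∈ y → x ∈ b) (hv.sub hj b hbv)
          (hv.sub hj t htv) (hv.power_sub hj y hy)).1 fun x hx hxy => (hb x).2 ⟨hx, hxy⟩
        exact ⟨b, hbv, fun x hx => ((hb x).1 hx).2, val j b, hv.map_mem hj hbv,
          (hv.pr_mem_restrict hj).2 ⟨hbv, rfl⟩, this w (h.sub_map hj hv t ht w hwt) hwy⟩
      · rintro ⟨b, hb, hby, e, -, he, hw⟩
        obtain ⟨-, rfl⟩ := (hv.pr_mem_restrict hj).1 he
        exact (hj.sub_iff (hv.sub hj b hb) (hv.power_sub hj y hy)).1 hby w hw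
    constructor
    · intro hΦ
      exact ext fun w => ⟨fun hw => (key w (hzv w hw)).2 ((hΦ w (hzv w hw)).1 hw),
        fun hw => (hΦ w (hjy w hw)).2 ((key w (hjy w hw)).1 hw)⟩
    · rintro rfl w hw
      exact key w hw

/-! ### Two levels up -/

/-- `d` is the restriction of `k` to `v`, as a function from `v` to `v`. -/
def IsRes (d k v : M) : Prop :=
  (∀ p, p ∈ d → p ∈ k ∧ ∃ x, x ∈ v ∧ ∃ x', x' ∈ v ∧ p = pr x x') ∧
    ∀ x, x ∈ v → ∀ x', x' ∈ v → pr x x' ∈ k → pr x x' ∈ d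

/-- `σ` is the set of all `x ∈ u` such that the section of `f` at `x` belongs to `y`. -/
def IsSec (σ u f y : M) : Prop :=
  (∀ x, x ∈ σ → x ∈ u) ∧ ∀ x, x ∈ u → (x ∈ σ ↔ ∃ r, r ∈ y ∧ r = row u f x)

/-- `z` is the set of all `k(f)_d` such that `d = k ↾ v` belongs to `k({x : f_x ∈ y})`. -/
def SuccExt (k y z v u₁ u₂ : M) : Prop :=
  ∀ w, w ∈ u₂ → (w ∈ z ↔ ∃ f, f ∈ u₂ ∧ ∃ σ, σ ∈ u₂ ∧ ∃ d, d ∈ u₁ ∧ ∃ τ, τ ∈ u₂ ∧ ∃ g, g ∈ u₂ ∧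
    (IsSec σ u₁ f y ∧ IsRes d k v ∧ pr σ τ ∈ k ∧ d ∈ τ ∧ pr f g ∈ k ∧ w = row u₁ g d))

section
variable {E : Type u} [Env M E] {a b c d : E → M}

instance df_IsRes [ha : DfT M a] [hb : DfT M b] [hc : DfT M c] :
    Df M (fun e => IsRes (a e) (b e) (c e)) :=
  Df.comp3 (by unfold IsRes; infer_instance) ha hb hc

instance df_IsSec [ha : DfT M a] [hb : DfT M b] [hc : DfT M c] [hd : DfT M d] :
    Df M (fun e => IsSec (a e) (b e) (c e) (d e)) := by
  unfold IsSec
  infer_instance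

instance d0_IsRes [Proj M a] [Proj M b] [Proj M c] : D0 M (fun e => IsRes (a e) (b e) (c e)) := by
  unfold IsRes
  infer_instance

instance d0_IsSec [Proj M a] [Proj M b] [Proj M c] [Proj M d] :
    D0 M (fun e => IsSec (a e) (b e) (c e) (d e)) := by
  unfold IsSec
  infer_instance

end

/-- The hypothesis presents every `w ⊆ power v` as the section of some `j(f)` at `c = j ↾ v`. Hence
`w ∈ j(y)` iff `c ∈ j(σ)` with `σ = {x : f_x ∈ y}`. As `c`, `j(f)` and `j(σ)` can all be read off
from `j ↾ power (power v)`, the bounded predicate `SuccExt` defines `j` one level further up. -/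
theorem Represents.power_power (hj : Elem0 A j) (hv : Good v) (h : Represents j v)
    (hv' : Fixed A j (power (power v))) : Represents j (power (power v)) := by
  have hv₀ : Fixed A j v := .of_power_power hj hv hv'
  have hu₂A := hv'.mem hj
  refine hv'.represents_of hj SuccExt (fun a b c d f g => ?_) (fun a b c d f g => ?_)
    (hv₀.mem hj) hv₀.2.1 hu₂A (hv₀.map hj) hv₀.2.2 (hv'.map hj) fun y z hy hz => ?_
  · intros
    unfold SuccExt
    infer_instance
  · intros
    unfold SuccExt
    infer_instance
  · have hzv := mem_power.1 hz
    have hjy := mem_power.1 (hv'.map_mem_power hj hy)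
    have hyA := hv'.power_sub hj y hy
    have hc := hv₀.restrict_mem hj
    have hsub : ∀ x, x ∈ power (power v) → x ∈ A := hv'.sub hj
    have sec : ∀ f σ, f ∈ power (power v) → σ ∈ power (power v) → IsSec σ (power v) f y →
        (restrict j v ∈ val j σ ↔ ∃ r, r ∈ val j y ∧ r = row (power v) (val j f) (restrict j v)) := by
      intro f σ hf hσ hs
      have := (hj.elem4 IsSec (hsub σ hσ) hv₀.2.1 (hsub f hf) hyA).1 hs
      rw [hv₀.2.2] at this
      exact this.2 _ hc
    have res : IsRes (restrict j v) (restrict j (power (power v))) v := by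
      have hvv : ∀ x, x ∈ v → x ∈ power (power v) := fun x hx =>
        hv.power.mem_power_of_mem (hv.mem_power_of_mem hx)
      constructor
      · intro p hp
        obtain ⟨x, hx, rfl⟩ := (hv₀.mem_restrict hj).1 hp
        exact ⟨(hv'.mem_restrict hj).2 ⟨x, hvv x hx, rfl⟩, x, hx, _, hv₀.map_mem hj hx, rfl⟩
      · intro x hx x' hx' h
        exact (hv₀.pr_mem_restrict hj).2 ⟨hx, ((hv'.pr_mem_restrict hj).1 h).2⟩
    have res_unique : ∀ d, IsRes d (restrict j (power (power v))) v → d = restrict j v := by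
      intro d hd
      refine ext fun p => ⟨fun hp => ?_, fun hp => ?_⟩
      · obtain ⟨h1, x, hx, x', hx', rfl⟩ := hd.1 p hp
        exact res.2 x hx x' hx' h1
      · obtain ⟨h1, x, hx, x', hx', rfl⟩ := res.1 p hp
        exact hd.2 x hx x' hx' h1
    have key : ∀ w, w ∈ power (power v) → (w ∈ val j y ↔ ∃ f, f ∈ power (power v) ∧
        ∃ σ, σ ∈ power (power v) ∧ ∃ d, d ∈ power v ∧ ∃ τ, τ ∈ power (power v) ∧
        ∃ g, g ∈ power (power v) ∧ (IsSec σ (power v) f y ∧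
          IsRes d (restrict j (power (power v))) v ∧ pr σ τ ∈ restrict j (power (power v)) ∧ d ∈ τ ∧
          pr f g ∈ restrict j (power (power v)) ∧ w = row (power v) g d)) := by
      intro w hw
      constructor
      · intro hwy
        obtain ⟨f, hf, hfw⟩ := h w (mem_power.1 hw)
        obtain ⟨σ, hσ⟩ := separation (fun x => ∃ r, r ∈ y ∧ r = row (power v) f x) (power v)
        have hσs : Sub σ (power v) := fun x hx => ((hσ x).1 hx).1
        have hs : IsSec σ (power v) f y := ⟨hσs, fun x hx => by rw [hσ]; simp [hx]⟩
        have hwr : w = row (power v) (val j f) (restrict j v) := ext fun t => by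
          rw [mem_row, hfw t]
          exact ⟨fun ht => ⟨mem_power.1 hw t ((hfw t).2 ht), ht⟩, fun ht => ht.2⟩
        exact ⟨f, mem_power.2 hf, σ, mem_power.2 hσs, restrict j v, hc, val j σ,
          mem_power.2 (hv₀.map_sub hj hσs), val j f, mem_power.2 (hv₀.map_sub hj hf), hs, res,
          (hv'.pr_mem_restrict hj).2 ⟨mem_power.2 hσs, rfl⟩,
          (sec f σ (mem_power.2 hf) (mem_power.2 hσs) hs).2 ⟨w, hwy, hwr⟩,
          (hv'.pr_mem_restrict hj).2 ⟨mem_power.2 hf, rfl⟩, hwr⟩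
      · rintro ⟨f, hf, σ, hσ, d, hd, τ, hτ, g, hg, hs, hr, hστ, hdτ, hfg, rfl⟩
        obtain rfl := res_unique d hr
        obtain ⟨-, rfl⟩ := (hv'.pr_mem_restrict hj).1 hστ
        obtain ⟨-, rfl⟩ := (hv'.pr_mem_restrict hj).1 hfg
        obtain ⟨r, hr, rfl⟩ := (sec f σ hf hσ hs).1 hdτ
        exact hr
    constructor
    · intro hΦ
      exact ext fun w => ⟨fun hw => (key w (hzv w hw)).2 ((hΦ w (hzv w hw)).1 hw),
        fun hw => (hΦ w (hjy w hw)).2 ((key w (hjy w hw)).1 hw)⟩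
    · rintro rfl w hw
      exact key w hw

/-- At infinite even levels that are fixed by `j`, all sets of the next two levels are
represented. -/
theorem represents_even (hj : Elem0 A j) {η : M} (hη : IsInfEven η) (hl : IsVLevel η v)
    (hv : Fixed A j v) : Represents j v := by
  -- Being fixed by `j` stays a hypothesis inside the induction predicate: it passes downwards by
  -- two levels, while representation passes upwards.
  have hQ : Df₁ M fun v => Good v ∧ (Fixed A j v → Represents j v) := by
    unfold Fixed Represents
    infer_instance
  refine (even_level_induction (fun v => Good v ∧ (Fixed A j v → Represents j v)) hη hl
    (fun v W h => ⟨h.good, h.represents hj⟩) fun v ⟨hg, ih⟩ => ⟨hg.power.power, fun hf => ?_⟩).2 hv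
  exact (ih (.of_power_power hj hg hf)).power_power hj hg hf

end

end ZFM



/-! ### The derived ultrafilter and the collapse of Ult(V_{η+2}, μ). -/

namespace ZFM

section
variable {M : Type u} [ZFModel M]

/-! ### The derived ultrafilter -/

/-- `j : V_{η+2} → V_{η+2}` is `Σ₀`-elementary and fixes `V_{η+1}`, where `v = V_η`, and all
elements of `V_{η+2}` are represented by functions. -/
structure Setting (v j : M) : Prop where
  good : Good v
  elem : Elem0 (power (power v)) j
  fix : val j (power v) = power v
  rep : Represents j v

/-- The ultrafilter derived from `j` with seed `j ↾ v`. -/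
noncomputable def uf (v j : M) : M := derivedUF (power v) j (restrict j v)

/-- `P` holds almost everywhere on the power set of `v`. -/
def Ae (v j : M) (P : M → Prop) : Prop := (theSet fun k => k ∈ power v ∧ P k) ∈ uf v j

variable {v j : M}

instance df_Ae {E : Type u} [Env M E] {P : E → M → Prop}
    [h : Df M (fun e : E × M => P e.1 e.2)] : Df M (fun e => Ae v j (P e)) := by
  have h1 : Df M (fun e : (E × M) × M => P e.1.1 e.2) :=
    Df.comp (p := fun e : (E × M) × M => (e.1.1, e.2)) h inferInstance
  unfold Ae
  infer_instance

namespace Setting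
variable (S : Setting v j)
include S

theorem fixed : Fixed (power (power v)) j v := ⟨S.good, self_mem_power _, S.fix⟩

theorem seed_mem : restrict j v ∈ power v := S.fixed.restrict_mem S.elem

theorem map_sub {x : M} (hx : Sub x (power v)) : Sub (val j x) (power v) :=
  S.fixed.map_sub S.elem hx

theorem mem_uf {σ : M} : σ ∈ uf v j ↔ Sub σ (power v) ∧ restrict j v ∈ val j σ := by
  have h : uf v j = theSet fun σ => Sub σ (power v) ∧ restrict j v ∈ val j σ :=
    theSet_congr fun σ => and_congr_right fun hσ => by
      rw [S.elem.func.val_eq (mem_power.2 hσ)]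
  rw [h]
  exact mem_theSet (a := power (power v)) (fun σ h => mem_power.2 h.1) σ

theorem ae_iff {P : M → Prop} [Df₁ M P] :
    Ae v j P ↔ restrict j v ∈ val j (theSet fun k => k ∈ power v ∧ P k) := by
  unfold Ae
  rw [S.mem_uf]
  exact and_iff_right fun k hk => ((mem_sep k).1 hk).1

/-- The set σ of all `k` with the bounded property is itself described by a bounded formula, so
`j(σ)` is defined by the same property with `j` applied to the parameters; membership in μ asks
whether the seed has it. -/
theorem ae_elem (Q : M → M → M → M → Prop)
    [D0 M fun e : ((((PUnit.{u + 1} × M) × M) × M) × M) × M => Q e.2 e.1.1.1.2 e.1.1.2 e.1.2]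
    {a b : M} [Df₁ M fun k => Q k a b (power v)] (ha : Sub a (power v)) (hb : Sub b (power v)) :
    Ae v j (fun k => Q k a b (power v)) ↔ Q (restrict j v) (val j a) (val j b) (power v) := by
  rw [S.ae_iff]
  have hs := fun k => mem_sep (P := fun k => Q k a b (power v)) (a := power v) k
  have := (S.elem.elem4 (fun σ a b u => (∀ k, k ∈ σ → k ∈ u ∧ Q k a b u) ∧
    ∀ k, k ∈ u → Q k a b u → k ∈ σ) (mem_power.2 fun k hk => ((hs k).1 hk).1) (mem_power.2 ha)
    (mem_power.2 hb) (self_mem_power _)).1 ⟨fun k hk => (hs k).1 hk, fun k h h' => (hs k).2 ⟨h, h'⟩⟩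
  rw [S.fix] at this
  exact ⟨fun h => (this.1 _ h).2, fun h => this.2 _ S.seed_mem h⟩

theorem ae_of_forall {P : M → Prop} [Df₁ M P] (h : ∀ k, k ∈ power v → P k) : Ae v j P := by
  rw [S.ae_iff]
  have : (theSet fun k => k ∈ power v ∧ P k) = power v :=
    theSet_eq fun k => ⟨fun hk => ⟨hk, h k hk⟩, fun h => h.1⟩
  rw [this, S.fix]
  exact S.seed_mem

theorem ae_mono {P Q : M → Prop} [Df₁ M P] [Df₁ M Q] (h : ∀ k, k ∈ power v → P k → Q k)
    (hP : Ae v j P) : Ae v j Q := by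
  rw [S.ae_iff] at hP ⊢
  exact (S.elem.sub_iff (mem_power.2 fun k hk => ((mem_sep k).1 hk).1)
    (mem_power.2 fun k hk => ((mem_sep k).1 hk).1)).1
    (fun k hk => (mem_sep k).2 ⟨((mem_sep k).1 hk).1, h k ((mem_sep k).1 hk).1
      ((mem_sep k).1 hk).2⟩) _ hP

theorem ae_congr {P Q : M → Prop} [Df₁ M P] [Df₁ M Q] (h : ∀ k, k ∈ power v → (P k ↔ Q k)) :
    Ae v j P ↔ Ae v j Q :=
  ⟨S.ae_mono fun k hk => (h k hk).1, S.ae_mono fun k hk => (h k hk).2⟩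

theorem ae_and {P Q : M → Prop} [Df₁ M P] [Df₁ M Q] :
    Ae v j (fun k => P k ∧ Q k) ↔ Ae v j P ∧ Ae v j Q := by
  refine ⟨fun h => ⟨S.ae_mono (fun _ _ h => h.1) h, S.ae_mono (fun _ _ h => h.2) h⟩, ?_⟩
  simp only [S.ae_iff]
  have hs := fun (P : M → Prop) [Df₁ M P] k => mem_sep (P := P) (a := power v) k
  have hp := fun (P : M → Prop) [Df₁ M P] =>
    mem_power.2 (fun k (hk : k ∈ theSet fun k => k ∈ power v ∧ P k) => ((hs P k).1 hk).1)
  rintro ⟨h1, h2⟩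
  refine (S.elem.elem3 (fun x y z => ∀ k, k ∈ x → k ∈ y → k ∈ z) (hp P) (hp Q)
    (hp fun k => P k ∧ Q k)).1 (fun k h1 h2 => ?_) _ h1 h2
  exact (hs _ k).2 ⟨((hs _ k).1 h1).1, ((hs _ k).1 h1).2, ((hs _ k).1 h2).2⟩

theorem not_ae_of_forall {P : M → Prop} [Df₁ M P] (h : ∀ k, k ∈ power v → ¬ P k) :
    ¬ Ae v j P := by
  rw [S.ae_iff]
  have : (theSet fun k => k ∈ power v ∧ P k) = empty :=
    theSet_eq fun k => ⟨fun hk => (not_mem_empty k hk).elim, fun hk => (h k hk.1 hk.2).elim⟩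
  rw [this, S.elem.map_nat empty_mem_omega]
  exact not_mem_empty _

theorem ae_not {P : M → Prop} [Df₁ M P] : Ae v j (fun k => ¬ P k) ↔ ¬ Ae v j P := by
  constructor
  · intro h h'
    exact S.not_ae_of_forall (P := fun k => ¬ P k ∧ P k) (fun k _ h => h.1 h.2) (S.ae_and.2 ⟨h, h'⟩)
  · simp only [S.ae_iff]
    have hs := fun (P : M → Prop) [Df₁ M P] k => mem_sep (P := P) (a := power v) k
    have hp := fun (P : M → Prop) [Df₁ M P] =>
      mem_power.2 (fun k (hk : k ∈ theSet fun k => k ∈ power v ∧ P k) => ((hs P k).1 hk).1)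
    have := (S.elem.elem3 (fun x y z => ∀ k, k ∈ x → k ∉ y → k ∈ z) (self_mem_power _) (hp P)
      (hp fun k => ¬ P k)).1 fun k hk hk' => (hs _ k).2 ⟨hk, fun h => hk' ((hs _ k).2 ⟨hk, h⟩)⟩
    rw [S.fix] at this
    exact this _ S.seed_mem

theorem ae_exists {P : M → Prop} [Df₁ M P] (h : Ae v j P) : ∃ k, k ∈ power v ∧ P k := by
  by_contra! h'
  exact S.not_ae_of_forall h' h

end Setting

/-! ### Representing functions -/

/-- The relation `{(k, y) : y ∈ f(k)}`. -/
noncomputable def code (v f : M) : M :=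
  theSet fun p => p ∈ power v ∧ ∃ k y, k ∈ power v ∧ y ∈ val f k ∧ p = pr k y

/-- The set represented by `f : V_{η+1} → V_{η+2}`. -/
noncomputable def rho (v j f : M) : M := row (power v) (val j (code v f)) (restrict j v)

instance df_code {E : Type u} [Env M E] {a : E → M} [ha : DfT M a] :
    DfT M (fun e => code v (a e)) := DfT.comp1 (by unfold code; infer_instance) ha

instance df_rho {E : Type u} [Env M E] {a : E → M} [ha : DfT M a] :
    DfT M (fun e => rho v j (a e)) := DfT.comp1 (by unfold rho; infer_instance) ha

theorem code_sub (v f : M) : Sub (code v f) (power v) := fun p hp => ((mem_sep p).1 hp).1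

namespace Setting
variable (S : Setting v j)
include S

theorem row_code {f k : M} (hf : IsFunc f (power v) (power (power v))) (hk : k ∈ power v) :
    row (power v) (code v f) k = val f k := by
  have hv := mem_power.1 (hf.val_mem hk)
  refine ext fun t => ?_
  unfold code
  rw [mem_row, mem_sep]
  constructor
  · rintro ⟨_, _, k', y, _, hy, h⟩
    rw [pr_eq] at h
    rw [h.1, h.2]
    exact hy
  · exact fun ht => ⟨hv t ht, S.good.power.pr hk (hv t ht), k, t, hk, ht, rfl⟩

theorem rho_mem (f : M) : rho v j f ∈ power (power v) := mem_power.2 (row_sub _ _ _)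

/-- Once unfolded, equality of sections is a bounded property of `k`, so it can be evaluated at the
seed. The same applies to membership of sections below. -/
theorem ae_row_eq {a b : M} (ha : Sub a (power v)) (hb : Sub b (power v)) :
    Ae v j (fun k => row (power v) a k = row (power v) b k) ↔
      row (power v) (val j a) (restrict j v) = row (power v) (val j b) (restrict j v) := by
  have h : ∀ a b k : M, row (power v) a k = row (power v) b k ↔
      ∀ t, t ∈ power v → (pr k t ∈ a ↔ pr k t ∈ b) := fun a b k => by
    rw [ext_iff]
    simp only [mem_row]
    exact forall_congr' fun t => by tauto
  simp only [h]
  exact S.ae_elem (fun k a b u => ∀ t, t ∈ u → (pr k t ∈ a ↔ pr k t ∈ b)) ha hb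

theorem ae_row_mem {a b : M} (ha : Sub a (power v)) (hb : Sub b (power v)) :
    Ae v j (fun k => row (power v) a k ∈ row (power v) b k) ↔
      row (power v) (val j a) (restrict j v) ∈ row (power v) (val j b) (restrict j v) := by
  have h : ∀ a b k : M, row (power v) a k ∈ row (power v) b k ↔
      ∃ r, r ∈ power v ∧ (pr k r ∈ b ∧ r = row (power v) a k) := fun a b k =>
    ⟨fun h => ⟨_, (mem_row.1 h).1, (mem_row.1 h).2, rfl⟩, fun ⟨r, h1, h2, h3⟩ =>
      h3 ▸ mem_row.2 ⟨h1, h2⟩⟩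
  simp only [h]
  exact S.ae_elem (fun k a b u => ∃ r, r ∈ u ∧ (pr k r ∈ b ∧ r = row u a k)) ha hb

theorem rho_eq_iff {f g : M} (hf : IsFunc f (power v) (power (power v)))
    (hg : IsFunc g (power v) (power (power v))) :
    rho v j f = rho v j g ↔ Ae v j fun k => val f k = val g k := by
  unfold rho
  rw [← S.ae_row_eq (code_sub v f) (code_sub v g)]
  exact S.ae_congr fun k hk => by rw [S.row_code hf hk, S.row_code hg hk]

theorem rho_mem_iff {f g : M} (hf : IsFunc f (power v) (power (power v)))
    (hg : IsFunc g (power v) (power (power v))) :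
    rho v j f ∈ rho v j g ↔ Ae v j fun k => val f k ∈ val g k := by
  unfold rho
  rw [← S.ae_row_mem (code_sub v f) (code_sub v g)]
  exact S.ae_congr fun k hk => by rw [S.row_code hf hk, S.row_code hg hk]

theorem isFunc_row (F : M) : IsFunc (mkFun (power v) (row (power v) F)) (power v)
    (power (power v)) := isFunc_mkFun fun k _ => mem_power.2 (row_sub _ _ _)

theorem rho_row {F : M} (hF : Sub F (power v)) :
    rho v j (mkFun (power v) (row (power v) F)) = row (power v) (val j F) (restrict j v) := by
  unfold rho
  rw [← S.ae_row_eq (code_sub _ _) hF]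
  exact S.ae_of_forall fun k hk => by rw [S.row_code (S.isFunc_row F) hk, val_mkFun hk]

/-- This is representation: if `w` is the section of `j(F)` at the seed, the function `k ↦ F_k`
represents `w`. -/
theorem rho_surj {w : M} (hw : Sub w (power v)) :
    ∃ f, IsFunc f (power v) (power (power v)) ∧ rho v j f = w := by
  obtain ⟨F, hF, h⟩ := S.rep w hw
  refine ⟨_, S.isFunc_row F, ?_⟩
  rw [S.rho_row hF]
  exact ext fun t => by
    rw [mem_row, ← h t]
    exact ⟨fun h => h.2, fun h => ⟨hw t h, h⟩⟩

theorem isFunc_const {X B b : M} (hb : b ∈ B) : IsFunc (mkFun X fun _ => b) X B :=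
  isFunc_mkFun fun _ _ => hb

/-- Every section of the code of a constant function is its value; `j` transfers this to the seed.
-/
theorem rho_const {x : M} (hx : Sub x (power v)) :
    rho v j (mkFun (power v) fun _ => x) = val j x := by
  have hf := S.isFunc_const (X := power v) (mem_power.2 hx)
  have key := (S.elem.elem3 (fun F x u => ∀ k, k ∈ u → ∀ t, t ∈ u → (pr k t ∈ F ↔ t ∈ x))
    (mem_power.2 (code_sub v (mkFun (power v) fun _ => x))) (mem_power.2 hx) (self_mem_power _)).1
    fun k hk t ht => by
      have h := S.row_code hf hk
      rw [val_mkFun hk] at h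
      rw [ext_iff] at h
      rw [← h t, mem_row]
      simp [ht]
  rw [S.fix] at key
  unfold rho
  refine ext fun t => ?_
  rw [mem_row]
  constructor
  · rintro ⟨h1, h2⟩
    exact (key _ S.seed_mem t h1).1 h2
  · intro h
    have := S.map_sub hx t h
    exact ⟨this, (key _ S.seed_mem t this).2 h⟩

end Setting

/-! ### Ultrapowers -/

/-- A definable version of `ultClass`. -/
noncomputable def uc (v j A f : M) : M :=
  theSet fun g => IsFunc g (power v) A ∧ Ae v j fun k => val f k = val g k

instance df_uc {E : Type u} [Env M E] {A : M} {a : E → M} [ha : DfT M a] :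
    DfT M (fun e => uc v j A (a e)) := DfT.comp1 (by unfold uc; infer_instance) ha

theorem ultClass_eq {A f : M} (hf : IsFunc f (power v) A) :
    ultClass (power v) A (uf v j) f = uc v j A f := by
  refine theSet_congr fun g => and_congr_right fun hg => ?_
  have : (theSet fun k => k ∈ power v ∧ app f k = app g k) =
      theSet fun k => k ∈ power v ∧ val f k = val g k :=
    theSet_congr fun k => and_congr_right fun hk => by rw [hf.val_eq hk, hg.val_eq hk]
  rw [this]
  rfl

theorem ae_app_mem_iff {A f g : M} (hf : IsFunc f (power v) A) (hg : IsFunc g (power v) A) :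
    (theSet fun k => k ∈ power v ∧ app f k ∈ app g k) ∈ uf v j ↔
      Ae v j fun k => val f k ∈ val g k := by
  have : (theSet fun k => k ∈ power v ∧ app f k ∈ app g k) =
      theSet fun k => k ∈ power v ∧ val f k ∈ val g k :=
    theSet_congr fun k => and_congr_right fun hk => by rw [hf.val_eq hk, hg.val_eq hk]
  rw [this]
  rfl

section
variable {A : M} (S : Setting v j) (hA : Good A) (hVA : Sub (power v) A)
include S hA hVA

theorem mem_uc {f g : M} :
    g ∈ uc v j A f ↔ IsFunc g (power v) A ∧ Ae v j fun k => val f k = val g k :=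
  mem_theSet (a := power A) (fun g h => mem_power.2 (h.1.sub hA hVA (Sub.refl A))) g

theorem uc_eq_iff {f g : M} (hf : IsFunc f (power v) A) (hg : IsFunc g (power v) A) :
    uc v j A f = uc v j A g ↔ Ae v j fun k => val f k = val g k := by
  constructor
  · intro h
    have : g ∈ uc v j A g := (mem_uc S hA hVA).2 ⟨hg, S.ae_of_forall fun _ _ => rfl⟩
    rw [← h] at this
    exact ((mem_uc S hA hVA).1 this).2
  · intro h
    refine ext fun w => ?_
    rw [mem_uc S hA hVA, mem_uc S hA hVA]
    refine and_congr_right fun _ => ⟨fun h' => ?_, fun h' => ?_⟩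
    · exact S.ae_mono (fun k _ h => h.1.symm.trans h.2) (S.ae_and.2 ⟨h, h'⟩)
    · exact S.ae_mono (fun k _ h => h.1.trans h.2) (S.ae_and.2 ⟨h, h'⟩)

theorem mem_ult {c : M} :
    c ∈ ult (power v) A (uf v j) ↔ ∃ f, IsFunc f (power v) A ∧ c = uc v j A f := by
  have h : ult (power v) A (uf v j) = theSet fun c => ∃ f, IsFunc f (power v) A ∧ c = uc v j A f :=
    theSet_congr fun c => exists_congr fun f => and_congr_right fun hf => by rw [ultClass_eq hf]
  rw [h]
  refine mem_theSet (a := power (power A)) (fun c hc => ?_) c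
  obtain ⟨f, hf, rfl⟩ := hc
  refine mem_power.2 fun g hg => mem_power.2 ?_
  exact ((mem_uc S hA hVA).1 hg).1.sub hA hVA (Sub.refl A)

theorem ultMem_iff {f g : M} (hf : IsFunc f (power v) A) (hg : IsFunc g (power v) A) :
    ultMem (power v) A (uf v j) (uc v j A f) (uc v j A g) ↔ Ae v j fun k => val f k ∈ val g k := by
  constructor
  · rintro ⟨f', g', hf', hg', h1, h2, h3⟩
    rw [ultClass_eq hf', uc_eq_iff S hA hVA hf hf'] at h1
    rw [ultClass_eq hg', uc_eq_iff S hA hVA hg hg'] at h2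
    rw [ae_app_mem_iff hf' hg'] at h3
    refine S.ae_mono (fun k _ h => ?_) (S.ae_and.2 ⟨S.ae_and.2 ⟨h1, h2⟩, h3⟩)
    rw [h.1.1, h.1.2]
    exact h.2
  · exact fun h => ⟨f, g, hf, hg, (ultClass_eq hf).symm, (ultClass_eq hg).symm,
      (ae_app_mem_iff hf hg).2 h⟩

theorem ultMap_eq {b : M} (hb : b ∈ A) :
    ultMap (power v) A (uf v j) b = uc v j A (mkFun (power v) fun _ => b) :=
  ultClass_eq (S.isFunc_const hb)

/-- A definable map on functions that respects equality and membership almost everywhere induces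
an isomorphism of the ultrapower with its range. -/
theorem exists_collapse (π : M → M) [hπ : DfT₁ M π] {T : M} (hT : IsTrans T)
    (hmem : ∀ f, IsFunc f (power v) A → π f ∈ T)
    (hsurj : ∀ y, y ∈ T → ∃ f, IsFunc f (power v) A ∧ π f = y)
    (heq : ∀ f g, IsFunc f (power v) A → IsFunc g (power v) A →
      (π f = π g ↔ Ae v j fun k => val f k = val g k))
    (hin : ∀ f g, IsFunc f (power v) A → IsFunc g (power v) A →
      (π f ∈ π g ↔ Ae v j fun k => val f k ∈ val g k)) :
    ∃ C, IsCollapse (ult (power v) A (uf v j)) (ultMem (power v) A (uf v j)) T C ∧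
      ∀ f, IsFunc f (power v) A → app C (uc v j A f) = π f := by
  have hπ' : ∀ {E : Type u} [Env M E] {x : E → M} [DfT M x], DfT M (fun e => π (x e)) :=
    fun {E} _ {x} hx => DfT.comp1 hπ hx
  have hD : Df₂ M fun c y => ∃ f, IsFunc f (power v) A ∧ c = uc v j A f ∧ y = π f := inferInstance
  obtain ⟨C, hC, h⟩ := exists_function
    (fun c y => ∃ f, IsFunc f (power v) A ∧ c = uc v j A f ∧ y = π f)
    (ult (power v) A (uf v j)) T fun c hc => by
      obtain ⟨f, hf, rfl⟩ := (mem_ult S hA hVA).1 hc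
      refine ⟨π f, ⟨hmem f hf, f, hf, rfl, rfl⟩, ?_⟩
      rintro y ⟨-, g, hg, h, rfl⟩
      exact ((heq f g hf hg).2 ((uc_eq_iff S hA hVA hf hg).1 h)).symm
  have hval : ∀ f, IsFunc f (power v) A → app C (uc v j A f) = π f := fun f hf => by
    obtain ⟨g, hg, h1, h2⟩ := h _ ((mem_ult S hA hVA).2 ⟨f, hf, rfl⟩)
    rw [h2]
    exact ((heq f g hf hg).2 ((uc_eq_iff S hA hVA hf hg).1 h1)).symm
  refine ⟨C, ⟨hT, hC, fun y hy => ?_, fun x y hx hy hxy => ?_, fun x y hx hy => ?_⟩, hval⟩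
  · obtain ⟨f, hf, rfl⟩ := hsurj y hy
    exact ⟨_, (mem_ult S hA hVA).2 ⟨f, hf, rfl⟩, hval f hf⟩
  · obtain ⟨f, hf, rfl⟩ := (mem_ult S hA hVA).1 hx
    obtain ⟨g, hg, rfl⟩ := (mem_ult S hA hVA).1 hy
    rw [hval f hf, hval g hg, heq f g hf hg] at hxy
    exact (uc_eq_iff S hA hVA hf hg).2 hxy
  · obtain ⟨f, hf, rfl⟩ := (mem_ult S hA hVA).1 hx
    obtain ⟨g, hg, rfl⟩ := (mem_ult S hA hVA).1 hy
    rw [hval f hf, hval g hg, hin f g hf hg, ultMem_iff S hA hVA hf hg]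

end

theorem IsCollapse.isExtensional {A T C : M} {R : M → M → Prop} (h : IsCollapse A R T C) :
    IsExtensional A R := by
  obtain ⟨hT, hC, hsurj, hinj, hmem⟩ := h
  intro x y hx hy hxy
  have hne : app C x ≠ app C y := fun h => hxy (hinj x y hx hy h)
  rw [Ne, ext_iff] at hne
  push Not at hne
  obtain ⟨z, hz⟩ := hne
  have hzT : z ∈ T := by
    rcases hz with hz | hz
    · exact hT _ (hC.app_mem hx) z hz.1
    · exact hT _ (hC.app_mem hy) z hz.2
  obtain ⟨w, hw, rfl⟩ := hsurj z hzT
  refine ⟨w, hw, ?_⟩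
  rw [hmem w x hw hx, hmem w y hw hy]
  tauto

theorem IsCollapse.isWellFd {A T C : M} {R : M → M → Prop} (h : IsCollapse A R T C) :
    IsWellFd A R := by
  obtain ⟨hT, hC, hsurj, hinj, hmem⟩ := h
  rintro X hX ⟨x, hx⟩
  obtain ⟨B, hB⟩ := replacement (val C) X
  obtain ⟨y, hy, hy'⟩ := ZFModel.foundation B ⟨_, (hB _).2 ⟨x, hx, rfl⟩⟩
  obtain ⟨z, hz, rfl⟩ := (hB y).1 hy
  refine ⟨z, hz, fun w hw hwz => ?_⟩
  rw [hmem w z (hX w hw) (hX z hz), ← hC.val_eq (hX w hw), ← hC.val_eq (hX z hz)] at hwz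
  exact hy' _ ((hB _).2 ⟨w, hw, rfl⟩) hwz

/-- The transitive collapse of the ultrapower of `V_{η+2}` is `V_{η+2}`, and the ultrapower map
is `j`. -/
theorem Setting.exists_collapse₂ (S : Setting v j) :
    ∃ C, IsCollapse (ult (power v) (power (power v)) (uf v j))
      (ultMem (power v) (power (power v)) (uf v j)) (power (power v)) C ∧
      ∀ x, x ∈ power (power v) →
        app C (ultMap (power v) (power (power v)) (uf v j) x) = app j x := by
  have hA := S.good.power.power
  have hVA : Sub (power v) (power (power v)) := hA.sub_of_mem (self_mem_power _)
  obtain ⟨C, h, h'⟩ := exists_collapse S hA hVA (rho v j) (T := power (power v))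
    (fun y hy => hA.sub_of_mem hy) (fun f _ => S.rho_mem f)
    (fun y hy => S.rho_surj (mem_power.1 hy)) (fun f g hf hg => S.rho_eq_iff hf hg)
    (fun f g hf hg => S.rho_mem_iff hf hg)
  refine ⟨C, h, fun x hx => ?_⟩
  rw [ultMap_eq S hA hVA hx, h' _ (S.isFunc_const hx), S.rho_const (mem_power.1 hx),
    S.elem.func.val_eq hx]

end

end ZFM



/-! ### Almost every `k` is an elementary map of V_η. -/

namespace ZFM

section
variable {M : Type u} [ZFModel M] {v j : M}

/-! ### Bounded definitions of formulas and satisfaction -/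

theorem IsFunc.pr_mem_iff_val {f a b x y : M} (h : IsFunc f a b) :
    pr x y ∈ f ↔ x ∈ a ∧ y = val f x := by
  rw [h.pr_mem_iff]
  exact and_congr_right fun hx => by rw [h.val_eq hx]

/-- `x = (k, y)`, where `k` is a numeral. -/
def NumPr (k : ℕ) (b x y : M) : Prop := ∃ o, o ∈ b ∧ (o = num k ∧ x = pr o y)

/-- `x = (k, (y, z))`, where `k` is a numeral. -/
def NumPr₂ (k : ℕ) (b x y z : M) : Prop := ∃ q, q ∈ b ∧ (q = pr y z ∧ NumPr k b x q)

theorem Good.numPr {k : ℕ} {x y : M} (hv : Good v) : NumPr k v x y ↔ x = ZFM.pr (num k) y :=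
  ⟨fun ⟨_, _, h, h'⟩ => h ▸ h', fun h => ⟨_, hv.nat (num_mem_omega k), rfl, h⟩⟩

theorem Good.numPr₂ {k : ℕ} {x y z : M} (hv : Good v) (hy : y ∈ v) (hz : z ∈ v) :
    NumPr₂ k v x y z ↔ x = ZFM.pr (num k) (ZFM.pr y z) :=
  ⟨fun ⟨_, _, h, h'⟩ => h ▸ hv.numPr.1 h', fun h => ⟨_, hv.pr hy hz, rfl, hv.numPr.2 h⟩⟩

/-- `C` is closed under the construction of formulas, with quantifiers bounded by `b`. -/
def FmlClosed (b C : M) : Prop :=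
  (∀ m, m ∈ b → m ∈ (omega : M) → ∀ n, n ∈ b → n ∈ (omega : M) → ∀ x, x ∈ b →
    NumPr₂ 0 b x m n ∨ NumPr₂ 1 b x m n → x ∈ C) ∧
  (∀ y, y ∈ b → y ∈ C → ∀ x, x ∈ b → NumPr 2 b x y → x ∈ C) ∧
  (∀ y, y ∈ b → y ∈ C → ∀ z, z ∈ b → z ∈ C → ∀ x, x ∈ b → NumPr₂ 3 b x y z → x ∈ C) ∧
  (∀ m, m ∈ b → m ∈ (omega : M) → ∀ y, y ∈ b → y ∈ C → ∀ x, x ∈ b → NumPr₂ 4 b x m y → x ∈ C)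

/-- The set of all formulas in `b`. -/
noncomputable def fmls (b : M) : M := theSet fun φ => φ ∈ b ∧ IsFml φ

/-- A bounded definition of the set of formulas. -/
def IsFmls (b u C : M) : Prop :=
  FmlClosed b C ∧ ∀ D, D ∈ u → FmlClosed b D → Sub C D

/-- Tarski's clauses for `S` at the assignment `s`, with bounded quantifiers, where `N` is the set
of formulas and `W` is the set of assignments. -/
def Tarski (b N W S s : M) : Prop :=
  (∀ m, m ∈ b → m ∈ (omega : M) → ∀ n, n ∈ b → n ∈ (omega : M) → ∀ x, x ∈ N →
    NumPr₂ 0 b x m n →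
      (pr x s ∈ S ↔ ∃ y, y ∈ b ∧ (pr m y ∈ s ∧ ∃ z, z ∈ b ∧ (pr n z ∈ s ∧ y ∈ z)))) ∧
  (∀ m, m ∈ b → m ∈ (omega : M) → ∀ n, n ∈ b → n ∈ (omega : M) → ∀ x, x ∈ N →
    NumPr₂ 1 b x m n → (pr x s ∈ S ↔ ∃ y, y ∈ b ∧ (pr m y ∈ s ∧ pr n y ∈ s))) ∧
  (∀ y, y ∈ N → ∀ x, x ∈ N → NumPr 2 b x y → (pr x s ∈ S ↔ ¬ pr y s ∈ S)) ∧
  (∀ y, y ∈ N → ∀ z, z ∈ N → ∀ x, x ∈ N → NumPr₂ 3 b x y z →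
    (pr x s ∈ S ↔ pr y s ∈ S ∧ pr z s ∈ S)) ∧
  (∀ m, m ∈ b → m ∈ (omega : M) → ∀ y, y ∈ N → ∀ x, x ∈ N → NumPr₂ 4 b x m y →
    (pr x s ∈ S ↔ ∃ t, t ∈ W ∧ ((∀ i, i ∈ b → i ∈ (omega : M) → i ≠ m →
      ∃ a, a ∈ b ∧ (pr i a ∈ s ∧ pr i a ∈ t)) ∧ pr y t ∈ S)))

/-- A bounded definition of the satisfaction relation. -/
def IsSatSet (b N W S : M) : Prop :=
  (∀ p, p ∈ S → ∃ x, x ∈ N ∧ ∃ s, s ∈ W ∧ p = pr x s) ∧ ∀ s, s ∈ W → Tarski b N W S s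

/-- A bounded definition of elementary maps. -/
def IsElemMap (k b N W S : M) : Prop :=
  IsFunc k b b ∧ ∀ x, x ∈ N → ∀ s, s ∈ W → ∀ t, t ∈ W →
    (∀ i, i ∈ b → i ∈ (omega : M) → ∃ y, y ∈ b ∧ (pr i y ∈ s ∧ ∃ z, z ∈ b ∧
      (pr i z ∈ t ∧ pr y z ∈ k))) → (pr x s ∈ S ↔ pr x t ∈ S)

section
variable {E : Type u} [Env M E] {a b c d f : E → M}

attribute [local instance 50] Proj.comp_inst

theorem d0_num : ∀ (k : ℕ) {E : Type u} [Env M E] {a : E → M} [Proj M a],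
    D0 M (fun e => a e = num k)
  | 0, _, _, _, _ => d0_empty
  | k + 1, _, _, a, _ => by
    have ih := @d0_num k
    exact D0.congr (P := fun e => ∃ y, y ∈ a e ∧ (y = num k ∧ a e = succ y)) inferInstance
      fun e => ⟨fun ⟨y, _, h, h'⟩ => h'.trans (h ▸ rfl),
        fun h => ⟨_, h ▸ self_mem_succ _, rfl, h⟩⟩

attribute [local instance 50] d0_num

section
variable [Proj M a] [Proj M b] [Proj M c] [Proj M d] [Proj M f]

instance d0_NumPr {k : ℕ} : D0 M (fun e => NumPr k (a e) (b e) (c e)) := by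
  unfold NumPr
  infer_instance

instance d0_NumPr₂ {k : ℕ} : D0 M (fun e => NumPr₂ k (a e) (b e) (c e) (d e)) := by
  unfold NumPr₂
  infer_instance

instance d0_FmlClosed : D0 M (fun e => FmlClosed (a e) (b e)) := by
  unfold FmlClosed
  infer_instance

instance d0_IsFmls : D0 M (fun e => IsFmls (a e) (b e) (c e)) := by
  unfold IsFmls
  infer_instance

instance d0_Tarski : D0 M (fun e => Tarski (a e) (b e) (c e) (d e) (f e)) := by
  unfold Tarski
  infer_instance

instance d0_IsSatSet : D0 M (fun e => IsSatSet (a e) (b e) (c e) (d e)) := by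
  unfold IsSatSet
  infer_instance

instance d0_IsFunc : D0 M (fun e => IsFunc (a e) (b e) (c e)) :=
  D0.congr (P := fun e => (∀ p, p ∈ a e → ∃ x, x ∈ b e ∧ ∃ y, y ∈ c e ∧ p = pr x y) ∧
    ∀ x, x ∈ b e → ∃ y, y ∈ c e ∧ (pr x y ∈ a e ∧ ∀ z, z ∈ c e → pr x z ∈ a e → z = y))
    inferInstance fun e => by
    constructor
    · rintro ⟨h1, h2⟩
      refine ⟨fun p hp => ?_, fun x hx => ?_⟩
      · obtain ⟨x, hx, y, hy, h⟩ := h1 p hp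
        exact ⟨x, y, hx, hy, h⟩
      · obtain ⟨y, hy, h, h'⟩ := h2 x hx
        refine ⟨y, h, fun z hz => h' z ?_ hz⟩
        obtain ⟨x', _, z', hz', hp⟩ := h1 _ hz
        exact (pr_inj hp).2 ▸ hz'
    · intro h
      refine ⟨fun p hp => ?_, fun x hx => ?_⟩
      · obtain ⟨x, y, hx, hy, h⟩ := h.1 p hp
        exact ⟨x, hx, y, hy, h⟩
      · exact ⟨_, h.app_mem hx, h.pr_mem hx, fun z _ hz => (h.app_eq hz).symm⟩

instance d0_IsElemMap : D0 M (fun e => IsElemMap (a e) (b e) (c e) (d e) (f e)) := by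
  unfold IsElemMap
  infer_instance

end

attribute [local instance 50] DfT.comp_inst

section
variable [ha : DfT M a] [hb : DfT M b] [hc : DfT M c] [hd : DfT M d] [hf : DfT M f]

instance df_IsElemMap : Df M (fun e => IsElemMap (a e) (b e) (c e) (d e) (f e)) := by
  unfold IsElemMap
  infer_instance

end
end

/-! ### The satisfaction relation is fixed -/

theorem mem_fmls (hv : Good v) {φ : M} : φ ∈ fmls v ↔ IsFml φ := by
  unfold fmls
  rw [mem_sep]
  exact ⟨fun h => h.2, fun h => ⟨h.mem_good hv, h⟩⟩

theorem fmls_sub : Sub (fmls v) v := fun x hx => by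
  unfold fmls at hx
  exact ((mem_sep x).1 hx).1

theorem FmlClosed.mem (hv : Good v) {C : M} (hC : FmlClosed v C) (φ : M) (hφ : IsFml φ) :
    φ ∈ C := by
  have hvw := fun n (hn : n ∈ (omega : M)) => hv.nat hn
  refine fml_induction hv (fun φ => φ ∈ C) (fun m n hm hn => ?_) (fun m n hm hn => ?_)
    (fun φ hφ ih => ?_) (fun φ ψ hφ hψ ih ih' => ?_) (fun m φ hm hφ ih => ?_) φ hφ
  · exact hC.1 m (hvw m hm) hm n (hvw n hn) hn _ ((isFml_fMem hm hn).mem_good hv)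
      (Or.inl ((hv.numPr₂ (hvw m hm) (hvw n hn)).2 rfl))
  · exact hC.1 m (hvw m hm) hm n (hvw n hn) hn _ ((isFml_fEq hm hn).mem_good hv)
      (Or.inr ((hv.numPr₂ (hvw m hm) (hvw n hn)).2 rfl))
  · exact hC.2.1 φ (hφ.mem_good hv) ih _ (hφ.fNot.mem_good hv) (hv.numPr.2 rfl)
  · exact hC.2.2.1 φ (hφ.mem_good hv) ih ψ (hψ.mem_good hv) ih' _ ((hφ.fAnd hψ).mem_good hv)
      ((hv.numPr₂ (hφ.mem_good hv) (hψ.mem_good hv)).2 rfl)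
  · exact hC.2.2.2 m (hvw m hm) hm φ (hφ.mem_good hv) ih _ ((hφ.fEx hm).mem_good hv)
      ((hv.numPr₂ (hvw m hm) (hφ.mem_good hv)).2 rfl)

theorem fmlClosed_fmls (hv : Good v) : FmlClosed v (fmls v) := by
  refine ⟨fun m hm hmo n hn hno x hx h => ?_, fun y hy hyN x hx h => ?_,
    fun y hy hyN z hz hzN x hx h => ?_, fun m hm hmo y hy hyN x hx h => ?_⟩
  all_goals rw [mem_fmls hv] at *
  · rcases h with h | h
    · rw [(hv.numPr₂ hm hn).1 h]
      exact isFml_fMem hmo hno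
    · rw [(hv.numPr₂ hm hn).1 h]
      exact isFml_fEq hmo hno
  · rw [hv.numPr.1 h]
    exact hyN.fNot
  · rw [(hv.numPr₂ hy hz).1 h]
    exact hyN.fAnd hzN
  · rw [(hv.numPr₂ hm hy).1 h]
    exact hyN.fEx hmo

/-- The bounded Tarski clauses have a unique solution, by induction on formulas. Since their other
parameters are fixed by `j`, so is the solution. -/
theorem IsSatSet.eq_satSet (hv : Good v) {S : M} (hS : IsSatSet v (fmls v) (asg v) S) :
    S = satSet v := by
  have hvw := fun n (hn : n ∈ (omega : M)) => hv.nat hn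
  have key : ∀ φ, IsFml φ → ∀ s, IsFunc s omega v → (pr φ s ∈ S ↔ Tr v φ s) := by
    have hN := fun φ => mem_fmls hv (φ := φ)
    refine fml_induction hv (fun φ => ∀ s, IsFunc s omega v → (pr φ s ∈ S ↔ Tr v φ s))
      (fun m n hm hn s hs => ?_) (fun m n hm hn s hs => ?_) (fun φ hφ ih s hs => ?_)
      (fun φ ψ hφ hψ ih ih' s hs => ?_) (fun m φ hm hφ ih s hs => ?_)
    all_goals have h := hS.2 s ((mem_asg' hv).2 hs)
    · rw [h.1 m (hvw m hm) hm n (hvw n hn) hn _ ((hN _).2 (isFml_fMem hm hn))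
        ((hv.numPr₂ (hvw m hm) (hvw n hn)).2 rfl), tr_mem hv hm hn hs]
      simp only [hs.pr_mem_iff_val]
      exact ⟨fun ⟨y, _, ⟨_, hy⟩, z, _, ⟨_, hz⟩, h⟩ => hy ▸ hz ▸ h,
        fun h => ⟨_, hs.val_mem hm, ⟨hm, rfl⟩, _, hs.val_mem hn, ⟨hn, rfl⟩, h⟩⟩
    · rw [h.2.1 m (hvw m hm) hm n (hvw n hn) hn _ ((hN _).2 (isFml_fEq hm hn))
        ((hv.numPr₂ (hvw m hm) (hvw n hn)).2 rfl), tr_eq hv hm hn hs]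
      simp only [hs.pr_mem_iff_val]
      exact ⟨fun ⟨y, _, ⟨_, hy⟩, _, hz⟩ => hy.symm.trans hz,
        fun h => ⟨_, hs.val_mem hm, ⟨hm, rfl⟩, hn, h⟩⟩
    · rw [h.2.2.1 φ ((hN _).2 hφ) _ ((hN _).2 hφ.fNot) (hv.numPr.2 rfl), tr_not hv hφ hs, ih s hs]
    · rw [h.2.2.2.1 φ ((hN _).2 hφ) ψ ((hN _).2 hψ) _ ((hN _).2 (hφ.fAnd hψ))
        ((hv.numPr₂ (hφ.mem_good hv) (hψ.mem_good hv)).2 rfl), tr_and hv hφ hψ hs, ih s hs, ih' s hs]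
    · rw [h.2.2.2.2 m (hvw m hm) hm φ ((hN _).2 hφ) _ ((hN _).2 (hφ.fEx hm))
        ((hv.numPr₂ (hvw m hm) (hφ.mem_good hv)).2 rfl), tr_ex' hv hm hφ hs]
      refine exists_congr fun t => ⟨fun ⟨h1, h2, h3⟩ => ?_, fun ⟨h1, h2⟩ => ?_⟩
      · rw [mem_asg' hv] at h1
        refine ⟨fun i hi him => ?_, (ih t h1).1 h3⟩
        obtain ⟨a, _, h4, h5⟩ := h2 i (hvw i hi) hi him
        rw [← (h1.pr_mem_iff_val.1 h5).2, ← (hs.pr_mem_iff_val.1 h4).2]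
      · have ht := h2.isFunc hv
        exact ⟨(mem_asg' hv).2 ht, fun i _ hi him => ⟨_, hs.val_mem hi,
          hs.pr_mem_iff_val.2 ⟨hi, rfl⟩, ht.pr_mem_iff_val.2 ⟨hi, (h1 i hi him).symm⟩⟩,
          (ih t ht).2 h2⟩
  refine ext fun p => ?_
  rw [mem_satSet hv]
  constructor
  · intro hp
    obtain ⟨x, hx, s, hs, rfl⟩ := hS.1 p hp
    rw [mem_fmls hv] at hx
    rw [mem_asg' hv] at hs
    exact ⟨x, s, hx, rfl, (key x hx s hs).1 hp⟩
  · rintro ⟨φ, s, hφ, rfl, h⟩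
    exact (key φ hφ s (h.isFunc hv)).2 h

theorem isSatSet_satSet (hv : Good v) : IsSatSet v (fmls v) (asg v) (satSet v) := by
  have hN := fun φ => mem_fmls hv (φ := φ)
  refine ⟨fun p hp => ?_, fun s hs => ?_⟩
  · obtain ⟨φ, s, hφ, rfl, h⟩ := (mem_satSet hv).1 hp
    exact ⟨φ, (hN φ).2 hφ, s, (mem_asg' hv).2 (h.isFunc hv), rfl⟩
  rw [mem_asg' hv] at hs
  refine ⟨fun m hm hmo n hn hno x hx h => ?_, fun m hm hmo n hn hno x hx h => ?_,
    fun y hy x hx h => ?_, fun y hy z hz x hx h => ?_, fun m hm hmo y hy x hx h => ?_⟩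
  all_goals rw [pr_mem_satSet hv ((hN _).1 hx)]
  · rw [(hv.numPr₂ hm hn).1 h]
    refine (tr_mem hv hmo hno hs).trans ?_
    simp only [hs.pr_mem_iff_val]
    exact ⟨fun h => ⟨_, hs.val_mem hmo, ⟨hmo, rfl⟩, _, hs.val_mem hno, ⟨hno, rfl⟩, h⟩,
      fun ⟨y, _, ⟨_, hy⟩, z, _, ⟨_, hz⟩, h⟩ => hy ▸ hz ▸ h⟩
  · rw [(hv.numPr₂ hm hn).1 h]
    refine (tr_eq hv hmo hno hs).trans ?_
    simp only [hs.pr_mem_iff_val]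
    exact ⟨fun h => ⟨_, hs.val_mem hmo, ⟨hmo, rfl⟩, hno, h⟩,
      fun ⟨y, _, ⟨_, hy⟩, _, hz⟩ => hy.symm.trans hz⟩
  · rw [hN] at hy
    rw [hv.numPr.1 h, pr_mem_satSet hv hy]
    exact tr_not hv hy hs
  · rw [hN] at hy hz
    rw [(hv.numPr₂ (hy.mem_good hv) (hz.mem_good hv)).1 h, pr_mem_satSet hv hy,
      pr_mem_satSet hv hz]
    exact tr_and hv hy hz hs
  · rw [hN] at hy
    rw [(hv.numPr₂ hm (hy.mem_good hv)).1 h]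
    refine (tr_ex' hv hmo hy hs).trans (exists_congr fun t => ?_)
    rw [pr_mem_satSet hv hy]
    constructor
    · rintro ⟨h1, h2⟩
      have ht := h2.isFunc hv
      exact ⟨(mem_asg' hv).2 ht, fun i _ hi him => ⟨_, hs.val_mem hi,
          hs.pr_mem_iff_val.2 ⟨hi, rfl⟩, ht.pr_mem_iff_val.2 ⟨hi, (h1 i hi him).symm⟩⟩, h2⟩
    · rintro ⟨h1, h2, h3⟩
      rw [mem_asg' hv] at h1
      refine ⟨fun i hi him => ?_, h3⟩
      obtain ⟨a, _, h4, h5⟩ := h2 i (hv.nat hi) hi him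
      rw [← (h1.pr_mem_iff_val.1 h5).2, ← (hs.pr_mem_iff_val.1 h4).2]

/-- With the sets of formulas, assignments and true pairs as parameters, elementarity becomes
bounded and can be transferred by `j`. -/
theorem isElemMap_iff (hv : Good v) {k : M} :
    IsElemMap k v (fmls v) (asg v) (satSet v) ↔ IsElemFor IsFml v k := by
  rw [isElemFor_iff hv fun _ h => h]
  refine and_congr_right fun hk => ?_
  have hN := fun φ => mem_fmls hv (φ := φ)
  constructor
  · intro h φ hφ s hs
    have ht := isFunc_compAsg hk hs
    rw [← pr_mem_satSet hv hφ, ← pr_mem_satSet hv hφ]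
    refine h φ ((hN φ).2 hφ) s ((mem_asg' hv).2 hs) _ ((mem_asg' hv).2 ht) fun i _ hi =>
      ⟨_, hs.val_mem hi, hs.pr_mem_iff_val.2 ⟨hi, rfl⟩, _, ht.val_mem hi,
        ht.pr_mem_iff_val.2 ⟨hi, rfl⟩, hk.pr_mem_iff_val.2 ⟨hs.val_mem hi, val_compAsg hi⟩⟩
  · intro h φ hφ s hs t ht hst
    rw [hN] at hφ
    rw [mem_asg' hv] at hs ht
    rw [pr_mem_satSet hv hφ, pr_mem_satSet hv hφ, h φ hφ s hs]
    have : compAsg k s = t := (isFunc_compAsg hk hs).ext_val ht fun i hi => by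
      obtain ⟨y, _, hy, z, _, hz, hyz⟩ := hst i (hv.nat hi) hi
      rw [val_compAsg hi, ← (hs.pr_mem_iff_val.1 hy).2, ← (ht.pr_mem_iff_val.1 hz).2,
        ← (hk.pr_mem_iff_val.1 hyz).2]
    rw [this]

theorem mem_elemMaps (hv : Good v) {k : M} :
    k ∈ elemMaps v ↔ IsElemMap k v (fmls v) (asg v) (satSet v) := by
  have : elemMaps v = theSet fun k => IsElemMap k v (fmls v) (asg v) (satSet v) :=
    theSet_congr fun k => (isElemMap_iff hv).symm
  rw [this]
  exact mem_theSet (a := power v) (fun k h => mem_power.2 (h.1.sub hv (Sub.refl v) (Sub.refl v))) k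

theorem elemMaps_sub (hv : Good v) : Sub (elemMaps v) (power v) := fun k hk =>
  mem_power.2 (((mem_elemMaps hv).1 hk).1.sub hv (Sub.refl v) (Sub.refl v))

namespace Setting
variable (S : Setting v j)
include S

/-- Formulas are built from natural numbers by pairing, and `j` fixes the former and commutes with
the latter. -/
theorem map_fml (φ : M) (hφ : IsFml φ) : val j φ = φ := by
  have hj := S.elem
  have hm : ∀ x, IsFml x → x ∈ power (power v) := fun x hx => hx.mem_good hj.good
  have hn : ∀ k : ℕ, (num k : M) ∈ power (power v) := fun k => hj.good.nat (num_mem_omega k)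
  have ho := fun n (hn : n ∈ (omega : M)) => hj.good.nat hn
  have hnn := fun k : ℕ => hj.map_nat (num_mem_omega k)
  refine fml_induction S.good (fun φ => val j φ = φ) (fun m n hm hn' => ?_) (fun m n hm hn' => ?_)
    (fun φ hφ ih => ?_) (fun φ ψ hφ hψ ih ih' => ?_) (fun m φ hmo hφ ih => ?_) φ hφ
  · unfold fMem
    rw [hj.map_pr (hn 0) (hj.good.pr (ho m hm) (ho n hn')), hj.map_pr (ho m hm) (ho n hn'), hnn,
      hj.map_nat hm, hj.map_nat hn']
  · unfold fEq
    rw [hj.map_pr (hn 1) (hj.good.pr (ho m hm) (ho n hn')), hj.map_pr (ho m hm) (ho n hn'), hnn,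
      hj.map_nat hm, hj.map_nat hn']
  · unfold fNot
    rw [hj.map_pr (hn 2) (hm φ hφ), hnn, ih]
  · unfold fAnd
    rw [hj.map_pr (hn 3) (hj.good.pr (hm φ hφ) (hm ψ hψ)), hj.map_pr (hm φ hφ) (hm ψ hψ), hnn, ih,
      ih']
  · unfold fEx
    rw [hj.map_pr (hn 4) (hj.good.pr (ho m hmo) (hm φ hφ)), hj.map_pr (ho m hmo) (hm φ hφ), hnn, ih,
      hj.map_nat hmo]

/-- The set of formulas is the least `FmlClosed` subset of `v`. With `power v` as the range of
competitors this is bounded, and both `v` and `power v` are fixed. -/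
theorem map_fmls : val j (fmls v) = fmls v := by
  have hj := S.elem
  have hv := S.fixed.mem hj
  have hN : fmls v ∈ power v := mem_power.2 fmls_sub
  have h : IsFmls v (power v) (fmls v) := ⟨fmlClosed_fmls S.good, fun D _ hD x hx =>
    hD.mem S.good x ((mem_fmls S.good).1 hx)⟩
  have := (hj.elem3 IsFmls hv (self_mem_power _) (hj.good.trans hN (self_mem_power _))).1 h
  rw [S.fixed.map hj, S.fix] at this
  exact Sub.antisymm (this.2 _ hN (fmlClosed_fmls S.good)) fun x hx =>
    this.1.mem S.good x ((mem_fmls S.good).1 hx)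

theorem map_asg : val j (asg v) = asg v := by
  have hj := S.elem
  have hv := S.fixed.mem hj
  have ho : omega ∈ power v := mem_power.2 S.good.omega_sub
  have h2 : Sub (asg v) (power v) := asg_sub S.good
  have := (hj.elem4 (fun W u o v => ∀ s, s ∈ u → (s ∈ W ↔ IsFunc s o v)) (mem_power.2 h2)
    (self_mem_power _) (hj.good.trans ho (self_mem_power _)) hv).1
    fun s _ => mem_asg' S.good
  rw [S.fix, hj.map_omega (hj.good.trans ho (self_mem_power _)), S.fixed.map hj] at this
  refine ext fun s => ⟨fun hs => ?_, fun hs => ?_⟩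
  · exact (mem_asg' S.good).2 ((this s (S.map_sub h2 s hs)).1 hs)
  · exact (this s (h2 s hs)).2 ((mem_asg' S.good).1 hs)

theorem satSet_sub : Sub (satSet v) (power v) := fun p hp => by
  obtain ⟨φ, s, hφ, rfl, h⟩ := (mem_satSet S.good).1 hp
  exact S.good.power.pr (hφ.mem_good S.good.power)
    (asg_sub S.good s ((mem_asg' S.good).2 (h.isFunc S.good)))

theorem fmls_mem : fmls v ∈ power (power v) :=
  S.elem.good.trans (mem_power.2 fmls_sub) (self_mem_power _)

theorem map_satSet : val j (satSet v) = satSet v := by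
  have := (S.elem.elem4 IsSatSet (S.fixed.mem S.elem) S.fmls_mem (mem_power.2 (asg_sub S.good))
    (mem_power.2 S.satSet_sub)).1 (isSatSet_satSet S.good)
  rw [S.fixed.map S.elem, S.map_fmls, S.map_asg] at this
  exact this.eq_satSet S.good

/-- A pair `(φ, s)` goes to `(φ, j(s))`, and `j(s) = j ∘ s` because natural numbers are fixed. Since
`satSet v` is fixed too, membership in it is preserved. -/
theorem isElemMap_restrict :
    IsElemMap (restrict j v) v (fmls v) (asg v) (satSet v) := by
  have hj := S.elem
  have hvA := S.fixed.sub hj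
  refine ⟨S.fixed.isFunc_restrict hj, fun φ hφ s hs t ht hst => ?_⟩
  rw [mem_fmls S.good] at hφ
  have hsA := S.fixed.power_sub hj s (asg_sub S.good s hs)
  have hφA := hφ.mem_good hj.good
  rw [hj.mem_iff (hj.good.pr hφA hsA) (mem_power.2 S.satSet_sub), S.map_satSet,
    hj.map_pr hφA hsA, S.map_fml φ hφ]
  have hjs : IsFunc (val j s) omega v := by
    rw [← mem_asg' S.good, ← S.map_asg]
    exact (hj.mem_iff hsA (mem_power.2 (asg_sub S.good))).1 hs
  rw [mem_asg' S.good] at hs ht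
  have : val j s = t := hjs.ext_val ht fun i hi => by
    obtain ⟨y, hy, h1, z, _, h2, h3⟩ := hst i (S.good.nat hi) hi
    have := (hj.mem_iff (hj.good.pr (hj.good.nat hi) (hvA y hy)) hsA).1 h1
    rw [hj.map_pr (hj.good.nat hi) (hvA y hy), hj.map_nat hi] at this
    rw [← (ht.pr_mem_iff_val.1 h2).2, ← (hjs.pr_mem_iff_val.1 this).2,
      ((S.fixed.pr_mem_restrict hj).1 h3).2]
  rw [this]

/-- Almost every `k` is an elementary map `V_η → V_η`. -/
theorem ae_mem_elemMaps : Ae v j fun k => k ∈ elemMaps v := by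
  rw [S.ae_iff]
  have hj := S.elem
  have hσ : Sub (theSet fun k => k ∈ power v ∧ k ∈ elemMaps v) (power v) := fun k hk =>
    ((mem_sep k).1 hk).1
  have := (hj.elem6 (fun σ u v N W S => ∀ k, k ∈ u → IsElemMap k v N W S → k ∈ σ)
    (mem_power.2 hσ) (self_mem_power _) (S.fixed.mem hj) S.fmls_mem (mem_power.2 (asg_sub S.good))
    (mem_power.2 S.satSet_sub)).1 fun k hk h => (mem_sep k).2 ⟨hk, (mem_elemMaps S.good).2 h⟩
  rw [S.fix, S.fixed.map hj, S.map_fmls, S.map_asg, S.map_satSet] at this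
  exact this _ S.seed_mem S.isElemMap_restrict

end Setting
end

end ZFM



/-! ### Łoś's theorem, Σ₁-elementarity and the definable hull. -/

namespace ZFM

section
variable {M : Type u} [ZFModel M] {v j : M}

attribute [local instance 50] Proj.comp_inst DfT.comp_inst

/-! ### Łoś's theorem for bounded formulas -/

/-- The `i`-th coordinate of a sequence of assignments. -/
noncomputable def coord (v H i : M) : M := mkFun (power v) fun k => val (val H k) i

/-- The assignment represented by a sequence of assignments. -/
noncomputable def repAsg (v : M) (π : M → M) (H : M) : M := mkFun omega fun i => π (coord v H i)

/-- The sequence of assignments `H` with the value at `m` changed according to `g`. -/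
noncomputable def updSeq (v H m g : M) : M := mkFun (power v) fun k => upd (val H k) m (val g k)

section
variable {E : Type u} [Env M E] {a b c d : E → M} [ha : DfT M a] [hb : DfT M b] [hc : DfT M c]
  [hd : DfT M d]

instance df_coord : DfT M (fun e => coord (a e) (b e) (c e)) :=
  DfT.comp3 (by unfold coord; infer_instance) ha hb hc

instance df_repAsg {π : M → M} [hπ : DfT₁ M π] : DfT M (fun e => repAsg v π (a e)) := by
  have hπ' : ∀ {E : Type u} [Env M E] {x : E → M} [DfT M x], DfT M (fun e => π (x e)) :=
    fun {E} _ {x} hx => DfT.comp1 hπ hx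
  exact DfT.comp1 (by unfold repAsg; infer_instance) ha

end

/-- Every relation with right field `B` has a uniformization almost everywhere. -/
def HasUnif (v j B : M) : Prop := ∀ R : M, ∃ g, IsFunc g (power v) B ∧
  Ae v j fun k => (∃ x, x ∈ B ∧ pr k x ∈ R) → pr k (val g k) ∈ R

/-- `π` represents the ultrapower of `A` as a transitive subset of `A`. -/
structure Repr (v j A : M) (π : M → M) : Prop where
  mem : ∀ {f}, IsFunc f (power v) A → π f ∈ A
  eq_iff : ∀ {f g}, IsFunc f (power v) A → IsFunc g (power v) A →
    (π f = π g ↔ Ae v j fun k => val f k = val g k)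
  mem_iff : ∀ {f g}, IsFunc f (power v) A → IsFunc g (power v) A →
    (π f ∈ π g ↔ Ae v j fun k => val f k ∈ val g k)
  surj : ∀ {f z}, IsFunc f (power v) A → z ∈ π f → ∃ g, IsFunc g (power v) A ∧ π g = z

variable {A B : M} {π : M → M}

theorem isFunc_coord (hA : Good A) {H i : M} (hH : IsFunc H (power v) (asg A))
    (hi : i ∈ (omega : M)) : IsFunc (coord v H i) (power v) A :=
  isFunc_mkFun fun _ hk => ((mem_asg' hA).1 (hH.val_mem hk)).val_mem hi

theorem val_coord {H i k : M} (hk : k ∈ power v) : val (coord v H i) k = val (val H k) i :=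
  val_mkFun hk

theorem val_updSeq {H m g k : M} (hk : k ∈ power v) :
    val (updSeq v H m g) k = upd (val H k) m (val g k) := val_mkFun hk

theorem isFunc_updSeq (hA : Good A) {H m g : M} (hH : IsFunc H (power v) (asg A))
    (hg : IsFunc g (power v) A) : IsFunc (updSeq v H m g) (power v) (asg A) :=
  isFunc_mkFun fun _ hk => (mem_asg' hA).2
    (isFunc_upd ((mem_asg' hA).1 (hH.val_mem hk)) (hg.val_mem hk))

instance df_coord_comp [hπ : DfT₁ M π] {H : M} : DfT₁ M fun i => π (coord v H i) :=
  DfT.comp1 (x := fun e : PUnit.{u + 1} × M => coord v H e.2) hπ inferInstance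

theorem Repr.isFunc_repAsg (hA : Good A) (h : Repr v j A π) [DfT₁ M π] {H : M}
    (hH : IsFunc H (power v) (asg A)) : IsFunc (repAsg v π H) omega A :=
  isFunc_mkFun fun _ hi => h.mem (isFunc_coord hA hH hi)

theorem val_repAsg [hπ : DfT₁ M π] {H i : M} (hi : i ∈ (omega : M)) :
    val (repAsg v π H) i = π (coord v H i) := by
  exact val_mkFun (t := fun i => π (coord v H i)) hi

theorem Repr.repAsg_updSeq (hA : Good A) (h : Repr v j A π) [DfT₁ M π] {H m g : M}
    (hH : IsFunc H (power v) (asg A)) (hm : m ∈ (omega : M)) (hg : IsFunc g (power v) A) :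
    repAsg v π (updSeq v H m g) = upd (repAsg v π H) m (π g) := by
  have hH' := isFunc_updSeq hA (m := m) hH hg
  refine (h.isFunc_repAsg hA hH').ext_val (isFunc_upd (h.isFunc_repAsg hA hH) (h.mem hg))
    fun i hi => ?_
  rw [val_repAsg hi]
  by_cases him : i = m
  · subst him
    rw [val_upd_self hi]
    congr 1
    refine (isFunc_coord hA hH' hi).ext_val hg fun k hk => ?_
    rw [val_coord hk, val_updSeq hk, val_upd_self hi]
  · rw [val_upd hi him, val_repAsg hi]
    congr 1
    refine (isFunc_coord hA hH' hi).ext_val (isFunc_coord hA hH hi) fun k hk => ?_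
    rw [val_coord hk, val_coord hk, val_updSeq hk, val_upd hi him]

/-- Łoś's theorem for bounded formulas. -/
theorem Repr.tr_iff (S : Setting v j) (hB : Good B) (hVB : Sub (power v) B)
    (h : Repr v j (power B) π) (hU : HasUnif v j B) [hπ : DfT₁ M π] (φ : M) (hφ : IsSigma0 φ) :
    ∀ H, IsFunc H (power v) (asg (power B)) →
      (Tr (power B) φ (repAsg v π H) ↔ Ae v j fun k => Tr (power B) φ (val H k)) := by
  have hA := hB.power
  have hs : ∀ {H}, IsFunc H (power v) (asg (power B)) → ∀ k, k ∈ power v →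
      IsFunc (val H k) omega (power B) := fun hH k hk => (mem_asg' hA).1 (hH.val_mem hk)
  refine (sigma0_induction hA (fun φ => ∀ H, IsFunc H (power v) (asg (power B)) →
      (Tr (power B) φ (repAsg v π H) ↔ Ae v j fun k => Tr (power B) φ (val H k)))
      (fun m n hm hn H hH => ?_) (fun m n hm hn H hH => ?_) (fun φ hφ ih H hH => ?_)
      (fun φ ψ hφ hψ ih ih' H hH => ?_) (fun m n φ hm hn hmn hφ ih H hH => ?_) φ hφ).2
  · rw [tr_mem hA hm hn (h.isFunc_repAsg hA hH), val_repAsg hm, val_repAsg hn,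
      h.mem_iff (isFunc_coord hA hH hm) (isFunc_coord hA hH hn)]
    refine S.ae_congr fun k hk => ?_
    rw [tr_mem hA hm hn (hs hH k hk), val_coord hk, val_coord hk]
  · rw [tr_eq hA hm hn (h.isFunc_repAsg hA hH), val_repAsg hm, val_repAsg hn,
      h.eq_iff (isFunc_coord hA hH hm) (isFunc_coord hA hH hn)]
    refine S.ae_congr fun k hk => ?_
    rw [tr_eq hA hm hn (hs hH k hk), val_coord hk, val_coord hk]
  · rw [tr_not hA hφ (h.isFunc_repAsg hA hH), ih H hH, ← S.ae_not]
    exact S.ae_congr fun k hk => (tr_not hA hφ (hs hH k hk)).symm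
  · rw [tr_and hA hφ hψ (h.isFunc_repAsg hA hH), ih H hH, ih' H hH, ← S.ae_and]
    exact S.ae_congr fun k hk => (tr_and hA hφ hψ (hs hH k hk)).symm
  · rw [tr_bex hA hm hn hmn hφ (h.isFunc_repAsg hA hH), val_repAsg hn]
    have hbex : ∀ k, k ∈ power v → (Tr (power B) (fEx m (fAnd (fMem m n) φ)) (val H k) ↔
        ∃ x, x ∈ val (val H k) n ∧ Tr (power B) φ (upd (val H k) m x)) := fun k hk =>
      tr_bex hA hm hn hmn hφ (hs hH k hk)
    rw [S.ae_congr hbex]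
    constructor
    · rintro ⟨x, hx, hT⟩
      -- A witness in the represented structure is itself represented, and its representative
      -- supplies witnesses almost everywhere.
      obtain ⟨g, hg, rfl⟩ := h.surj (isFunc_coord hA hH hn) hx
      rw [h.mem_iff hg (isFunc_coord hA hH hn)] at hx
      rw [← h.repAsg_updSeq hA hH hm hg, ih _ (isFunc_updSeq hA hH hg)] at hT
      refine S.ae_mono (fun k hk ⟨h1, h2⟩ => ?_) (S.ae_and.2 ⟨hx, hT⟩)
      rw [val_coord hk] at h1
      rw [val_updSeq hk] at h2
      exact ⟨_, h1, h2⟩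
    · intro hE
      -- Conversely a function has to select witnesses. They belong to elements of `power B`, hence
      -- to `B`, so uniformization with values in `B` replaces choice.
      obtain ⟨R, hR⟩ := separation (fun p => ∃ k x, k ∈ power v ∧ p = pr k x ∧
        x ∈ val (val H k) n ∧ Tr (power B) φ (upd (val H k) m x)) (power B)
      have hR' : ∀ k x, k ∈ power v → x ∈ B → (pr k x ∈ R ↔ x ∈ val (val H k) n ∧
          Tr (power B) φ (upd (val H k) m x)) := fun k x hk hx => by
        rw [hR]
        constructor
        · rintro ⟨_, k', x', _, h1, h2⟩
          rw [pr_eq] at h1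
          rw [h1.1, h1.2]
          exact h2
        · exact fun h => ⟨hB.mem_power_of_mem (hB.pr (hVB k hk) hx), k, x, hk, rfl, h⟩
      obtain ⟨g, hg, hgR⟩ := hU R
      have hg' : IsFunc g (power v) (power B) := hg.mono fun k hk =>
        hB.mem_power_of_mem (hg.app_mem hk)
      have key : Ae v j fun k => val g k ∈ val (val H k) n ∧
          Tr (power B) φ (upd (val H k) m (val g k)) := by
        refine S.ae_mono (fun k hk ⟨⟨x, hx, hT⟩, h2⟩ => ?_) (S.ae_and.2 ⟨hE, hgR⟩)
        have hxB : x ∈ B := mem_power.1 ((hs hH k hk).val_mem hn) x hx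
        exact (hR' k _ hk (hg.val_mem hk)).1 (h2 ⟨x, hxB, (hR' k x hk hxB).2 ⟨hx, hT⟩⟩)
      refine ⟨π g, ?_, ?_⟩
      · rw [h.mem_iff hg' (isFunc_coord hA hH hn)]
        refine S.ae_mono (fun k hk h => ?_) key
        rw [val_coord hk]
        exact h.1
      · rw [← h.repAsg_updSeq hA hH hm hg', ih _ (isFunc_updSeq hA hH hg')]
        refine S.ae_mono (fun k hk h => ?_) key
        rw [val_updSeq hk]
        exact h.2

/-- The constant function with value `x`. -/
noncomputable def const (v x : M) : M := mkFun (power v) fun _ => x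

instance df_const {E : Type u} [Env M E] {a : E → M} [ha : DfT M a] :
    DfT M (fun e => const v (a e)) := DfT.comp1 (by unfold const; infer_instance) ha

theorem isFunc_const' {x : M} (hx : x ∈ A) : IsFunc (const v x) (power v) A :=
  isFunc_mkFun fun _ _ => hx

theorem val_const {x k : M} (hk : k ∈ power v) : val (const v x) k = x := val_mkFun hk

theorem coord_const {s i : M} : coord v (const v s) i = const v (val s i) := by
  unfold coord const mkFun
  refine theSet_congr fun p => exists_congr fun k => and_congr_right fun hk => ?_
  have := val_const (x := s) hk
  unfold const mkFun at this
  dsimp only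
  rw [this]

theorem repAsg_const [hπ : DfT₁ M π] {s i : M} (hi : i ∈ (omega : M)) :
    val (repAsg v π (const v s)) i = π (const v (val s i)) := by
  rw [val_repAsg hi, coord_const]

/-- If `ℓ` is given by constant functions, then it is elementary for bounded formulas. -/
theorem Repr.elem0 (S : Setting v j) (hB : Good B) (hVB : Sub (power v) B)
    (h : Repr v j (power B) π) (hU : HasUnif v j B) [hπ : DfT₁ M π] {l : M}
    (hl : IsFunc l (power B) (power B)) (hlπ : ∀ x, x ∈ power B → val l x = π (const v x)) :
    Elem0 (power B) l := by
  have hA := hB.power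
  refine ⟨hA, hl, fun φ hφ s hs => ?_⟩
  have hH := isFunc_const' (v := v) ((mem_asg' hA).2 hs)
  have : compAsg l s = repAsg v π (const v s) :=
    (isFunc_compAsg hl hs).ext_val (h.isFunc_repAsg hA hH) fun i hi => by
      rw [val_compAsg hi, repAsg_const hi, hlπ _ (hs.val_mem hi)]
  rw [this, h.tr_iff S hB hVB hU φ hφ _ hH]
  constructor
  · intro hT
    exact S.ae_of_forall fun k hk => by rwa [val_const hk]
  · intro hT
    obtain ⟨k, hk, h⟩ := S.ae_exists hT
    rwa [val_const hk] at h

/-- If in addition all elements are represented, then it is elementary for `Σ₁` formulas. -/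
theorem Repr.elem1 (S : Setting v j) (hB : Good B) (hVB : Sub (power v) B)
    (h : Repr v j (power B) π) (hU : HasUnif v j B) [hπ : DfT₁ M π] {l : M}
    (hl : IsFunc l (power B) (power B)) (hlπ : ∀ x, x ∈ power B → val l x = π (const v x))
    (hsurj : ∀ x, x ∈ power B → ∃ g, IsFunc g (power v) (power B) ∧ π g = x) :
    IsElemFor IsSigma1 (power B) l := by
  have hA := hB.power
  have h0 := h.elem0 S hB hVB hU hl hlπ
  have hs : ∀ {H}, IsFunc H (power v) (asg (power B)) → ∀ k, k ∈ power v →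
      IsFunc (val H k) omega (power B) := fun hH k hk => (mem_asg' hA).1 (hH.val_mem hk)
  rw [isElemFor_iff hA fun φ hφ => (sigma1_induction hA (fun _ => True) (fun _ _ => trivial)
    (fun _ _ _ _ _ => trivial) φ hφ).1]
  refine ⟨hl, fun φ hφ s hs' => ⟨?_, fun hT => ?_⟩⟩
  · refine (sigma1_induction hA (fun φ => ∀ s, IsFunc s omega (power B) → Tr (power B) φ s →
      Tr (power B) φ (compAsg l s)) (fun φ hφ s hs => (h0.tr φ hφ s hs).1)
      (fun m φ hm hφ ih s hs hT => ?_) φ hφ).2 s hs'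
    rw [tr_ex hA hm hφ hs] at hT
    obtain ⟨x, hx, hT⟩ := hT
    have hu := isFunc_upd hs (m := m) hx
    rw [tr_ex' hA hm hφ (isFunc_compAsg hl hs)]
    refine ⟨_, fun i hi him => ?_, ih _ hu hT⟩
    rw [val_compAsg hi, val_compAsg hi, val_upd hi him]
  -- For unbounded quantifiers only this implication of Łoś's theorem is claimed. It takes a
  -- representative of a given witness and makes no selection; applied to a constant sequence of
  -- assignments it gives downward preservation.
  · have key := (sigma1_induction hA (fun φ => ∀ H, IsFunc H (power v) (asg (power B)) →
      Tr (power B) φ (repAsg v π H) → Ae v j fun k => Tr (power B) φ (val H k))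
      (fun φ hφ H hH => (h.tr_iff S hB hVB hU φ hφ H hH).1) (fun m φ hm hφ ih H hH hT => ?_) φ hφ).2
    · have hH := isFunc_const' (v := v) ((mem_asg' hA).2 hs')
      have : compAsg l s = repAsg v π (const v s) :=
        (isFunc_compAsg hl hs').ext_val (h.isFunc_repAsg hA hH) fun i hi => by
          rw [val_compAsg hi, repAsg_const hi, hlπ _ (hs'.val_mem hi)]
      rw [this] at hT
      obtain ⟨k, hk, h⟩ := S.ae_exists (key _ hH hT)
      rwa [val_const hk] at h
    · rw [tr_ex hA hm hφ (h.isFunc_repAsg hA hH)] at hT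
      obtain ⟨x, hx, hT⟩ := hT
      obtain ⟨g, hg, rfl⟩ := hsurj x hx
      rw [← h.repAsg_updSeq hA hH hm hg] at hT
      refine S.ae_mono (fun k hk hT => ?_) (ih _ (isFunc_updSeq hA hH hg) hT)
      rw [val_updSeq hk] at hT
      rw [tr_ex hA hm hφ (hs hH k hk)]
      exact ⟨_, hg.val_mem hk, hT⟩

theorem forall_eqv_nil {Q : ℕ → M → Prop} :
    (∀ i, Q i.val (Env.eqv (M := M) PUnit.unit.{u + 1} i)) ↔ True :=
  iff_true_intro fun i => (i : Fin 0).elim0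

theorem forall_eqv_prod {E : Type u} [Env M E] {Q : ℕ → M → Prop} {e : E} {x : M} :
    (∀ i, Q i.val (Env.eqv (M := M) (e, x) i)) ↔
      (∀ i, Q i.val (Env.eqv (M := M) e i)) ∧ Q (Env.dim M E) x := by
  have h1 := eqv_prod_last (M := M) (e, x)
  have h2 := eqv_prod_castSucc (M := M) (e, x)
  constructor
  · intro h
    refine ⟨fun i => ?_, ?_⟩
    · have := h i.castSucc
      rwa [h2 i] at this
    · have := h (Fin.last _)
      rwa [h1] at this
  · rintro ⟨h, h'⟩ i
    induction i using Fin.lastCases with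
    | last => rw [h1]; exact h'
    | cast i => rw [h2]; exact h i

/-! ### The ultrapower of `V_{η+2}` -/

/-- A function with values in `B` almost everywhere agrees almost everywhere with a function into
`B`. -/
theorem Setting.exists_retract (S : Setting v j) (hB : empty ∈ B) {f : M}
    (h : Ae v j fun k => val f k ∈ B) :
    ∃ g, IsFunc g (power v) B ∧ Ae v j fun k => val f k = val g k := by
  classical
  refine ⟨mkFun (power v) fun k => if val f k ∈ B then val f k else empty,
    isFunc_mkFun fun k _ => ?_, S.ae_mono (fun k hk hf => ?_) h⟩
  · split_ifs with h
    exacts [h, hB]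
  · rw [val_mkFun hk, if_pos hf]

namespace Setting
variable (S : Setting v j)
include S

theorem repr_rho : Repr v j (power (power v)) (rho v j) where
  mem _ := S.rho_mem _
  eq_iff hf hg := S.rho_eq_iff hf hg
  mem_iff hf hg := S.rho_mem_iff hf hg
  surj _ hz := S.rho_surj (mem_power.1 (S.good.power.power.trans hz (S.rho_mem _)))

/-- An element of the section of `j(R')` at the seed is represented by a function whose graph lies
in `R` almost everywhere. If there is no such element, then almost every section of `R'` is empty
and any function will do. -/
theorem hasUnif_power : HasUnif v j (power v) := by
  intro R
  have hemp : (empty : M) ∈ power v := S.good.power.empty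
  obtain ⟨R', hR'⟩ := separation (fun p => p ∈ R) (power v)
  have hR's : Sub R' (power v) := fun p hp => ((hR' p).1 hp).1
  have hrow : ∀ k x, k ∈ power v → (x ∈ row (power v) R' k ↔ x ∈ power v ∧ pr k x ∈ R) :=
    fun k x hk => by
      rw [mem_row, hR']
      exact and_congr_right fun hx => and_iff_right (S.good.power.pr hk hx)
  have hfr := S.isFunc_row R'
  by_cases hx : ∃ x, x ∈ row (power v) (val j R') (restrict j v)
  · obtain ⟨x, hx⟩ := hx
    obtain ⟨f, hf, rfl⟩ := S.rho_surj (mem_power.1 (S.good.power.mem_power_of_mem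
      (row_sub _ _ _ x hx)))
    rw [← S.rho_row hR's, S.rho_mem_iff hf hfr] at hx
    have hx' : Ae v j fun k => val f k ∈ power v ∧ pr k (val f k) ∈ R :=
      S.ae_mono (fun k hk h => by rwa [val_mkFun hk, hrow k _ hk] at h) hx
    obtain ⟨g, hg, hfg⟩ := S.exists_retract hemp (S.ae_mono (fun k _ h => h.1) hx')
    refine ⟨g, hg, S.ae_mono (fun k _ h _ => ?_) (S.ae_and.2 ⟨hx', hfg⟩)⟩
    rw [← h.2]
    exact h.1.2
  · refine ⟨_, isFunc_const' (v := v) hemp, ?_⟩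
    have h0 : IsFunc (const v empty) (power v) (power (power v)) :=
      isFunc_const' S.good.power.power.empty
    have : rho v j (mkFun (power v) (row (power v) R')) = rho v j (const v empty) := by
      rw [S.rho_row hR's, const, S.rho_const (empty_sub _), S.elem.map_nat empty_mem_omega]
      exact eq_empty_of fun y hy => hx ⟨y, hy⟩
    rw [S.rho_eq_iff hfr h0] at this
    refine S.ae_mono (fun k hk h ⟨x, hx, hR⟩ => ?_) this
    rw [val_mkFun hk, val_const hk] at h
    have := (hrow k x hk).2 ⟨hx, hR⟩
    rw [h] at this
    exact (not_mem_empty _ this).elim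

/-- `j` is elementary for `Σ₁` formulas. -/
theorem elem1 : IsElemFor IsSigma1 (power (power v)) j :=
  S.repr_rho.elem1 S S.good.power (Sub.refl _) S.hasUnif_power S.elem.func
    (fun _ hx => (S.rho_const (mem_power.1 hx)).symm) fun _ hx => S.rho_surj (mem_power.1 hx)

/-! ### The definable hull -/

/-- Every element of `V_{η+2}` is definable from parameters in `rg(j) ∪ {j ↾ V_η}`. -/
theorem hull_eq : hull (power (power v)) (theSet fun y =>
    (∃ x, x ∈ power (power v) ∧ y = app j x) ∨ y = restrict j v) = power (power v) := by
  classical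
  have hA := S.good.power.power
  set X := theSet fun y => (∃ x, x ∈ power (power v) ∧ y = app j x) ∨ y = restrict j v with hX
  have hX' : ∀ y, y ∈ X ↔ (∃ x, x ∈ power (power v) ∧ y = val j x) ∨ y = restrict j v := by
    have : X = theSet fun y => (∃ x, x ∈ power (power v) ∧ y = val j x) ∨ y = restrict j v :=
      theSet_congr fun y => or_congr_left (exists_congr fun x => and_congr_right fun hx => by
        rw [S.elem.func.val_eq hx])
    rw [this]
    refine fun y => mem_theSet (a := power (power v)) (fun y hy => ?_) y
    rcases hy with ⟨x, hx, rfl⟩ | rfl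
    · exact S.elem.mem hx
    · exact S.good.power.mem_power_of_mem S.seed_mem
  refine theSet_eq fun x => ⟨fun hx => ⟨hx, ?_⟩, fun h => h.1⟩
  obtain ⟨F, hF, hxF⟩ := S.rep x (mem_power.1 hx)
  have hxr : x = row (power v) (val j F) (restrict j v) := ext fun y => by
    rw [mem_row, ← hxF]
    exact ⟨fun hy => ⟨mem_power.1 hx y hy, hy⟩, fun hy => hy.2⟩
  -- The formula says that `v₀` is the section of `v₂` at `v₁` within `v₃`.
  obtain ⟨φ, hφ, hφ'⟩ := D0.out (M := M)
    (P := fun e : (((PUnit.{u + 1} × M) × M) × M) × M => e.1.1.1.2 = row e.2 e.1.2 e.1.1.2)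
  have hcA : restrict j v ∈ power (power v) := S.good.power.mem_power_of_mem S.seed_mem
  have hFA : val j F ∈ power (power v) := mem_power.2 (S.map_sub hF)
  -- The default value `power v` serves as the parameter `v₃` and fills all unused variables; it is
  -- allowed because `j` fixes it, so it lies in the range of `j`.
  let s := mkFun omega fun i => if i = empty then x else if i = num 1 then restrict j v else
    if i = num 2 then val j F else power v
  have hsv : ∀ i, i ∈ (omega : M) → val s i = if i = empty then x else
      if i = num 1 then restrict j v else if i = num 2 then val j F else power v :=
    fun i hi => val_mkFun hi
  have hs : IsFunc s omega (power (power v)) := isFunc_mkFun fun i _ => by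
    split_ifs
    exacts [hx, hcA, hFA, self_mem_power _]
  refine ⟨φ, s, hφ.isFml hA, hs, fun i hi hi0 => ?_, fun t ht hst => ?_⟩
  · rw [← hs.val_eq hi, hsv i hi, if_neg hi0, hX']
    split_ifs
    · exact Or.inr rfl
    · exact Or.inl ⟨F, mem_power.2 hF, rfl⟩
    · exact Or.inl ⟨_, self_mem_power _, S.fix.symm⟩
  · rw [agreeOff_iff hs ht] at hst
    have ht0 := ht.val_mem empty_mem_omega
    rw [sat_iff_tr hA (hφ.isFml hA) ht, ← ht.val_eq empty_mem_omega]
    refine (hφ' _ hA ((((PUnit.unit, val t empty), restrict j v), val j F), power v) (fun i => ?_)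
      t ht fun i => ?_).trans (by rw [← hxr])
    · revert i
      simp only [forall_eqv_prod (Q := fun _ y => y ∈ power (power v)),
        forall_eqv_nil (Q := fun _ y => y ∈ power (power v)), true_and]
      exact ⟨⟨⟨ht0, hcA⟩, hFA⟩, self_mem_power _⟩
    · revert i
      simp only [forall_eqv_prod (Q := fun n y => val t (num n) = y),
        forall_eqv_nil (Q := fun n y => val t (num n) = y), true_and]
      have hne : ∀ k : ℕ, (num (k + 1) : M) ≠ empty := fun k h => succ_ne_empty _ h
      have hn := fun k : ℕ => num_mem_omega (M := M) k
      refine ⟨⟨⟨rfl, ?_⟩, ?_⟩, ?_⟩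
      · change val t (num 1) = _
        rw [hst _ (hn 1) (hne 0), hsv _ (hn 1), if_neg (hne 0), if_pos rfl]
      · change val t (num 2) = _
        rw [hst _ (hn 2) (hne 1), hsv _ (hn 2), if_neg (hne 1), if_neg (by simp), if_pos rfl]
      · change val t (num 3) = _
        rw [hst _ (hn 3) (hne 2), hsv _ (hn 3), if_neg (hne 2), if_neg (by simp), if_neg (by simp)]

end Setting
end
end ZFM



/-! ### The ultrapower of V_{η+3}, uniformization and extensions of `j`. -/

namespace ZFM

section
variable {M : Type u} [ZFModel M] {v j l : M}

attribute [local instance 50] Proj.comp_inst DfT.comp_inst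

/-! ### The ultrapower of `V_{η+3}` -/

/-- The subset of `V_{η+2}` represented by `f : V_{η+1} → V_{η+3}`. -/
noncomputable def rho₃ (v j f : M) : M :=
  theSet fun w => w ∈ power (power v) ∧ ∃ g, IsFunc g (power v) (power (power v)) ∧
    (Ae v j fun k => val g k ∈ val f k) ∧ rho v j g = w

instance df_rho₃ {E : Type u} [Env M E] {a : E → M} [ha : DfT M a] :
    DfT M (fun e => rho₃ v j (a e)) := DfT.comp1 (by unfold rho₃; infer_instance) ha

theorem rho₃_mem (v j f : M) : rho₃ v j f ∈ power (power (power v)) :=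
  mem_power.2 fun w hw => ((mem_sep w).1 hw).1

theorem empty_mem_power (x : M) : empty ∈ power x := mem_power.2 (empty_sub x)

namespace Setting
variable (S : Setting v j)
include S

theorem isFunc_lift {f : M} (hf : IsFunc f (power v) (power (power v))) :
    IsFunc f (power v) (power (power (power v))) :=
  hf.mono fun _ hk => S.good.power.power.mem_power_of_mem (hf.app_mem hk)

theorem rho_mem_rho₃ {f g : M} (hg : IsFunc g (power v) (power (power v))) :
    rho v j g ∈ rho₃ v j f ↔ Ae v j fun k => val g k ∈ val f k := by
  unfold rho₃
  rw [mem_sep]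
  constructor
  · rintro ⟨_, g', hg', h1, h2⟩
    rw [S.rho_eq_iff hg' hg] at h2
    exact S.ae_mono (fun k _ h => by rw [← h.2]; exact h.1) (S.ae_and.2 ⟨h1, h2⟩)
  · exact fun h => ⟨S.rho_mem g, g, hg, h, rfl⟩

theorem exists_rho {w : M} (hw : w ∈ power (power v)) :
    ∃ g, IsFunc g (power v) (power (power v)) ∧ rho v j g = w := S.rho_surj (mem_power.1 hw)

/-- Both sides are subsets of V_{η+2}, and all elements of V_{η+2} are values of `rho`. -/
theorem rho₃_ext {f w : M} (hw : w ∈ power (power (power v)))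
    (h : ∀ g, IsFunc g (power v) (power (power v)) →
      ((Ae v j fun k => val g k ∈ val f k) ↔ rho v j g ∈ w)) : rho₃ v j f = w := by
  refine ext fun y => ⟨fun hy => ?_, fun hy => ?_⟩
  · obtain ⟨g, hg, rfl⟩ := S.exists_rho (mem_power.1 (rho₃_mem v j f) y hy)
    exact (h g hg).1 ((S.rho_mem_rho₃ hg).1 hy)
  · obtain ⟨g, hg, rfl⟩ := S.exists_rho (mem_power.1 hw y hy)
    exact (S.rho_mem_rho₃ hg).2 ((h g hg).2 hy)

theorem rho₃_eq_rho {f : M} (hf : IsFunc f (power v) (power (power v))) :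
    rho₃ v j f = rho v j f :=
  S.rho₃_ext (S.good.power.power.mem_power_of_mem (S.rho_mem f))
    fun _ hg => (S.rho_mem_iff hg hf).symm

theorem rho₃_congr {f g : M} (h : Ae v j fun k => val f k = val g k) :
    rho₃ v j f = rho₃ v j g :=
  S.rho₃_ext (rho₃_mem _ _ _) fun i hi => by
    rw [S.rho_mem_rho₃ hi]
    exact ⟨fun h' => S.ae_mono (fun k _ h => by simpa only [h.1] using h.2) (S.ae_and.2 ⟨h, h'⟩),
      fun h' => S.ae_mono (fun k _ h => by simpa only [h.1] using h.2) (S.ae_and.2 ⟨h, h'⟩)⟩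

/-- Elements of functions into `V_{η+3}` are represented by functions into `V_{η+2}`. -/
theorem exists_retract_mem {f g : M} (hg : IsFunc g (power v) (power (power (power v))))
    (h : Ae v j fun k => val f k ∈ val g k) :
    ∃ f', IsFunc f' (power v) (power (power v)) ∧ Ae v j fun k => val f k = val f' k :=
  S.exists_retract (empty_mem_power _)
    (S.ae_mono (fun _ hk h => mem_power.1 (hg.val_mem hk) _ h) h)

/-- If almost everywhere uniformization holds, then the ultrapower of `V_{η+3}` is isomorphic to
a transitive subset of `V_{η+3}`. -/
theorem repr_rho₃ (hU : HasUnif v j (power (power v))) :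
    Repr v j (power (power (power v))) (rho₃ v j) := by
  have hsub : ∀ {f g}, IsFunc f (power v) (power (power (power v))) →
      IsFunc g (power v) (power (power (power v))) → rho₃ v j f = rho₃ v j g →
      Ae v j fun k => ∀ x, x ∈ val f k → x ∈ val g k := by
    intro f g hf hg hfg
    -- If `f(k) ⊆ g(k)` failed almost everywhere, a uniformization `h` of these differences would
    -- give an element `rho v j h` of `rho₃ v j f` outside `rho₃ v j g`.
    obtain ⟨R, hR⟩ := separation (fun p => ∃ k x, p = pr k x ∧ x ∈ val f k ∧ x ∉ val g k)
      (power (power v))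
    have hA := S.good.power.power
    have hR' : ∀ k x, k ∈ power v → x ∈ power (power v) →
        (pr k x ∈ R ↔ x ∈ val f k ∧ x ∉ val g k) := fun k x hk hx => by
      rw [hR]
      constructor
      · rintro ⟨_, k', x', h1, h2⟩
        rw [pr_eq] at h1
        rw [h1.1, h1.2]
        exact h2
      · exact fun h => ⟨hA.pr (hA.sub_of_mem (self_mem_power _) k hk) hx, k, x, rfl, h⟩
    obtain ⟨h, hh, hhR⟩ := hU R
    by_contra hne
    rw [← S.ae_not] at hne
    have key : Ae v j fun k => val h k ∈ val f k ∧ val h k ∉ val g k := by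
      refine S.ae_mono (fun k hk ⟨h1, h2⟩ => ?_) (S.ae_and.2 ⟨hne, hhR⟩)
      push Not at h1
      obtain ⟨x, hx, hx'⟩ := h1
      have hxA := mem_power.1 (hf.val_mem hk) x hx
      exact (hR' k _ hk (hh.val_mem hk)).1 (h2 ⟨x, hxA, (hR' k x hk hxA).2 ⟨hx, hx'⟩⟩)
    have h1 := (S.rho_mem_rho₃ hh).2 (S.ae_mono (fun k _ h => h.1) key)
    rw [hfg, S.rho_mem_rho₃ hh] at h1
    exact S.ae_not.1 (S.ae_mono (fun k _ h => h.2) key) h1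
  have heq : ∀ {f g}, IsFunc f (power v) (power (power (power v))) →
      IsFunc g (power v) (power (power (power v))) →
      (rho₃ v j f = rho₃ v j g ↔ Ae v j fun k => val f k = val g k) := fun hf hg =>
    ⟨fun h => S.ae_mono (fun k _ h => Sub.antisymm h.1 h.2)
      (S.ae_and.2 ⟨hsub hf hg h, hsub hg hf h.symm⟩), S.rho₃_congr⟩
  refine ⟨fun _ => rho₃_mem _ _ _, heq, fun {f g} hf hg => ⟨fun h => ?_, fun h => ?_⟩,
    fun {f z} hf hz => ?_⟩
  · obtain ⟨i, hi, hif⟩ := S.exists_rho (mem_power.1 (rho₃_mem v j g) _ h)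
    rw [← hif, S.rho_mem_rho₃ hi] at h
    rw [← S.rho₃_eq_rho hi, heq (S.isFunc_lift hi) hf] at hif
    exact S.ae_mono (fun k _ h => by rw [← h.1]; exact h.2) (S.ae_and.2 ⟨hif, h⟩)
  · obtain ⟨f', hf', hff'⟩ := S.exists_retract_mem hg h
    rw [S.rho₃_congr hff', S.rho₃_eq_rho hf', S.rho_mem_rho₃ hf']
    exact S.ae_mono (fun k _ h => by rw [← h.1]; exact h.2) (S.ae_and.2 ⟨hff', h⟩)
  · obtain ⟨g, hg, rfl⟩ := S.exists_rho (mem_power.1 (rho₃_mem v j f) z hz)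
    exact ⟨g, S.isFunc_lift hg, S.rho₃_eq_rho hg⟩

theorem sub₃ : Sub (power v) (power (power (power v))) := fun _ hx =>
  S.good.power.power.mem_power_of_mem (S.good.power.mem_power_of_mem hx)

theorem good₃ : Good (power (power (power v))) := S.good.power.power.power

/-- The collapse of the ultrapower of `V_{η+3}`. -/
theorem exists_collapse₃ (hU : HasUnif v j (power (power v))) :
    ∃ T C, IsCollapse (ult (power v) (power (power (power v))) (uf v j))
      (ultMem (power v) (power (power (power v))) (uf v j)) T C ∧
      (∀ y, y ∈ T ↔ ∃ f, IsFunc f (power v) (power (power (power v))) ∧ rho₃ v j f = y) ∧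
      ∀ x, x ∈ power (power (power v)) →
        app C (ultMap (power v) (power (power (power v))) (uf v j) x) = rho₃ v j (const v x) := by
  have h := S.repr_rho₃ hU
  obtain ⟨T, hT⟩ := separation
    (fun y => ∃ f, IsFunc f (power v) (power (power (power v))) ∧ rho₃ v j f = y)
    (power (power (power v)))
  have hT' : ∀ y, y ∈ T ↔ ∃ f, IsFunc f (power v) (power (power (power v))) ∧ rho₃ v j f = y :=
    fun y => (hT y).trans (and_iff_right_of_imp fun ⟨f, _, hf⟩ => hf ▸ rho₃_mem v j f)
  have hTt : IsTrans T := fun y hy z hz => by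
    obtain ⟨f, hf, rfl⟩ := (hT' y).1 hy
    exact (hT' z).2 (h.surj hf hz)
  obtain ⟨C, hC, hC'⟩ := exists_collapse S S.good₃ S.sub₃ (rho₃ v j) hTt
    (fun f hf => (hT' _).2 ⟨f, hf, rfl⟩) (fun y hy => (hT' y).1 hy)
    (fun f g hf hg => h.eq_iff hf hg) (fun f g hf hg => h.mem_iff hf hg)
  refine ⟨T, C, hC, hT', fun x hx => ?_⟩
  rw [ultMap_eq S S.good₃ S.sub₃ hx]
  exact hC' _ (isFunc_const' hx)

/-- The ultrapower of `V_{η+3}` is wellfounded. -/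
theorem isWellFd₃ : IsWellFd (ult (power v) (power (power (power v))) (uf v j))
    (ultMem (power v) (power (power (power v))) (uf v j)) := by
  have hA := S.good₃
  have hVA := S.sub₃
  intro X hX ⟨x, hx⟩
  by_contra! hmin
  -- Below each class in a set without minimal element there is another one represented by a
  -- function into V_{η+2}. This needs neither extensionality nor uniformization.
  have down : ∀ y, y ∈ X → ∃ g, IsFunc g (power v) (power (power v)) ∧
      uc v j (power (power (power v))) g ∈ X ∧
      ∀ f, IsFunc f (power v) (power (power (power v))) →
        y = uc v j (power (power (power v))) f → Ae v j fun k => val g k ∈ val f k := by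
    intro y hy
    obtain ⟨z, hz, hzy⟩ := hmin y hy
    obtain ⟨f, hf, rfl⟩ := (mem_ult S hA hVA).1 (hX y hy)
    obtain ⟨h, hh, rfl⟩ := (mem_ult S hA hVA).1 (hX z hz)
    rw [ultMem_iff S hA hVA hh hf] at hzy
    obtain ⟨g, hg, hhg⟩ := S.exists_retract_mem hf hzy
    have : uc v j (power (power (power v))) h = uc v j (power (power (power v))) g :=
      (uc_eq_iff S hA hVA hh (S.isFunc_lift hg)).2 hhg
    refine ⟨g, hg, this ▸ hz, fun f' hf' he => ?_⟩
    rw [uc_eq_iff S hA hVA hf hf'] at he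
    exact S.ae_mono (fun k _ h => by rw [← h.1.1, ← h.1.2]; exact h.2) (S.ae_and.2 ⟨S.ae_and.2 ⟨hhg, he⟩, hzy⟩)
  -- On such functions `rho` turns the relation of the ultrapower into true membership, so
  -- Foundation for the set of their values is contradicted.
  obtain ⟨Y, hY⟩ := separation (fun w => ∃ g, IsFunc g (power v) (power (power v)) ∧
    uc v j (power (power (power v))) g ∈ X ∧ rho v j g = w) (power (power v))
  obtain ⟨g, hg, hgX, -⟩ := down x hx
  obtain ⟨w, hw, hw'⟩ := ZFModel.foundation Y ⟨_, (hY _).2 ⟨S.rho_mem g, g, hg, hgX, rfl⟩⟩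
  obtain ⟨-, g, hg, hgX, rfl⟩ := (hY w).1 hw
  obtain ⟨h, hh, hhX, hhg⟩ := down _ hgX
  exact hw' _ ((hY _).2 ⟨S.rho_mem h, h, hh, hhX, rfl⟩)
    ((S.rho_mem_iff hh hg).2 (hhg g (S.isFunc_lift hg) rfl))

/-! ### Uniformization -/

/-- The class of `k ↦ R_k` is compared with the class of the constant function ∅. If they are equal,
almost every section is empty. Otherwise something separates them; it cannot belong to the second
class, so it belongs to the first, and a representative of it uniformizes `R`. -/
theorem hasUnif_of_isExtensional
    (h : IsExtensional (ult (power v) (power (power (power v))) (uf v j))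
      (ultMem (power v) (power (power (power v))) (uf v j))) :
    HasUnif v j (power (power v)) := by
  have hA := S.good₃
  have hVA := S.sub₃
  intro R
  have hf : IsFunc (mkFun (power v) (row (power (power v)) R)) (power v)
      (power (power (power v))) := isFunc_mkFun fun k _ => mem_power.2 (row_sub _ _ _)
  have h0 : IsFunc (const v empty) (power v) (power (power (power v))) :=
    isFunc_const' (empty_mem_power _)
  by_cases he : uc v j (power (power (power v))) (mkFun (power v) (row (power (power v)) R)) =
      uc v j (power (power (power v))) (const v empty)
  · refine ⟨_, isFunc_const' (v := v) (empty_mem_power (power v)), ?_⟩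
    rw [uc_eq_iff S hA hVA hf h0] at he
    refine S.ae_mono (fun k hk h ⟨x, hx, hR⟩ => ?_) he
    rw [val_mkFun hk, val_const hk] at h
    have := mem_row.2 ⟨hx, hR⟩
    rw [h] at this
    exact (not_mem_empty _ this).elim
  · obtain ⟨z, hz, hz'⟩ := h _ _ ((mem_ult S hA hVA).2 ⟨_, hf, rfl⟩)
      ((mem_ult S hA hVA).2 ⟨_, h0, rfl⟩) he
    obtain ⟨i, hi, rfl⟩ := (mem_ult S hA hVA).1 hz
    rw [ultMem_iff S hA hVA hi hf, ultMem_iff S hA hVA hi h0] at hz'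
    have hn : ¬ Ae v j fun k => val i k ∈ val (const v empty) k :=
      S.not_ae_of_forall fun k hk h => by
        rw [val_const hk] at h
        exact not_mem_empty _ h
    have hz := hz'.2 hn
    obtain ⟨g, hg, hig⟩ := S.exists_retract_mem hf hz
    refine ⟨g, hg, S.ae_mono (fun k hk ⟨h1, h2⟩ _ => ?_) (S.ae_and.2 ⟨hig, hz⟩)⟩
    rw [val_mkFun hk, mem_row, h1] at h2
    exact h2.2

/-- Almost every `k` is an elementary map, so relations and functions may be restricted to such `k`.
In the other direction the function is redefined as ∅ wherever its value is not in V_{η+2}. -/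
theorem hasUnif_iff : HasUnif v j (power (power v)) ↔
    ∀ R : M, (∀ p, p ∈ R → ∃ k x, k ∈ elemMaps v ∧ x ∈ power (power v) ∧ p = pr k x) →
      ∃ f, IsUniformization (elemMaps v) (uf v j) R f := by
  constructor
  · intro hU R hR
    obtain ⟨g, hg, h⟩ := hU R
    have hf : IsFunc (mkFun (elemMaps v) (val g)) (elemMaps v) (power (power v)) :=
      isFunc_mkFun fun k hk => hg.val_mem (elemMaps_sub S.good k hk)
    refine ⟨_, ⟨_, hf⟩, ?_⟩
    have key : Ae v j fun k => k ∈ elemMaps v ∧ ((∃ x, pr k x ∈ R) → pr k (val g k) ∈ R) := by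
      refine S.ae_mono (fun k hk h => ⟨h.1, fun ⟨x, hx⟩ => h.2 ⟨x, ?_, hx⟩⟩)
        (S.ae_and.2 ⟨S.ae_mem_elemMaps, h⟩)
      obtain ⟨k', x', _, hx', h'⟩ := hR _ hx
      exact (pr_inj h').2 ▸ hx'
    unfold Ae at key
    have : (theSet fun k => k ∈ power v ∧ k ∈ elemMaps v ∧
        ((∃ x, pr k x ∈ R) → pr k (val g k) ∈ R)) =
        theSet fun k => k ∈ elemMaps v ∧ ((∃ x, pr k x ∈ R) →
          pr k (app (mkFun (elemMaps v) (val g)) k) ∈ R) := theSet_congr fun k => by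
      constructor
      · rintro ⟨_, h1, h2⟩
        rw [app_mkFun h1]
        exact ⟨h1, h2⟩
      · rintro ⟨h1, h2⟩
        rw [app_mkFun h1] at h2
        exact ⟨elemMaps_sub S.good k h1, h1, h2⟩
    rwa [this] at key
  · intro h R
    classical
    obtain ⟨R', hR'⟩ := separation (fun p => ∃ k x, k ∈ elemMaps v ∧ x ∈ power (power v) ∧
      p = pr k x) R
    obtain ⟨f, ⟨b, hf⟩, hu⟩ := h R' fun p hp => ((hR' p).1 hp).2
    have hmem : ∀ k y, pr k y ∈ R' ↔ pr k y ∈ R ∧ k ∈ elemMaps v ∧ y ∈ power (power v) := by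
      intro k y
      rw [hR']
      constructor
      · rintro ⟨h1, k', y', h2, h3, h4⟩
        rw [pr_eq] at h4
        rw [h4.1, h4.2] at h1 ⊢
        exact ⟨h1, h2, h3⟩
      · rintro ⟨h1, h2, h3⟩
        exact ⟨h1, k, y, h2, h3, rfl⟩
    have key : Ae v j fun k => k ∈ elemMaps v ∧ ((∃ x, pr k x ∈ R') → pr k (val f k) ∈ R') := by
      have : (theSet fun k => k ∈ power v ∧ k ∈ elemMaps v ∧
          ((∃ x, pr k x ∈ R') → pr k (val f k) ∈ R')) =
          theSet fun k => k ∈ elemMaps v ∧ ((∃ x, pr k x ∈ R') → pr k (app f k) ∈ R') :=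
        theSet_congr fun k => by
          constructor
          · rintro ⟨_, h1, h2⟩
            rw [hf.val_eq h1] at h2
            exact ⟨h1, h2⟩
          · rintro ⟨h1, h2⟩
            rw [← hf.val_eq h1] at h2
            exact ⟨elemMaps_sub S.good k h1, h1, h2⟩
      unfold Ae
      rwa [this]
    refine ⟨mkFun (power v) fun k => if val f k ∈ power (power v) then val f k else empty,
      isFunc_mkFun fun k _ => ?_, S.ae_mono (fun k hk ⟨h1, h2⟩ ⟨x, hx, hR⟩ => ?_) key⟩
    · split_ifs with h
      exacts [h, empty_mem_power _]
    · have := (hmem _ _).1 (h2 ⟨x, (hmem k x).2 ⟨hR, h1, hx⟩⟩)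
      rw [val_mkFun hk, if_pos this.2.2]
      exact this.1

theorem isExtensional_iff : IsExtensional (ult (power v) (power (power (power v))) (uf v j))
      (ultMem (power v) (power (power (power v))) (uf v j)) ↔
    HasUnif v j (power (power v)) :=
  ⟨S.hasUnif_of_isExtensional, fun hU => by
    obtain ⟨_, _, h, _⟩ := S.exists_collapse₃ hU
    exact h.isExtensional⟩

/-! ### Extensions of `j` -/

/-- The extension is the ultrapower map followed by the collapse; Łoś's theorem gives its
elementarity, and on V_{η+2} it agrees with `rho` of constant functions, that is, with `j`. -/
theorem exists_extension (hU : HasUnif v j (power (power v))) :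
    ∃ l, Elem0 (power (power (power v))) l ∧ ∀ x, x ∈ power (power v) → val l x = val j x := by
  have hl : IsFunc (mkFun (power (power (power v))) fun x => rho₃ v j (const v x))
      (power (power (power v))) (power (power (power v))) :=
    isFunc_mkFun fun _ _ => rho₃_mem _ _ _
  refine ⟨_, (S.repr_rho₃ hU).elem0 S S.good.power.power
    (S.good.power.power.sub_of_mem (self_mem_power _)) hU hl fun x hx => val_mkFun hx,
    fun x hx => ?_⟩
  rw [val_mkFun (S.good.power.power.mem_power_of_mem hx), S.rho₃_eq_rho (isFunc_const' hx), const,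
    S.rho_const (mem_power.1 hx)]

section
variable (hl : Elem0 (power (power (power v))) l)
  (hlj : ∀ x, x ∈ power (power v) → val l x = val j x)
include hl hlj

/-- Elements of the image are subsets of V_{η+1}, which is fixed. Conversely, V_{η+2} contains all
sections of a relation, hence its image contains the section of any `j(F)` at the seed, and these
exhaust V_{η+2}. -/
theorem map_power_power : val l (power (power v)) = power (power v) := by
  have hA := S.good₃
  have h2 := fun x hx => S.good.power.power.mem_power_of_mem (x := x) hx
  have h21 := h2 _ (self_mem_power (power v))
  have h1 : val l (power v) = power v := (hlj _ (self_mem_power _)).trans S.fix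
  refine Sub.antisymm (fun u hu => ?_) fun w hw => ?_
  · have := (hl.elem2 (fun a b => ∀ u, u ∈ a → Sub u b) (self_mem_power _) h21).1
      fun u => mem_power.1
    rw [h1] at this
    exact mem_power.2 (this u hu)
  · obtain ⟨f, hf, rfl⟩ := S.exists_rho hw
    have hc := mem_power.2 (code_sub v f)
    have := (hl.elem3 (fun a b F => ∀ k, k ∈ b → ∃ u, u ∈ a ∧ u = row b F k) (self_mem_power _) h21
      (h2 _ hc)).1 fun k hk => ⟨_, mem_power.2 (row_sub _ _ _), rfl⟩
    rw [h1, hlj _ hc] at this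
    obtain ⟨u, hu, rfl⟩ := this _ S.seed_mem
    exact hu

/-- The argument of `ae_elem` with parameters from V_{η+3}: the set of the relevant `k` is still in
V_{η+2}, where `l` agrees with `j`. -/
theorem ae_elem_ext (Q : M → M → M → M → M → Prop)
    [D0 M fun e : (((((PUnit.{u + 1} × M) × M) × M) × M) × M) × M =>
      Q e.2 e.1.1.1.1.2 e.1.1.1.2 e.1.1.2 e.1.2]
    {a b c : M} [Df₁ M fun k => Q k a b c (power v)] (ha : a ∈ power (power (power v)))
    (hb : b ∈ power (power (power v))) (hc : c ∈ power (power (power v))) :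
    Ae v j (fun k => Q k a b c (power v)) ↔
      Q (restrict j v) (val l a) (val l b) (val l c) (power v) := by
  rw [S.ae_iff]
  have hs := fun k => mem_sep (P := fun k => Q k a b c (power v)) (a := power v) k
  have hσ : (theSet fun k => k ∈ power v ∧ Q k a b c (power v)) ∈ power (power v) :=
    mem_power.2 fun k hk => ((hs k).1 hk).1
  have h2 := fun x hx => S.good.power.power.mem_power_of_mem (x := x) hx
  have := (hl.elem5 (fun σ a b c u => (∀ k, k ∈ σ → k ∈ u ∧ Q k a b c u) ∧
    ∀ k, k ∈ u → Q k a b c u → k ∈ σ) (h2 _ hσ) ha hb hc (h2 _ (self_mem_power _))).1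
    ⟨fun k hk => (hs k).1 hk, fun k h h' => (hs k).2 ⟨h, h'⟩⟩
  rw [hlj _ hσ, hlj _ (self_mem_power _), S.fix] at this
  exact ⟨fun h => (this.1 _ h).2, fun h => this.2 _ S.seed_mem h⟩

theorem ae_pr_mem {f R : M} (hf : IsFunc f (power v) (power (power v)))
    (hR : R ∈ power (power (power v))) :
    (Ae v j fun k => pr k (val f k) ∈ R) ↔ pr (restrict j v) (rho v j f) ∈ val l R := by
  have hc := mem_power.2 (code_sub v f)
  have h2 := fun x hx => S.good.power.power.mem_power_of_mem (x := x) hx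
  have := S.ae_elem_ext hl hlj (fun k R F V u => ∃ x, x ∈ V ∧ (x = row u F k ∧ pr k x ∈ R)) hR
    (h2 _ hc) (self_mem_power _)
  rw [S.map_power_power hl hlj, hlj _ hc] at this
  refine (S.ae_congr fun k hk => ?_).trans (this.trans ?_)
  · rw [S.row_code hf hk]
    exact ⟨fun h => ⟨_, hf.val_mem hk, rfl, h⟩, fun ⟨_, _, h, h'⟩ => h ▸ h'⟩
  · exact ⟨fun ⟨_, _, h, h'⟩ => by rw [h] at h'; exact h', fun h => ⟨_, S.rho_mem f, rfl, h⟩⟩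

/-- As in `hasUnif_power`, with `l(R')` in place of `j(R')`. Invariance of V_{η+2} ensures that a
section with no element in V_{η+2} corresponds to almost all sections being empty there. -/
theorem hasUnif_of_extension : HasUnif v j (power (power v)) := by
  intro R
  have hA := S.good.power.power
  obtain ⟨R', hR'⟩ := separation (fun p => p ∈ R) (power (power v))
  have hR's : R' ∈ power (power (power v)) := mem_power.2 fun p hp => ((hR' p).1 hp).1
  have hmem : ∀ k x, k ∈ power v → x ∈ power (power v) → (pr k x ∈ R' ↔ pr k x ∈ R) :=
    fun k x hk hx => by
      rw [hR']
      exact and_iff_right (hA.pr (hA.sub_of_mem (self_mem_power _) k hk) hx)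
  by_cases hx : ∃ x, x ∈ power (power v) ∧ pr (restrict j v) x ∈ val l R'
  · obtain ⟨x, hx, hx'⟩ := hx
    obtain ⟨f, hf, rfl⟩ := S.exists_rho hx
    rw [← S.ae_pr_mem hl hlj hf hR's] at hx'
    exact ⟨f, hf, S.ae_mono (fun k hk h _ => (hmem k _ hk (hf.val_mem hk)).1 h) hx'⟩
  · have := S.ae_elem_ext hl hlj (fun k R V _ _ => ¬ ∃ x, x ∈ V ∧ pr k x ∈ R) hR's
      (self_mem_power _) (empty_mem_power _)
    rw [S.map_power_power hl hlj] at this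
    refine ⟨_, isFunc_const' (v := v) (empty_mem_power _), S.ae_mono (fun k hk h h' => ?_)
      (this.2 hx)⟩
    obtain ⟨x, hx, hR⟩ := h'
    exact (h ⟨x, hx, (hmem k x hk hx).2 hR⟩).elim

/-- Membership of `rho v j g` in `l(x)` is decided by the seed, hence by whether `g(k) ∈ x` for
almost all `k`. In particular `j` has at most one extension. -/
theorem extension_eq {x : M} (hx : x ∈ power (power (power v))) :
    val l x = rho₃ v j (const v x) := by
  symm
  have h2 := fun x hx => S.good.power.power.mem_power_of_mem (x := x) hx
  refine S.rho₃_ext (hl.mem hx) fun g hg => ?_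
  have hc := mem_power.2 (code_sub v g)
  have := S.ae_elem_ext hl hlj (fun k F x _ u => ∃ y, y ∈ x ∧ y = row u F k) (h2 _ hc) hx
    (self_mem_power _)
  rw [hlj _ hc] at this
  refine (S.ae_congr fun k hk => ?_).trans (this.trans ?_)
  · rw [S.row_code hg hk, val_const hk]
    simp
  · change _ ↔ row (power v) (val j (code v g)) (restrict j v) ∈ val l x
    simp

/-- Any extension of `j` is the ultrapower map. -/
theorem extension_collapse :
    ∃ T C, IsCollapse (ult (power v) (power (power (power v))) (uf v j))
      (ultMem (power v) (power (power (power v))) (uf v j)) T C ∧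
      Sub (power (power v)) T ∧ T ≠ power (power v) ∧ Sub T (power (power (power v))) ∧
      ∀ x, x ∈ power (power (power v)) →
        app C (ultMap (power v) (power (power (power v))) (uf v j) x) = app l x := by
  obtain ⟨T, C, hC, hT, hC'⟩ := S.exists_collapse₃ (S.hasUnif_of_extension hl hlj)
  refine ⟨T, C, hC, fun w hw => ?_, fun h => ?_, fun y hy => ?_, fun x hx => ?_⟩
  · obtain ⟨f, hf, rfl⟩ := S.exists_rho hw
    exact (hT _).2 ⟨f, S.isFunc_lift hf, S.rho₃_eq_rho hf⟩
  -- Properness: `T` contains the value at V_{η+2} of the ultrapower map, which is V_{η+2} itself.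
  · have : power (power v) ∈ T := (hT _).2 ⟨_, isFunc_const' (v := v) (self_mem_power _), by
      rw [← S.extension_eq hl hlj (self_mem_power _), S.map_power_power hl hlj]⟩
    rw [h] at this
    exact not_mem_self _ this
  · obtain ⟨f, hf, rfl⟩ := (hT y).1 hy
    exact rho₃_mem v j f
  · rw [hC' x hx, ← S.extension_eq hl hlj hx, hl.func.val_eq hx]

end
end Setting
end

end ZFM



/-! ### The main theorem. -/

namespace ZFM

/-- The hypotheses on `j`, as used in the proofs. -/
theorem setting_of_isElemFor {M : Type u} [ZFModel M] {η v j : M} (hη : IsInfEven η)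
    (hv : IsVLevel η v) (hj : IsElemFor IsSigma0 (power (power v)) j)
    (hjv : app j (power v) = power v) : Setting v j := by
  have hg := hv.good hη
  have hj' := (elem0_iff hg.power.power).2 hj
  have hfix : val j (power v) = power v := by rw [hj.1.val_eq (self_mem_power _), hjv]
  exact ⟨hg, hj', hfix, represents_even hj' hη hv ⟨hg, self_mem_power _, hfix⟩⟩

end ZFM

theorem lemma4p3 {M : Type*} [ZFM.ZFModel M]
    (η V₀ V₁ V₂ V₃ j μ : M)
    (hη : ZFM.IsInfEven η)
    -- `V₀ = V_η`, `V₁ = V_{η+1}`, `V₂ = V_{η+2}`, `V₃ = V_{η+3}`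
    (hV₀ : ZFM.IsVLevel η V₀)
    (hV₁ : V₁ = ZFM.power V₀) (hV₂ : V₂ = ZFM.power V₁) (hV₃ : V₃ = ZFM.power V₂)
    -- `j : V_{η+2} → V_{η+2}` is `Σ₀`-elementary
    (hj : ZFM.IsElemFor ZFM.IsSigma0 V₂ j)
    (hjV₁ : ZFM.app j V₁ = V₁)
    -- `μ = μ_j` is the ultrafilter over `V_{η+1}` derived from `j` with seed `j ↾ V_η`
    (hμ : μ = ZFM.derivedUF V₁ j (ZFM.restrict j V₀)) :
    -- `U = Ult(V_{η+2}, μ)` is extensional and wellfounded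
    ZFM.IsExtensional (ZFM.ult V₁ V₂ μ) (ZFM.ultMem V₁ V₂ μ) ∧
    ZFM.IsWellFd (ZFM.ult V₁ V₂ μ) (ZFM.ultMem V₁ V₂ μ) ∧
    -- its transitive collapse is `V_{η+2}`, and the ultrapower map becomes `j`
    (∃ π : M, ZFM.IsCollapse (ZFM.ult V₁ V₂ μ) (ZFM.ultMem V₁ V₂ μ) V₂ π ∧
      ∀ x : M, x ∈ V₂ → ZFM.app π (ZFM.ultMap V₁ V₂ μ x) = ZFM.app j x) ∧
    -- the hull of `rg(j) ∪ {j ↾ V_η}` in `V_{η+2}` is `V_{η+2}`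
    ZFM.hull V₂ (ZFM.theSet fun y : M =>
      (∃ x : M, x ∈ V₂ ∧ y = ZFM.app j x) ∨ y = ZFM.restrict j V₀) = V₂ ∧
    -- `j` is `Σ₁`-elementary
    ZFM.IsElemFor ZFM.IsSigma1 V₂ j ∧
    -- `Ult(V_{η+3}, μ)` is wellfounded
    ZFM.IsWellFd (ZFM.ult V₁ V₃ μ) (ZFM.ultMem V₁ V₃ μ) ∧
    -- it is extensional iff `j` extends to a `Σ₀`-elementary `ℓ : V_{η+3} → V_{η+3}`
    (ZFM.IsExtensional (ZFM.ult V₁ V₃ μ) (ZFM.ultMem V₁ V₃ μ) ↔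
      ∃ ℓ : M, ZFM.IsElemFor ZFM.IsSigma0 V₃ ℓ ∧
        ∀ x : M, x ∈ V₂ → ZFM.app ℓ x = ZFM.app j x) ∧
    -- iff every `R ⊆ ℰ(V_η) × V_{η+2}` has a `μ`-uniformization
    (ZFM.IsExtensional (ZFM.ult V₁ V₃ μ) (ZFM.ultMem V₁ V₃ μ) ↔
      ∀ R : M, (∀ p : M, p ∈ R → ∃ k x : M, k ∈ ZFM.elemMaps V₀ ∧ x ∈ V₂ ∧ p = ZFM.pr k x) →
        ∃ f : M, ZFM.IsUniformization (ZFM.elemMaps V₀) μ R f) ∧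
    -- any such extension `ℓ` is the ultrapower map, and fixes `V_{η+2}`; the transitive collapse
    -- `T` of the ultrapower satisfies `V_{η+2} ⊊ T ⊆ V_{η+3}`
    (∀ ℓ : M, ZFM.IsElemFor ZFM.IsSigma0 V₃ ℓ →
      (∀ x : M, x ∈ V₂ → ZFM.app ℓ x = ZFM.app j x) →
      (∃ T π : M, ZFM.IsCollapse (ZFM.ult V₁ V₃ μ) (ZFM.ultMem V₁ V₃ μ) T π ∧
        ZFM.Sub V₂ T ∧ T ≠ V₂ ∧ ZFM.Sub T V₃ ∧
        ∀ x : M, x ∈ V₃ → ZFM.app π (ZFM.ultMap V₁ V₃ μ x) = ZFM.app ℓ x) ∧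
      ZFM.app ℓ V₂ = V₂) := by
  subst hV₁ hV₂ hV₃ hμ
  have S := ZFM.setting_of_isElemFor hη hV₀ hj hjV₁
  have hA := S.good₃
  obtain ⟨C, hC, hC'⟩ := S.exists_collapse₂
  have hext : ∀ l, ZFM.IsElemFor ZFM.IsSigma0 (ZFM.power (ZFM.power (ZFM.power V₀))) l →
      (∀ x, x ∈ ZFM.power (ZFM.power V₀) → ZFM.app l x = ZFM.app j x) →
      ZFM.Elem0 (ZFM.power (ZFM.power (ZFM.power V₀))) l ∧
        ∀ x, x ∈ ZFM.power (ZFM.power V₀) → ZFM.val l x = ZFM.val j x := fun l hl hlj =>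
    ⟨(ZFM.elem0_iff hA).2 hl, fun x hx => by
      rw [hl.1.val_eq (S.good.power.power.mem_power_of_mem hx), hj.1.val_eq hx, hlj x hx]⟩
  refine ⟨hC.isExtensional, hC.isWellFd, ⟨C, hC, hC'⟩, S.hull_eq, S.elem1, S.isWellFd₃, ?_,
    S.isExtensional_iff.trans S.hasUnif_iff, fun l hl hlj => ?_⟩
  · rw [← ZFM.uf, S.isExtensional_iff]
    constructor
    · intro hU
      obtain ⟨l, hl, hlj⟩ := S.exists_extension hU
      refine ⟨l, (ZFM.elem0_iff hA).1 hl, fun x hx => ?_⟩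
      rw [← hl.func.val_eq (S.good.power.power.mem_power_of_mem hx), hlj x hx, hj.1.val_eq hx]
    · rintro ⟨l, hl, hlj⟩
      obtain ⟨h1, h2⟩ := hext l hl hlj
      exact S.hasUnif_of_extension h1 h2
  · obtain ⟨h1, h2⟩ := hext l hl hlj
    refine ⟨S.extension_collapse h1 h2, ?_⟩
    rw [← hl.1.val_eq (ZFM.self_mem_power _), S.map_power_power h1 h2]
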